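/- Throughout, $A$ is a finite alphabet. A (copyless) substitution over a finite set of variables $\mathcal X$ is a map $\sigma:\mathcal X\to(\mathcal X\cup A)^*$ such that each variable occurs at most once in all the words $\sigma(X)$, $X\in\mathcal X$, together; it is extended morphically to $(\mathcal X\cup A)^*$. A streaming string transducer (SST) $T$ consists of a finite automaton over $A$ (nondeterministic, with sets of initial and final states), a finite set $\mathcal X$ of variables, a final variable $O\in\mathcal X$, a substitution $\kappa(\delta)$ for each transition $\delta$, and a substitution $\kappa_F(q)$ for each state $q$. An accepting run with transitions $\delta_1\cdots\delta_n$ and last state $q_n$ yields the sequence $\lambda=\kappa(\delta_1)\cdots\kappa(\delta_n)\,\kappa_F(q_n)$. For a sequence $\lambda=\sigma_1\cdots\sigma_N$ of substitutions, its output $\mathrm{out}(\lambda)$ is the word obtained from $(\sigma_1\circ\cdots\circ\sigma_N)(O)$ by deleting all variables. The transduction $R(T)$ is the set of pairs (input word, output) of the accepting runs of $T$. $T$ is functional if $R(T)$ is a (partial) function, and deterministic if its automaton has exactly one initial state and exactly one transition for each state and letter. Write $T\equiv T'$ if $R(T)=R(T')$. The origin of a position of $\mathrm{out}(\lambda)$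 is the index $t$ of the substitution $\sigma_t$ that produced the letter there, and $\mathrm{weight}_{j,t}(\lambda)$ is the number of positions $i\le j$ of $\mathrm{out}(\lambda)$ with origin at most $t$. The primitive root of a word $u$ is the shortest word $w$ with $u=w^n$ for some $n\ge1$. For $\ell>0$, the $\ell$-factorization of a word cuts it from left to right into factors, each of which is the longest prefix of the remaining word whose primitive root has length at most $\ell$; $\mathrm{cut}_\ell(u)$ is the set of end positions of the factors of $u$. For two sequences $\lambda,\mu$ (possibly over different sets of variables) of the same length $N$ and with the same output, let $$\mathrm{delay}_\ell(\lambda,\mu)=\max_{j\in\mathrm{cut}_\ell(\mathrm{out}(\lambda))}\ \max_{1\le t\le N}\ \bigl|\mathrm{weight}_{j,t}(\lambda)-\mathrm{weight}_{j,t}(\mu)\bigr|$$ (and $0$ if the output is empty). $T_1$ is $(k,\ell)$-included in $T_2$ if for every accepting run of $T_1$, with input $u$ and sequence $\lambda$, there is an accepting run of $T_2$ over the same input $u$ whose sequence $\mu$ has the same length and the same output as $\lambda$ and satisfies $\mathrm{delay}_\ell(\lambda,\mu)\le k$. Write $T_1\equiv_{k,\ell}T_2$ if each of $T_1,T_2$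 is $(k,\ell)$-included in the other. **Corollary.** Let $T$ be a functional SST and $m$ a non-negative integer. There exist integers $k\ge0$ and $\ell>0$ such that 1. there exists a functional SST $T'$ with $m$ variables such that $T\equiv T'$ if and only if there exists a functional SST $T''$ with $m$ variables such that $T\equiv_{k,\ell}T''$; and 2. there exists a deterministic SST $T'$ with $m$ variables such that $T\equiv T'$ if and only if there exists a deterministic SST $T''$ with $m$ variables such that $T\equiv_{k,\ell}T''$. (Nothing is claimed about the computability of $k$ and $\ell$.) -/

import Mathlib

universe u v w

/-! ## Substitutions -/

/-- Functions from the variables `X` to words over variables and letters. -/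
abbrev Subst (X : Type v) (A : Type u) : Type (max u v) := X → List (X ⊕ A)

namespace Subst

variable {X : Type v} {A : Type u}

/-- The list of the occurrences of variables in a word over variables and letters. -/
def varsOf (z : List (X ⊕ A)) : List X := z.filterMap Sum.getLeft?

/-- The word of letters that is left when all variables are replaced by the empty word. -/
def eraseVars (z : List (X ⊕ A)) : List A := z.filterMap Sum.getRight?

/-- No variable appears twice in the image of a variable, and no variable appears in the images
of two distinct variables. -/
def Copyless (σ : Subst X A) : Prop :=
  (∀ x, (varsOf (σ x)).Nodup) ∧ ∀ x y, x ≠ y → List.Disjoint (varsOf (σ x)) (varsOf (σ y))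

/-- The morphic extension of a substitution to words: letters are kept. -/
def hat (σ : Subst X A) (z : List (X ⊕ A)) : List (X ⊕ A) :=
  z.flatMap (Sum.elim σ (fun a => [Sum.inr a]))

/-- The identity substitution. -/
def ident : Subst X A := fun x => [Sum.inl x]

/-- The composition `σ ∘ τ`: first `τ` is applied, then `σ`. -/
def comp (σ τ : Subst X A) : Subst X A := fun x => hat σ (τ x)

/-- The composition `σ₁ ∘ σ₂ ∘ ⋯ ∘ σₙ` of a sequence of substitutions. -/
def compSeq (s : List (Subst X A)) : Subst X A := s.foldr comp ident

/-- The output `(σ_ε ∘ σ₁ ∘ ⋯ ∘ σₙ)(O)` of a sequence of substitutions, where `σ_ε` maps every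
variable to the empty word. -/
def output (O : X) (s : List (Subst X A)) : List A := eraseVars (compSeq s O)

/-! ## Origins and weights -/

/-- The sequence in which every letter of the `t`-th substitution (counted from `1`) is replaced by
the number `t`. -/
def stamp (s : List (Subst X A)) : List (Subst X ℕ) :=
  s.mapIdx (fun i σ x => (σ x).map (Sum.map id (fun _ => i + 1)))

/-- The origins of the output positions, listed from left to right: the `j`-th entry is the index
of the substitution that produces the `j`-th output letter. -/
def originWord (O : X) (s : List (Subst X A)) : List ℕ := output O (stamp s)

/-- The number of output positions `i ≤ j` whose origin is at most `t`. -/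
def weight (O : X) (j t : ℕ) (s : List (Subst X A)) : ℕ :=
  ((originWord O s).take j).countP (fun o => decide (o ≤ t))

end Subst

/-! ## Periodic factors and cuts -/

section Cuts

variable {A : Type u}

/-- The length of the primitive root of `z`, the shortest word `y` such that `z = y ^ n` for some
positive `n`. -/
noncomputable def rootLength (z : List A) : ℕ :=
  sInf {p | ∃ (y : List A) (n : ℕ), 0 < n ∧ z = (List.replicate n y).flatten ∧ y.length = p}

open Classical in
/-- The length of the longest prefix of `z` whose primitive root has length at most `l`. -/
noncomputable def factorLength (l : ℕ) (z : List A) : ℕ :=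
  Nat.findGreatest (fun n => rootLength (z.take n) ≤ l) z.length

/-- The `l`-factorization of a word: each factor is the longest prefix of the remaining word whose
primitive root has length at most `l`. For `l > 0` and a non-empty word, that prefix is non-empty,
so that the maximum with `1` only makes the definition total in the meaningless case `l = 0`. -/
noncomputable def factors (l : ℕ) : List A → List (List A)
  | [] => []
  | a :: z =>
    (a :: z).take (max 1 (factorLength l (a :: z))) ::
      factors l ((a :: z).drop (max 1 (factorLength l (a :: z))))
  termination_by z => z.length
  decreasing_by
    simp only [List.length_drop, List.length_cons]
    omega

/-- The `l`-cuts of a word: the end positions of the factors of its `l`-factorization. -/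
noncomputable def cuts (l : ℕ) (z : List A) : Finset ℕ :=
  (Finset.Icc 1 (factors l z).length).image (fun i => ((factors l z).take i).flatten.length)

end Cuts

/-! ## Delay -/

namespace Subst

variable {X : Type v} {Y : Type w} {A : Type u}

/-- The absolute difference of the weights of two sequences at output position `j` and time `t`. -/
def diff (O : X) (P : Y) (j t : ℕ) (s : List (Subst X A)) (r : List (Subst Y A)) : ℕ :=
  ((weight O j t s : ℤ) - (weight P j t r : ℤ)).natAbs

/-- The maximum of the weight differences at output position `j` over all times. -/
def maxDiff (O : X) (P : Y) (j : ℕ) (s : List (Subst X A)) (r : List (Subst Y A)) : ℕ :=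
  (Finset.Icc 1 s.length).sup (fun t => diff O P j t s r)

/-- The `l`-delay: the maximum of `maxDiff` over the `l`-cuts of the output (`0` if there is no
cut, that is, if the output is empty). It is meant for sequences of equal length and output. -/
noncomputable def delay (O : X) (P : Y) (l : ℕ) (s : List (Subst X A)) (r : List (Subst Y A)) :
    ℕ :=
  (cuts l (output O s)).sup (fun j => maxDiff O P j s r)

/-- The delay resynchronizer: the pairs of sequences of the same length and with the same output
whose `l`-delay is at most `k`. -/
def delayResync (O : X) (P : Y) (k l : ℕ) : Set (List (Subst X A) × List (Subst Y A)) :=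
  {p | p.1.length = p.2.length ∧ output O p.1 = output P p.2 ∧ delay O P l p.1 p.2 ≤ k}

end Subst

/-! ## Streaming string transducers -/

/-- A (copyless, nondeterministic) streaming string transducer with input and output alphabet `A`.
The values of `upd` matter only on the transitions of the underlying automaton. -/
structure SST (A : Type u) where
  /-- the states -/
  State : Type
  /-- the variables -/
  Var : Type
  finite_state : Finite State
  finite_var : Finite Var
  /-- the underlying automaton -/
  aut : NFA A State
  /-- the final variable -/
  outVar : Var
  /-- the output function on transitions -/
  upd : State → A → State → Subst Var A
  upd_copyless : ∀ p a q, q ∈ aut.step p a → (upd p a q).Copyless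
  /-- the final output function -/
  fin : State → Subst Var A
  fin_copyless : ∀ q, (fin q).Copyless

namespace SST

variable {A : Type u}

/-- `T.Run p z s q`: there is a run of `T` from `p` to `q` with input `z` along which the sequence
of substitutions `s` occurs. -/
inductive Run (T : SST A) : T.State → List A → List (Subst T.Var A) → T.State → Prop
  | nil (q : T.State) : Run T q [] [] q
  | cons {p q r : T.State} {a : A} {z : List A} {s : List (Subst T.Var A)} :
      q ∈ T.aut.step p a → Run T q z s r → Run T p (a :: z) (T.upd p a q :: s) r

/-- The pairs of an input word and the sequence of substitutions, the final one included, of an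
accepting run over it. -/
def lang (T : SST A) : Set (List A × List (Subst T.Var A)) :=
  {c | ∃ p ∈ T.aut.start, ∃ q ∈ T.aut.accept, ∃ s, T.Run p c.1 s q ∧ c.2 = s ++ [T.fin q]}

/-- The transduction recognized by `T`. -/
def rel (T : SST A) : Set (List A × List A) :=
  {c | ∃ s, (c.1, s) ∈ T.lang ∧ c.2 = Subst.output T.outVar s}

/-- The transduction is a (partial) function. -/
def Functional (T : SST A) : Prop :=
  ∀ z y y', (z, y) ∈ T.rel → (z, y') ∈ T.rel → y = y'

/-- The underlying automaton is deterministic: one initial state, and the transitions form a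
function of the state and the letter. -/
def Deterministic (T : SST A) : Prop :=
  (∃ q, T.aut.start = {q}) ∧ ∀ p a, ∃ q, T.aut.step p a = {q}

/-- The number of variables. -/
noncomputable def numVars (T : SST A) : ℕ := Nat.card T.Var

/-- Two transducers are equivalent if they recognize the same transduction. -/
def Equivalent (T₁ T₂ : SST A) : Prop := T₁.rel = T₂.rel

/-- `(k, l)`-inclusion: the substitution sequence of every accepting run of `T₁` is related by the
delay resynchronizer to that of some accepting run of `T₂` over the same input. -/
def DelayIncluded (k l : ℕ) (T₁ T₂ : SST A) : Prop :=
  ∀ z s, (z, s) ∈ T₁.lang →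
    ∃ r, (z, r) ∈ T₂.lang ∧ (s, r) ∈ Subst.delayResync T₁.outVar T₂.outVar k l

/-- `(k, l)`-equivalence: `(k, l)`-inclusion in both directions. -/
def DelayEquivalent (k l : ℕ) (T₁ T₂ : SST A) : Prop :=
  DelayIncluded k l T₁ T₂ ∧ DelayIncluded k l T₂ T₁

end SST

/-! Since `k` and `l` may depend on `T` and `m` in any way, it is enough to bound the delay between
two fixed equivalent functional transducers. If some transducer with `m` variables is equivalent to
`T`, then it is itself delay equivalent to `T` for suitable `k` and `l`
(`SST.exists_delayEquivalent`); if there is none, both sides of the equivalence fail, because delay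
equivalence implies equivalence. The bound even holds for all pairs of accepting runs over the same
input (`SST.exists_delayResync`).

Fix two such runs and a position `j` of their common output. At every time the cut `j` has a place
in the word that describes the output in terms of the current variables (`Subst.Frame`), and the
letters to its left in that word are those still to be written. So the difference of the weights is
a difference of two letter counts, which starts at 0 and grows by bounded steps. If it becomes
large, it passes many levels. Record for both runs the states, the variables on either side of the
cut and a finite class of the substitutions. A semigroup version of Brown's lemma
(`exists_consecutive_idempotent`) then yields many consecutive loops of one idempotent type, whose
number is as large as desired in terms of the gaps between them.

Pumping the middle loop turns the outputs into words `a₁ b₁ⁿ a₂ b₂ⁿ ⋯`. Both runs produce the same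
words, but left of the cut one of them grows by `δ` more letters per iteration. Every block that
could compensate for this is separated from the cut by many letters, because each of the other loops
writes a letter in between. Hence the unpumped output is periodic on a long window around `j`, with
a period that divides `δ` (`period_of_slope`).

The number `δ` is not bounded independently of the window. Inserting a second loop of the same type
whose gain `d` is bounded gives another period, a divisor of `δ + d`; by the theorem of Fine and
Wilf the gcd of both is a period, and it divides `d` (`SST.exists_small_period`). So a large weight
difference at `j` forces a long factor of small period centred at `j`, and such a `j` is not an
`l`-cut for suitable `l` (`not_mem_cuts_of_period`). -/

/-! ## Powers of words and periodic continuations -/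

section Words

variable {A : Type*}

/-- The `n`-th power of a word. -/
def wordPow (w : List A) (n : ℕ) : List A := (List.replicate n w).flatten

@[simp] lemma wordPow_zero (w : List A) : wordPow w 0 = [] := by simp [wordPow]

lemma wordPow_succ (w : List A) (n : ℕ) : wordPow w (n + 1) = w ++ wordPow w n := by
  simp [wordPow, List.replicate_succ]

lemma wordPow_succ' (w : List A) (n : ℕ) : wordPow w (n + 1) = wordPow w n ++ w := by
  simp [wordPow, List.replicate_succ']

@[simp] lemma wordPow_nil (n : ℕ) : wordPow ([] : List A) n = [] := by simp [wordPow]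

@[simp] lemma wordPow_one (w : List A) : wordPow w 1 = w := by simp [wordPow]

@[simp] lemma length_wordPow (w : List A) (n : ℕ) : (wordPow w n).length = n * w.length := by
  simp [wordPow]

/-- The factor of length `n` of the infinite word `e` that starts at position `s`. -/
def seg (e : ℕ → A) (s n : ℕ) : List A := (List.range n).map (fun i => e (s + i))

@[simp] lemma length_seg (e : ℕ → A) (s n : ℕ) : (seg e s n).length = n := by simp [seg]

lemma getElem?_seg (e : ℕ → A) (s n i : ℕ) (h : i < n) : (seg e s n)[i]? = some (e (s + i)) := by
  simp [seg, h]

lemma seg_add (e : ℕ → A) (s m n : ℕ) : seg e s (m + n) = seg e s m ++ seg e (s + m) n := by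
  simp [seg, List.range_add, add_assoc, Function.comp_def]

lemma seg_shift {e : ℕ → A} {p : ℕ} (h : ∀ i, e (i + p) = e i) (k s n : ℕ) :
    seg e (s + k * p) n = seg e s n := by
  have h' : ∀ k i, e (i + k * p) = e i := by
    intro k
    induction k with
    | zero => simp
    | succ k ih => intro i; rw [add_mul, one_mul, ← add_assoc, h, ih]
  simp only [seg]
  refine List.map_congr_left fun i _ => ?_
  rw [show s + k * p + i = s + i + k * p by ring, h']

lemma seg_ext {e e' : ℕ → A} {s s' n : ℕ} (h : ∀ i < n, e (s + i) = e' (s' + i)) :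
    seg e s n = seg e' s' n :=
  List.map_congr_left fun i hi => h i (List.mem_range.1 hi)

lemma eq_seg {w : List A} {e : ℕ → A} {s : ℕ} (h : ∀ i < w.length, w[i]? = some (e (s + i))) :
    w = seg e s w.length := by
  apply List.ext_getElem?
  intro i
  by_cases hi : i < w.length
  · rw [h i hi, getElem?_seg _ _ _ _ hi]
  · rw [List.getElem?_eq_none (by omega), List.getElem?_eq_none (by simp; omega)]

lemma wordPow_seg {e : ℕ → A} {p : ℕ} (h : ∀ i, e (i + p) = e i) (s n : ℕ) :
    wordPow (seg e s p) n = seg e s (n * p) := by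
  induction n with
  | zero => simp [seg]
  | succ n ih =>
    rw [wordPow_succ, ih, add_mul, one_mul, add_comm (n * p), seg_add]
    congr 1
    simpa using (seg_shift h 1 s (n * p)).symm

/-- A non-empty word and its powers are factors of a periodic infinite word. -/
lemma exists_periodic {w : List A} (hw : w ≠ []) :
    ∃ e : ℕ → A, (∀ i, e (i + w.length) = e i) ∧ ∀ n, wordPow w n = seg e 0 (n * w.length) := by
  have hpos := List.length_pos_iff.2 hw
  have hper : ∀ i, (fun i => w[i % w.length]'(Nat.mod_lt _ hpos)) (i + w.length) =
      (fun i => w[i % w.length]'(Nat.mod_lt _ hpos)) i := by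
    intro i; simp
  refine ⟨fun i => w[i % w.length]'(Nat.mod_lt _ hpos), hper, fun n => ?_⟩
  rw [← wordPow_seg hper]
  congr 1
  apply eq_seg
  intro i hi
  simp [Nat.mod_eq_of_lt hi, hi]

/-! ### Periods of infinite words and cancellation of powers -/

lemma periodic_mul {e : ℕ → A} {p : ℕ} (h : ∀ i, e (i + p) = e i) (k i : ℕ) :
    e (i + k * p) = e i := by
  induction k with
  | zero => simp
  | succ k ih => rw [add_mul, one_mul, ← add_assoc, h, ih]

lemma periodic_gcd {e : ℕ → A} {p q : ℕ} (hq0 : 0 < q) (hp : ∀ i, e (i + p) = e i)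
    (hq : ∀ i, e (i + q) = e i) (i : ℕ) : e (i + p.gcd q) = e i := by
  rcases Nat.eq_zero_or_pos p with rfl | hp0
  · simpa using hq i
  obtain ⟨x, y, hxy⟩ : ∃ x y : ℕ, p.gcd q + x * p = y * q := by
    have hb := Nat.gcd_eq_gcd_ab p q
    -- Adding the same multiple of `p * q` to both sides of Bézout's identity makes both
    -- coefficients non-negative, so that the identity can be read as a statement on shifts.
    refine ⟨(-(p.gcdA q) + q * (p.gcdA q).natAbs).toNat,
      (p.gcdB q + p * (p.gcdA q).natAbs).toNat, ?_⟩
    have hq1 : (1 : ℤ) ≤ q := by exact_mod_cast hq0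
    have hx : 0 ≤ (-(p.gcdA q) + q * (p.gcdA q).natAbs) := by
      have h1 : p.gcdA q ≤ (p.gcdA q).natAbs := Int.le_natAbs
      have h2 : (0 : ℤ) ≤ (p.gcdA q).natAbs := by positivity
      nlinarith
    have key : (p.gcd q : ℤ) + (-(p.gcdA q) + q * (p.gcdA q).natAbs) * p =
        (p.gcdB q + p * (p.gcdA q).natAbs) * q := by rw [hb]; ring
    have hy : 0 ≤ (p.gcdB q + p * (p.gcdA q).natAbs) := by
      have h1 : (0 : ℤ) ≤ (p.gcdB q + p * (p.gcdA q).natAbs) * q := by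
        rw [← key]; positivity
      exact nonneg_of_mul_nonneg_left h1 (by omega)
    have h1 := Int.toNat_of_nonneg hx
    have h2 := Int.toNat_of_nonneg hy
    rw [← h1, ← h2] at key
    exact_mod_cast key
  rw [← periodic_mul hp x (i + p.gcd q), add_assoc, hxy, periodic_mul hq]

lemma hasPeriod_seg {e : ℕ → A} {p : ℕ} (h : ∀ i, e (i + p) = e i) (s n : ℕ) :
    (seg e s n).HasPeriod p := by
  rw [List.hasPeriod_iff_getElem?]
  intro i hi
  simp only [length_seg] at hi
  rw [getElem?_seg _ _ _ _ (by omega), getElem?_seg _ _ _ _ (by omega), ← add_assoc, h]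

/-- If the powers of two words start with the same letters up to an offset, then the shorter word
can be cancelled. -/
theorem cancel_powers {u b d : List A} {F G : ℕ → List A} (hb : b ≠ []) (hd : d ≠ [])
    (h : ∀ n, u ++ (wordPow b n ++ F n) = wordPow d n ++ G n) :
    u.HasPeriod (b.length.gcd d.length) ∧
    (b.length ≤ d.length → ∃ d' : List A, d'.length = d.length - b.length ∧
      ∀ n, u ++ F n = wordPow d' n ++ G n) ∧
    (d.length ≤ b.length → ∃ b' : List A, b'.length = b.length - d.length ∧
      ∀ n, u ++ (wordPow b' n ++ F n) = G n) := by
  obtain ⟨e, hq, he⟩ := exists_periodic hd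
  obtain ⟨e', hp', he'⟩ := exists_periodic hb
  have hb0 := List.length_pos_iff.2 hb
  have hd0 := List.length_pos_iff.2 hd
  -- Letting `n` grow identifies `u b b b ⋯` with `d d d ⋯`, the infinite word `e`. Thus `e` has
  -- period `|d|`, and period `|b|` from position `|u|` on; shifts by multiples of `|d|` carry the
  -- latter back to the start.
  have hget : ∀ n i, i < n * d.length →
      (u ++ (wordPow b n ++ F n))[i]? = some (e i) := by
    intro n i hi
    rw [h, List.getElem?_append_left (by simpa), he, getElem?_seg _ _ _ _ hi, zero_add]
  have hu : ∀ i < u.length, u[i]? = some (e (0 + i)) := by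
    intro i hi
    rw [zero_add, ← hget (i + 1) i (by nlinarith), List.getElem?_append_left hi]
  have hbe : ∀ i, e' i = e (u.length + i) := by
    intro i
    have := hget (u.length + i + 1) (u.length + i) (by nlinarith)
    rw [List.getElem?_append_right (by omega),
      List.getElem?_append_left (by rw [length_wordPow, Nat.add_sub_cancel_left]; nlinarith), he',
      getElem?_seg _ _ _ _ (by rw [Nat.add_sub_cancel_left]; nlinarith)] at this
    simpa using this
  have hp : ∀ i, e (i + b.length) = e i := by
    intro i
    have h1 : ∀ i, e (u.length + i + b.length) = e (u.length + i) := by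
      intro i; rw [add_assoc, ← hbe, ← hbe, hp']
    have h2 := h1 (i + (u.length * d.length - u.length))
    have h3 : u.length ≤ u.length * d.length := Nat.le_mul_of_pos_right _ hd0
    rw [show u.length + (i + (u.length * d.length - u.length)) = i + u.length * d.length by omega,
      periodic_mul hq, add_right_comm, periodic_mul hq] at h2
    exact h2
  have hg := periodic_gcd hd0 hp hq
  have hu' : u = seg e 0 u.length := eq_seg hu
  have hbn : ∀ n, wordPow b n = seg e u.length (n * b.length) := by
    intro n
    rw [he']
    exact seg_ext fun i _ => by rw [zero_add, hbe]
  refine ⟨hu' ▸ hasPeriod_seg hg _ _, fun hle => ?_, fun hle => ?_⟩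
  · have hr : ∀ i, e (i + (d.length - b.length)) = e i := by
      intro i
      rw [← hp, add_assoc, Nat.sub_add_cancel hle, hq]
    -- Both `u bⁿ` and `dⁿ` start with the prefix of `e` of length `n|b|`. What follows it is `u` in
    -- the first and the `n`-th power of the prefix of length `|d| - |b|` in the second.
    refine ⟨seg e 0 (d.length - b.length), by simp, fun n => ?_⟩
    have := h n
    rw [← List.append_assoc, hbn, he] at this
    have h1 : u ++ seg e u.length (n * b.length) = seg e 0 (n * b.length) ++ u := by
      conv_lhs => rw [hu']
      conv_rhs => rw [hu']
      have := seg_add e 0 u.length (n * b.length)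
      rw [zero_add] at this
      rw [length_seg, ← this, add_comm, seg_add, seg_shift hp]
    have h2 : seg e 0 (n * d.length) =
        seg e 0 (n * b.length) ++ wordPow (seg e 0 (d.length - b.length)) n := by
      rw [wordPow_seg hr, ← seg_shift hp n 0 (n * (d.length - b.length)), ← seg_add, ← mul_add,
        Nat.add_sub_cancel' hle]
    rw [h1, h2, List.append_assoc, List.append_assoc] at this
    exact List.append_cancel_left this
  · have hr : ∀ i, e (i + (b.length - d.length)) = e i := by
      intro i
      rw [← hq, add_assoc, Nat.sub_add_cancel hle, hp]
    -- The remaining block stands after `u`, so it is read off from `e` at position `|u|`.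
    refine ⟨seg e u.length (b.length - d.length), by simp, fun n => ?_⟩
    have := h n
    rw [← List.append_assoc, hbn, he] at this
    have h1 : u ++ seg e u.length (n * b.length) = seg e 0 (n * d.length) ++
        (u ++ wordPow (seg e u.length (b.length - d.length)) n) := by
      rw [wordPow_seg hr]
      conv_lhs => rw [hu']
      conv_rhs => rw [hu']
      have h3 := seg_add e 0 u.length (n * b.length)
      have h4 := seg_add e 0 u.length (n * (b.length - d.length))
      rw [zero_add] at h3 h4
      have h5 : u.length + n * b.length =
          n * d.length + (u.length + n * (b.length - d.length)) := by
        rw [Nat.mul_sub]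
        have := Nat.mul_le_mul_left n hle
        omega
      rw [length_seg, ← h3, ← h4, h5, seg_add, seg_shift hq]
    rw [h1, List.append_assoc, List.append_assoc] at this
    exact List.append_cancel_left this

/-! ## Patterns -/

/-- The word `a₁ b₁ⁿ a₂ b₂ⁿ ⋯` given by a list of pairs `(aᵢ, bᵢ)`. -/
def patEval (n : ℕ) (P : List (List A × List A)) : List A := P.flatMap fun p => p.1 ++ wordPow p.2 n

/-- The growth of the length of a pattern. -/
def patSlope (P : List (List A × List A)) : ℕ := (P.map fun p => p.2.length).sum

@[simp] lemma patEval_nil (n : ℕ) : patEval n ([] : List (List A × List A)) = [] := rfl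

@[simp] lemma patEval_cons (n : ℕ) (p : List A × List A) (P : List (List A × List A)) :
    patEval n (p :: P) = p.1 ++ (wordPow p.2 n ++ patEval n P) := by simp [patEval]

@[simp] lemma patEval_append (n : ℕ) (P Q : List (List A × List A)) :
    patEval n (P ++ Q) = patEval n P ++ patEval n Q := by simp [patEval]

@[simp] lemma patSlope_nil : patSlope ([] : List (List A × List A)) = 0 := rfl

@[simp] lemma patSlope_cons (p : List A × List A) (P : List (List A × List A)) :
    patSlope (p :: P) = p.2.length + patSlope P := by simp [patSlope]

lemma length_patEval (n : ℕ) (P : List (List A × List A)) :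
    (patEval n P).length = (patEval 0 P).length + n * patSlope P := by
  induction P with
  | nil => simp
  | cons p P ih => simp [ih]; ring

/-- The factor of `w` between the positions `x` and `y`. -/
def window (w : List A) (x y : ℕ) : List A := (w.take y).drop x

lemma length_window (w : List A) (x y : ℕ) : (window w x y).length = min y w.length - x := by
  simp [window]

lemma window_infix (w : List A) {x y x' y' : ℕ} (hx : x ≤ x') (hy : y' ≤ y) :
    window w x' y' <:+: window w x y := by
  have h1 : window w x' y' <:+: window w x' y := by
    unfold window
    refine List.IsPrefix.isInfix ?_
    rw [show w.take y' = (w.take y).take y' by rw [List.take_take, min_eq_left hy],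
      List.drop_take]
    exact List.take_prefix _ _
  refine h1.trans (List.IsSuffix.isInfix ?_)
  unfold window
  rw [show x' = x + (x' - x) by omega, ← List.drop_drop]
  exact List.drop_suffix _ _

lemma window_append (u v w : List A) :
    window (u ++ v ++ w) u.length (u ++ v).length = v := by
  simp [window, List.take_append]

lemma gcd_dvd_step {b d s : ℕ} (hb : 0 < b) (hs : s = min b d) :
    0 < b.gcd d ∧ b.gcd d ∣ s := by
  refine ⟨Nat.gcd_pos_of_pos_left _ hb, ?_⟩
  rcases le_total b d with h | h
  · rw [hs, min_eq_left h]; exact Nat.gcd_dvd_left _ _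
  · rw [hs, min_eq_right h]; exact Nat.gcd_dvd_right _ _

/-- Every block of `P` has at least `f` letters of the base word to its right. -/
def FarFromEnd (f : ℕ) (P : List (List A × List A)) : Prop :=
  ∀ pre a b post, P = pre ++ (a, b) :: post → b ≠ [] → f ≤ (patEval 0 post).length

/-- Every block of `P` has at least `f` letters of the base word to its left. -/
def FarFromStart (f : ℕ) (P : List (List A × List A)) : Prop :=
  ∀ pre a b post, P = pre ++ (a, b) :: post → b ≠ [] → f ≤ (patEval 0 pre).length + a.length

lemma FarFromEnd.tail {f : ℕ} {p : List A × List A} {P : List (List A × List A)}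
    (h : FarFromEnd f (p :: P)) : FarFromEnd f P := by
  intro pre a b post hP
  exact h (p :: pre) a b post (by simp [hP])

lemma FarFromEnd.replace {f : ℕ} {a b b' : List A} {P : List (List A × List A)}
    (h : FarFromEnd f ((a, b) :: P)) (hb : b ≠ []) : FarFromEnd f ((a, b') :: P) := by
  intro pre x y post hP hy
  rcases pre with _ | ⟨q, pre⟩
  · simp only [List.nil_append, List.cons.injEq] at hP
    rw [← hP.2]
    exact h [] a b P rfl hb
  · simp only [List.cons_append, List.cons.injEq] at hP
    exact h.tail pre x y post hP.2 hy

/-- All blocks of the first word are right of the cut here, all those of `P` left of it. The word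
between the first blocks `d` of `P` and `b` of `S` covers the window and has period `gcd(|b|, |d|)`.
Cancelling the shorter block lowers the slope of `P` by `min(|b|, |d|)`, and the induction supplies
a period that divides the rest. Fine and Wilf join the two periods to one that divides the sum. -/
theorem period_of_slope_right (f j : ℕ) (G : ℕ → List A) :
    ∀ (N : ℕ) (S P : List (List A × List A)) (u v : List A), S.length + P.length ≤ N →
    (∀ n, u ++ patEval n S = v ++ (patEval n P ++ G n)) → j ≤ u.length →
    v.length + (patEval 0 P).length = j → 0 < patSlope P → patSlope P ≤ 2 * f →
    (∀ pre a b post, S = pre ++ (a, b) :: post → b ≠ [] →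
      j + f ≤ u.length + (patEval 0 pre).length + a.length) → FarFromEnd f P →
    f ≤ j ∧ j + f ≤ (u ++ patEval 0 S).length ∧ ∃ g, 0 < g ∧ g ∣ patSlope P ∧
      (window (u ++ patEval 0 S) (j - f) (j + f)).HasPeriod g := by
  intro N
  induction N with
  | zero =>
    intro S P u v hN _ _ _ hpos
    have : P = [] := List.length_eq_zero_iff.1 (by omega)
    simp [this] at hpos
  | succ N ih =>
    intro S P u v hN heq hu hv hpos hle hS hP
    rcases P with _ | ⟨⟨c, d⟩, P⟩
    · simp at hpos
    rcases S with _ | ⟨⟨a, b⟩, S⟩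
    -- Without blocks in `S` the left side has constant length, but the right side grows.
    · have := congrArg List.length (heq (u.length + 1))
      simp only [patEval_nil, List.append_nil, List.length_append,
        length_patEval (u.length + 1)] at this
      nlinarith
    simp only [List.length_cons] at hN
    rcases eq_or_ne b [] with rfl | hb
    · have := ih S ((c, d) :: P) (u ++ a) v (by simp; omega) (by simpa using heq)
        (by simp; omega) hv hpos hle
        (by
          intro pre a' b' post h1 h2
          have := hS ((a, []) :: pre) a' b' post (by simp [h1]) h2
          simp only [patEval_cons, wordPow_nil, List.nil_append, List.length_append] at this ⊢
          omega) hP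
      simpa using this
    rcases eq_or_ne d [] with rfl | hd
    · have := ih ((a, b) :: S) P u (v ++ c) (by simp; omega) (by simpa using heq)
        hu (by simp at hv ⊢; omega) (by simpa using hpos) (by simpa using hle) hS hP.tail
      simpa using this
    have hb0 := List.length_pos_iff.2 hb
    have hd0 := List.length_pos_iff.2 hd
    have hfar1 := hS [] a b S rfl hb
    have hfar2 := hP [] c d P rfl hd
    simp only [patEval_nil, List.length_nil, add_zero] at hfar1
    simp only [patEval_cons, wordPow_zero, List.nil_append, List.length_append] at hv
    simp only [patSlope_cons] at hpos hle ⊢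
    -- the word between the two blocks
    obtain ⟨x, hx⟩ : ∃ x, u ++ a = (v ++ c) ++ x := by
      have h0 := heq 0
      simp only [patEval_cons, wordPow_zero, List.nil_append, ← List.append_assoc] at h0
      have : v ++ c <+: u ++ a := by
        refine List.prefix_of_prefix_length_le (l₃ := u ++ a ++ patEval 0 S) ?_
          (List.prefix_append _ _) (by simp; omega)
        rw [h0, List.append_assoc (v ++ c)]
        exact List.prefix_append _ _
      obtain ⟨x, hx⟩ := this
      exact ⟨x, hx.symm⟩
    have heq' : ∀ n, x ++ (wordPow b n ++ patEval n S) =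
        wordPow d n ++ (patEval n P ++ G n) := by
      intro n
      have := heq n
      simp only [patEval_cons, ← List.append_assoc] at this
      rw [hx] at this
      simp only [List.append_assoc] at this
      simpa using this
    obtain ⟨hper, hcase1, hcase2⟩ := cancel_powers hb hd heq'
    have hlen := congrArg List.length hx
    simp only [List.length_append] at hlen
    have hfj : f ≤ j := by omega
    have hjf : j + f ≤ (u ++ patEval 0 ((a, b) :: S)).length := by simp; omega
    refine ⟨hfj, hjf, ?_⟩
    have hwlen : (window (u ++ patEval 0 ((a, b) :: S)) (j - f) (j + f)).length = 2 * f := by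
      rw [length_window, min_eq_left hjf]; omega
    have hperw : (window (u ++ patEval 0 ((a, b) :: S)) (j - f) (j + f)).HasPeriod
        (b.length.gcd d.length) := by
      have : x = window (u ++ patEval 0 ((a, b) :: S)) (v ++ c).length (v ++ c ++ x).length := by
        have h1 := window_append (v ++ c) x (patEval 0 S)
        rw [← hx] at h1 ⊢
        simpa using h1.symm
      rw [this] at hper
      refine hper.infix (window_infix _ ?_ ?_)
      · simp; omega
      · rw [← hx]; simp; omega
    have hgcd : b.length.gcd d.length ≤ min b.length d.length :=
      le_min (Nat.gcd_le_left _ hb0) (Nat.gcd_le_right _ hd0)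
    obtain ⟨hg0, hgs⟩ := gcd_dvd_step hb0 rfl
    -- Fine and Wilf apply since the periods sum to at most `min(|b|, |d|) + δ`, the slope, which is
    -- at most the window length `2 * f`.
    have combine : ∀ δ, (min b.length d.length) + δ = d.length + patSlope P →
        (∃ g, 0 < g ∧ g ∣ δ ∧
          (window (u ++ patEval 0 ((a, b) :: S)) (j - f) (j + f)).HasPeriod g) → 0 < δ →
        ∃ g, 0 < g ∧ g ∣ d.length + patSlope P ∧
          (window (u ++ patEval 0 ((a, b) :: S)) (j - f) (j + f)).HasPeriod g := by
      rintro δ hδ ⟨g, hg, hgd, hgp⟩ hδ0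
      refine ⟨_, Nat.gcd_pos_of_pos_right (b.length.gcd d.length) hg, ?_, hperw.gcd hgp ?_⟩
      · rw [← hδ]
        exact dvd_add ((Nat.gcd_dvd_left _ _).trans hgs) ((Nat.gcd_dvd_right _ _).trans hgd)
      · have := Nat.le_of_dvd hδ0 hgd
        rw [hwlen]; omega
    rcases le_total b.length d.length with hbd | hbd
    · obtain ⟨d', hd', hd'eq⟩ := hcase1 hbd
      rcases Nat.eq_zero_or_pos (d.length - b.length + patSlope P) with h0 | h0
      · exact ⟨_, hg0, by
          rw [show d.length + patSlope P = min b.length d.length by rw [min_eq_left hbd]; omega]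
          exact hgs, hperw⟩
      · refine combine (d.length - b.length + patSlope P)
          (by rw [min_eq_left hbd]; omega) ?_ h0
        have := ih S ((c, d') :: P) (u ++ a) v (by simp; omega)
          (fun n => by
            have := hd'eq n
            rw [hx, List.append_assoc, this]
            simp only [patEval_cons, List.append_assoc])
          (by simp; omega) (by simp; omega) (by simp; omega) (by simp; omega)
          (by
            intro pre a' b' post h1 h2
            have := hS ((a, b) :: pre) a' b' post (by simp [h1]) h2
            simp only [patEval_cons, wordPow_zero, List.nil_append, List.length_append] at this ⊢
            omega) (hP.replace hd)
        simpa [hd'] using this.2.2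
    · obtain ⟨b', hb', hb'eq⟩ := hcase2 hbd
      rcases Nat.eq_zero_or_pos (patSlope P) with h0 | h0
      · exact ⟨_, hg0, by
          rw [show d.length + patSlope P = min b.length d.length by rw [min_eq_right hbd]; omega]
          exact hgs, hperw⟩
      · refine combine (patSlope P) (by rw [min_eq_right hbd]) ?_ h0
        have := ih ((a, b') :: S) P u (v ++ c) (by simp; omega)
          (fun n => by
            have := hb'eq n
            rw [patEval_cons, ← List.append_assoc, hx, List.append_assoc, this,
              List.append_assoc])
          (by omega) (by simp; omega) h0 (by omega)
          (by
            intro pre a' b'' post h1 h2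
            rcases pre with _ | ⟨q, pre⟩
            · simp only [List.nil_append, List.cons.injEq, Prod.mk.injEq] at h1
              simp only [patEval_nil, List.length_nil, ← h1.1.1]; omega
            · simp only [List.cons_append, List.cons.injEq] at h1
              have := hS ((a, b) :: pre) a' b'' post (by simp [h1.2]) h2
              simpa [← h1.1] using this) hP.tail
        simpa using this.2.2

/-- Two patterns for the same family of words, cut at the same position of the base word but with
different growth on the left: if all the blocks between which the cut moves are far from it, then
the base word is periodic around the cut, and the period divides the difference of the growths. -/
theorem period_of_slope (f j : ℕ) (G : ℕ → List A) :
    ∀ (N : ℕ) (P₁ S₁ P₂ : List (List A × List A)) (u v : List A), P₁.length + P₂.length ≤ N →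
    (∀ n, u ++ (patEval n P₁ ++ patEval n S₁) = v ++ (patEval n P₂ ++ G n)) →
    u.length + (patEval 0 P₁).length = j →
    v.length + (patEval 0 P₂).length = j → patSlope P₁ < patSlope P₂ →
    patSlope P₂ - patSlope P₁ ≤ 2 * f → FarFromStart f S₁ → FarFromEnd f P₂ →
    f ≤ j ∧ j + f ≤ (u ++ (patEval 0 P₁ ++ patEval 0 S₁)).length ∧
      ∃ g, 0 < g ∧ g ∣ patSlope P₂ - patSlope P₁ ∧
      (window (u ++ (patEval 0 P₁ ++ patEval 0 S₁)) (j - f) (j + f)).HasPeriod g := by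
  intro N
  induction N with
  | zero =>
    intro P₁ S₁ P₂ u v hN _ _ _ hlt
    have : P₂ = [] := List.length_eq_zero_iff.1 (by omega)
    simp [this] at hlt
  | succ N ih =>
    intro P₁ S₁ P₂ u v hN heq hu hv hlt hle hS hP
    -- Cancelling pairs of blocks left of the cut keeps the difference of the slopes. When `P₁` is
    -- used up, `u` ends at the cut and `period_of_slope_right` applies; `P₂` cannot be used up
    -- before, as its slope stays larger.
    rcases P₁ with _ | ⟨⟨a, b⟩, P₁⟩
    · simp only [patEval_nil, List.length_nil, add_zero, List.nil_append, patSlope_nil,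
        Nat.sub_zero] at *
      refine period_of_slope_right f j G _ S₁ P₂ u v le_rfl heq hu.ge hv hlt hle ?_ hP
      intro pre a b post h1 h2
      have := hS pre a b post h1 h2
      omega
    rcases P₂ with _ | ⟨⟨c, d⟩, P₂⟩
    · simp at hlt
    simp only [List.length_cons] at hN
    rcases eq_or_ne b [] with rfl | hb
    · have := ih P₁ S₁ ((c, d) :: P₂) (u ++ a) v (by simp; omega) (by simpa using heq)
        (by simp at hu ⊢; omega) hv (by simpa using hlt) (by simpa using hle) hS hP
      simpa using this
    rcases eq_or_ne d [] with rfl | hd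
    · have := ih ((a, b) :: P₁) S₁ P₂ u (v ++ c) (by simp; omega) (by simpa using heq)
        hu (by simp at hv ⊢; omega) (by simpa using hlt) (by simpa using hle) hS hP.tail
      simpa using this
    simp only [patEval_cons, wordPow_zero, List.nil_append, List.length_append] at hu hv
    simp only [patSlope_cons] at hlt hle ⊢
    -- cancelling a pair of blocks
    have step : (b.length ≤ d.length → ∃ d' : List A, d'.length = d.length - b.length ∧
          ∀ n, (u ++ a) ++ (patEval n P₁ ++ patEval n S₁) =
            (v ++ c) ++ (wordPow d' n ++ (patEval n P₂ ++ G n))) ∧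
        (d.length ≤ b.length → ∃ b' : List A, b'.length = b.length - d.length ∧
          ∀ n, (u ++ a) ++ (wordPow b' n ++ (patEval n P₁ ++ patEval n S₁)) =
            (v ++ c) ++ (patEval n P₂ ++ G n)) := by
      have heq2 : ∀ n, (u ++ a) ++ (wordPow b n ++ (patEval n P₁ ++ patEval n S₁)) =
          (v ++ c) ++ (wordPow d n ++ (patEval n P₂ ++ G n)) := by
        intro n; simpa using heq n
      rcases le_total (v ++ c).length (u ++ a).length with hcmp | hcmp
      · obtain ⟨x, hx⟩ := List.prefix_of_prefix_length_le
          (l₃ := (u ++ a) ++ (wordPow b 0 ++ (patEval 0 P₁ ++ patEval 0 S₁)))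
          (by rw [heq2]; exact List.prefix_append _ _) (List.prefix_append _ _) hcmp
        rw [← hx] at heq2 ⊢
        simp only [List.append_assoc (v ++ c), List.append_cancel_left_eq] at heq2 ⊢
        have := cancel_powers hb hd heq2
        exact this.2
      · obtain ⟨x, hx⟩ := List.prefix_of_prefix_length_le
          (l₃ := (u ++ a) ++ (wordPow b 0 ++ (patEval 0 P₁ ++ patEval 0 S₁)))
          (List.prefix_append _ _) (by rw [heq2]; exact List.prefix_append _ _) hcmp
        rw [← hx] at heq2 ⊢
        simp only [List.append_assoc (u ++ a), List.append_cancel_left_eq] at heq2 ⊢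
        have := cancel_powers hd hb (fun n => (heq2 n).symm)
        refine ⟨fun h => ?_, fun h => ?_⟩
        · obtain ⟨d', h1, h2⟩ := this.2.2 h
          exact ⟨d', h1, fun n => (h2 n).symm⟩
        · obtain ⟨d', h1, h2⟩ := this.2.1 h
          exact ⟨d', h1, fun n => (h2 n).symm⟩
    rcases le_total b.length d.length with hbd | hbd
    · obtain ⟨d', hd', hd'eq⟩ := step.1 hbd
      clear step
      have := ih P₁ S₁ ((c, d') :: P₂) (u ++ a) v (by simp; omega)
        (fun n => by simpa using hd'eq n) (by simp; omega) (by simp; omega)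
        (by simp [hd']; omega) (by simp [hd']; omega) hS (hP.replace hd)
      rw [patSlope_cons, hd', show d.length - b.length + patSlope P₂ - patSlope P₁ =
        d.length + patSlope P₂ - (b.length + patSlope P₁) by omega] at this
      simpa using this
    · obtain ⟨b', hb', hb'eq⟩ := step.2 hbd
      clear step
      have := ih ((a, b') :: P₁) S₁ P₂ u (v ++ c) (by simp; omega)
        (fun n => by simpa using hb'eq n) (by simp; omega) (by simp; omega)
        (by simp [hb']; omega) (by simp [hb']; omega) hS hP.tail
      rw [patSlope_cons, hb', show patSlope P₂ - (b.length - d.length + patSlope P₁) =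
        d.length + patSlope P₂ - (b.length + patSlope P₁) by omega] at this
      simpa using this

end Words

/-! ## Consecutive factors of bounded length in a finite semigroup -/

section Brown

lemma lt_of_chain {t : ℕ → ℕ} {n : ℕ} (h : ∀ i < n, t i < t (i + 1)) {i j : ℕ} (hij : i < j)
    (hj : j ≤ n) : t i < t j := by
  induction j with
  | zero => omega
  | succ j ih =>
    rcases Nat.lt_succ_iff_lt_or_eq.1 hij with h1 | rfl
    · exact (ih h1 (by omega)).trans (h j (by omega))
    · exact h i (by omega)

lemma le_of_chain {t : ℕ → ℕ} {n : ℕ} (h : ∀ i < n, t i < t (i + 1)) {i j : ℕ} (hij : i ≤ j)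
    (hj : j ≤ n) : t i ≤ t j := by
  rcases hij.eq_or_lt with rfl | h1
  · exact le_rfl
  · exact (lt_of_chain h h1 hj).le

lemma gap_of_chain {t : ℕ → ℕ} {n b : ℕ} (h : ∀ i < n, t (i + 1) ≤ t i + b) (i m : ℕ)
    (hm : i + m ≤ n) : t (i + m) ≤ t i + m * b := by
  induction m with
  | zero => simp
  | succ m ih =>
    have h1 := ih (by omega)
    have h2 := h (i + m) (by omega)
    rw [add_mul, one_mul, ← add_assoc i m 1]
    omega

/-- Brown's lemma: in a long coloured interval some colour occurs many times with gaps that are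
small compared to the number of occurrences. -/
theorem brown {C : Type*} (F : ℕ → ℕ) (s : Finset C) :
    ∃ k, ∀ col : ℕ → C, (∀ i ≤ k, col i ∈ s) → ∃ (b : ℕ) (a : C) (t : ℕ → ℕ), a ∈ s ∧
      (∀ i < F b, t i < t (i + 1) ∧ t (i + 1) ≤ t i + b) ∧ (∀ i ≤ F b, col (t i) = a) ∧
      t (F b) ≤ k := by
  classical
  induction s using Finset.induction_on with
  | empty => exact ⟨0, fun col h => absurd (h 0 le_rfl) (by simp)⟩
  | insert a s _ ih =>
    obtain ⟨k, hk⟩ := ih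
    refine ⟨(F (2 * (k + 1)) + 1) * (k + 1), fun col hcol => ?_⟩
    -- Either `k + 1` consecutive positions avoid the colour `a`, and the induction hypothesis
    -- applies to them, or `a` occurs among any `k + 1` positions. In the latter case one occurrence
    -- from each block of length `k + 1` gives gaps of at most `2 * (k + 1)`.
    by_cases hx : ∃ x, x + k ≤ (F (2 * (k + 1)) + 1) * (k + 1) ∧ ∀ i ≤ k, col (x + i) ≠ a
    · obtain ⟨x, hxk, hxa⟩ := hx
      obtain ⟨b, a', t, ha', ht, hc, hle⟩ := hk (fun i => col (x + i)) fun i hi =>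
        Finset.mem_of_mem_insert_of_ne (hcol _ (by omega)) (hxa i hi)
      refine ⟨b, a', fun i => x + t i, Finset.mem_insert_of_mem ha', fun i hi => ?_, hc, by
        show x + t (F b) ≤ _
        omega⟩
      have := ht i hi
      show x + t i < x + t (i + 1) ∧ x + t (i + 1) ≤ x + t i + b
      omega
    · push Not at hx
      choose! g hg using hx
      have hb : ∀ i ≤ F (2 * (k + 1)),
          i * (k + 1) + k ≤ (F (2 * (k + 1)) + 1) * (k + 1) := by
        intro i hi
        have := Nat.mul_le_mul_right (k + 1) hi
        rw [add_mul, one_mul]; omega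
      refine ⟨2 * (k + 1), a, fun i => i * (k + 1) + g (i * (k + 1)), by simp, fun i hi => ?_,
        fun i hi => (hg _ (hb i hi)).2, ?_⟩
      · have h1 := (hg _ (hb i hi.le)).1
        have h2 := (hg _ (hb (i + 1) hi)).1
        have h3 : (i + 1) * (k + 1) = i * (k + 1) + (k + 1) := by ring
        show i * (k + 1) + g (i * (k + 1)) < (i + 1) * (k + 1) + g ((i + 1) * (k + 1)) ∧
          (i + 1) * (k + 1) + g ((i + 1) * (k + 1)) ≤
            i * (k + 1) + g (i * (k + 1)) + 2 * (k + 1)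
        omega
      · have h1 := (hg _ (hb _ le_rfl)).1
        have h2 := hb _ le_rfl
        show F (2 * (k + 1)) * (k + 1) + g (F (2 * (k + 1)) * (k + 1)) ≤ _
        omega

/-- In a long word over a finite semigroup there are many consecutive factors which all have the
same idempotent value and are short compared to their number. -/
theorem exists_consecutive_idempotent {S : Type*} [Semigroup S] [Finite S] (F : ℕ → ℕ) :
    ∃ k, ∀ c : ℕ → ℕ → S, (∀ i j l, i < j → j < l → l ≤ k → c i j * c j l = c i l) →
      ∃ (b : ℕ) (e : S) (t : ℕ → ℕ), e * e = e ∧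
        (∀ i < F b, t i < t (i + 1) ∧ t (i + 1) ≤ t i + b ∧ c (t i) (t (i + 1)) = e) ∧
        t (F b) ≤ k := by
  classical
  have := Fintype.ofFinite S
  -- Induction on a closed set `T` that contains all the values. `F` is quantified inside because
  -- the induction hypothesis is used with a rescaled `F`.
  suffices H : ∀ T : Finset S, (∀ x ∈ T, ∀ y ∈ T, x * y ∈ T) → ∀ F : ℕ → ℕ, ∃ k,
      ∀ c : ℕ → ℕ → S, (∀ i j l, i < j → j < l → l ≤ k → c i j * c j l = c i l) →
      (∀ i j, i < j → j ≤ k → c i j ∈ T) →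
      ∃ (b : ℕ) (e : S) (t : ℕ → ℕ), e * e = e ∧
        (∀ i < F b, t i < t (i + 1) ∧ t (i + 1) ≤ t i + b ∧ c (t i) (t (i + 1)) = e) ∧
        t (F b) ≤ k by
    obtain ⟨k, hk⟩ := H Finset.univ (by simp) F
    exact ⟨k, fun c hc => hk c hc (by simp)⟩
  clear F
  intro T
  induction T using Finset.strongInduction with
  | H T ih =>
  intro hT F
  choose! K hK using ih
  -- The subset for the induction hypothesis is known only after `brown` has been applied, hence the
  -- supremum over all subsets. A gap `b'` in a sequence with gaps at most `b` is a gap of at most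
  -- `b' * b`, hence the rescaling of `F`.
  let FB : ℕ → ℕ := fun b => T.powerset.sup fun T' => K T' fun b' => F (b' * b)
  obtain ⟨k₁, hk₁⟩ := brown FB T
  set L := k₁ + 1 with hL
  obtain ⟨k₂, hk₂⟩ := brown (fun b => F (b * L)) T
  refine ⟨(k₂ + 1) * L, fun c hc hcT => ?_⟩
  set k := (k₂ + 1) * L with hk
  -- Call `z` a left zero if `z * y = z` for all `y ∈ T`. Either some interval of length `L` has no
  -- factor whose value is a left zero, or all have one.
  by_cases hx : ∃ x, x + L ≤ k ∧ ∀ i j, x ≤ i → i < j → j ≤ x + L → ∃ y ∈ T, c i j * y ≠ c i j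
  · obtain ⟨x, hxk, hx⟩ := hx
    obtain ⟨b, a, t, haT, ht, hta, htk⟩ := hk₁ (fun i => c x (x + 1 + i))
      (fun i hi => hcT _ _ (by omega) (by omega))
    have htm : ∀ i < FB b, t i < t (i + 1) := fun i hi => (ht i hi).1
    -- Between two positions with the same prefix value `a` the factor stabilizes `a`. The
    -- stabilizer is closed, and it is smaller than `T` because `a` is not a left zero.
    set T' := T.filter fun y => a * y = a with hT'
    have hss : T' ⊂ T := by
      refine Finset.filter_ssubset.2 ?_
      obtain ⟨y, hy, hne⟩ := hx x (x + 1 + t 0) le_rfl (by omega) (by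
        have := le_of_chain htm (Nat.zero_le (FB b)) le_rfl
        omega)
      have h0 := hta 0 (Nat.zero_le _)
      rw [h0] at hne
      exact ⟨y, hy, hne⟩
    have hcl : ∀ y ∈ T', ∀ z ∈ T', y * z ∈ T' := by
      intro y hy z hz
      simp only [hT', Finset.mem_filter] at hy hz ⊢
      exact ⟨hT y hy.1 z hz.1, by rw [← mul_assoc, hy.2, hz.2]⟩
    have hKle : K T' (fun b' => F (b' * b)) ≤ FB b :=
      Finset.le_sup (f := fun T' => K T' fun b' => F (b' * b)) (Finset.mem_powerset.2 hss.subset)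
    have hbound : ∀ i ≤ FB b, x + 1 + t i ≤ k := fun i hi => by
      have := le_of_chain htm hi le_rfl
      omega
    obtain ⟨b', e, t', he, ht', htk'⟩ := hK T' hss hcl (fun b' => F (b' * b))
      (fun i j => c (x + 1 + t i) (x + 1 + t j))
      (fun i j l hij hjl hl => hc _ _ _
        (by have := lt_of_chain htm hij (by omega); omega)
        (by have := lt_of_chain htm hjl (by omega); omega) (hbound l (by omega)))
      (fun i j hij hj => by
        have hlt := lt_of_chain htm hij (by omega)
        refine Finset.mem_filter.2 ⟨hcT _ _ (by omega) (hbound j (by omega)), ?_⟩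
        have h1 := hta i (by omega)
        have h2 := hta j (by omega)
        have h3 := hc x (x + 1 + t i) (x + 1 + t j) (by omega) (by omega) (hbound j (by omega))
        rw [h1, h2] at h3
        exact h3)
    have htm' : ∀ i < F (b' * b), t' i < t' (i + 1) := fun i hi => (ht' i hi).1
    refine ⟨b' * b, e, fun i => x + 1 + t (t' i), he, fun i hi => ?_, ?_⟩
    · obtain ⟨h1, h2, h3⟩ := ht' i hi
      have hle : t' (i + 1) ≤ FB b :=
        ((le_of_chain htm' hi le_rfl).trans htk').trans hKle
      have h4 := lt_of_chain htm h1 hle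
      have h5 := gap_of_chain (fun i hi => (ht i hi).2) (t' i) (t' (i + 1) - t' i) (by omega)
      rw [Nat.add_sub_cancel' h1.le] at h5
      have h6 : (t' (i + 1) - t' i) * b ≤ b' * b := Nat.mul_le_mul_right _ (by omega)
      exact ⟨by show x + 1 + t (t' i) < x + 1 + t (t' (i + 1)); omega,
        by show x + 1 + t (t' (i + 1)) ≤ x + 1 + t (t' i) + _; omega, h3⟩
    · exact hbound _ (htk'.trans hKle)
  · push Not at hx
    -- A left zero absorbs what follows, and its left multiples are left zeros, so the value of the
    -- whole interval is a left zero. Hence from one interval of value `a` to the start of a later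
    -- one the value is still `a`, and `a` is idempotent.
    have hzero : ∀ x, x + L ≤ k → ∀ y ∈ T, c x (x + L) * y = c x (x + L) := by
      intro x hxk
      obtain ⟨i, j, hi, hij, hj, hz⟩ := hx x hxk
      have h1 : c i (x + L) = c i j := by
        rcases hj.eq_or_lt with rfl | hj'
        · rfl
        · rw [← hc i j _ hij hj' hxk, hz _ (hcT _ _ hj' hxk)]
      have h2 : ∀ y ∈ T, c i (x + L) * y = c i (x + L) := by
        intro y hy; rw [h1, hz y hy]
      rcases hi.eq_or_lt with rfl | hi'
      · exact h2
      · intro y hy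
        rw [← hc x i _ hi' (by omega) hxk, mul_assoc, h2 y hy]
    have hmul : ∀ i ≤ k₂, i * L + L ≤ k := by
      intro i hi
      rw [hk, ← Nat.succ_mul]
      exact Nat.mul_le_mul_right _ (by omega)
    obtain ⟨b, a, t, haT, ht, hta, htk⟩ := hk₂ (fun i => c (i * L) (i * L + L))
      (fun i hi => hcT _ _ (by omega) (hmul i hi))
    have htm : ∀ i < F (b * L), t i < t (i + 1) := fun i hi => (ht i hi).1
    have hidem : ∀ y ∈ T, a * y = a := by
      have h0 := hta 0 (Nat.zero_le _)
      have h1 := (le_of_chain htm (Nat.zero_le (F (b * L))) le_rfl).trans htk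
      intro y hy
      rw [← h0]
      exact hzero _ (hmul _ h1) y hy
    refine ⟨b * L, a, fun i => t i * L, hidem a haT, fun i hi => ?_, ?_⟩
    · obtain ⟨h1, h2⟩ := ht i hi
      have h3 : t (i + 1) ≤ k₂ := (le_of_chain htm hi le_rfl).trans htk
      refine ⟨Nat.mul_lt_mul_of_pos_right h1 (by omega), ?_, ?_⟩
      · show t (i + 1) * L ≤ t i * L + b * L
        rw [← add_mul]
        exact Nat.mul_le_mul_right _ h2
      · have h4 := hta i hi.le
        have h5 : t i * L + L ≤ t (i + 1) * L := by
          rw [← Nat.succ_mul]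
          exact Nat.mul_le_mul_right _ h1
        show c (t i * L) (t (i + 1) * L) = a
        rcases h5.eq_or_lt with h6 | h6
        · rw [← h6, h4]
        · have h7 : t (i + 1) * L ≤ k := by
            have := hmul _ h3; omega
          rw [← hc _ _ _ (by omega) h6 h7, h4, hidem _ (hcT _ _ h6 h7)]
    · have := hmul _ htk
      show t (F (b * L)) * L ≤ k
      omega

end Brown

/-! ## Cuts are not surrounded by long words of small period -/

section CutPositions

variable {A : Type*}

lemma rootLength_le_iff (z : List A) (l : ℕ) :
    rootLength z ≤ l ↔ ∃ (y : List A) (n : ℕ), 0 < n ∧ z = wordPow y n ∧ y.length ≤ l := by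
  constructor
  · intro h
    have hne : {p | ∃ (y : List A) (n : ℕ), 0 < n ∧ z = (List.replicate n y).flatten ∧
        y.length = p}.Nonempty := ⟨z.length, z, 1, one_pos, by simp, rfl⟩
    obtain ⟨y, n, hn, hz, hy⟩ := Nat.sInf_mem hne
    exact ⟨y, n, hn, hz, hy.trans_le h⟩
  · rintro ⟨y, n, hn, hz, hy⟩
    exact le_trans (Nat.sInf_le (show y.length ∈ _ from ⟨y, n, hn, hz, rfl⟩)) hy

/-- A cut ends a factor, which is the longest prefix with a short root of what remains. -/
lemma exists_of_mem_cuts (l : ℕ) (z : List A) (j : ℕ) (hj : j ∈ cuts l z) :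
    ∃ x y : List A, z = x ++ y ∧ y ≠ [] ∧ j = x.length + max 1 (factorLength l y) := by
  obtain ⟨i, hi, rfl⟩ := Finset.mem_image.1 hj
  clear hj
  rw [Finset.mem_Icc] at hi
  induction hn : z.length using Nat.strong_induction_on generalizing z i with
  | _ n ih =>
  rcases z with _ | ⟨a, z⟩
  · simp only [factors, List.length_nil] at hi
    omega
  · rw [factors] at hi ⊢
    obtain ⟨i, rfl⟩ : ∃ i', i = i' + 1 := ⟨i - 1, by omega⟩
    simp only [List.length_cons] at hi
    have hle : max 1 (factorLength l (a :: z)) ≤ (a :: z).length := by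
      refine max_le (by simp) ?_
      unfold factorLength
      exact Nat.findGreatest_le _
    rcases Nat.eq_zero_or_pos i with rfl | hi0
    · refine ⟨[], a :: z, rfl, by simp, ?_⟩
      simp only [zero_add, List.take_succ_cons, List.take_zero, List.flatten_cons,
        List.flatten_nil, List.append_nil, List.length_nil, List.length_take]
      exact min_eq_left hle
    · obtain ⟨x, y, h1, h2, h3⟩ := ih ((a :: z).drop (max 1 (factorLength l (a :: z)))).length
        (by rw [← hn, List.length_drop]; simp) _ i ⟨hi0, by omega⟩ rfl
      refine ⟨(a :: z).take (max 1 (factorLength l (a :: z))) ++ x, y, ?_, h2, ?_⟩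
      · rw [List.append_assoc, ← h1, List.take_append_drop]
      · rw [List.take_succ_cons, List.flatten_cons, List.length_append, h3, List.length_append,
          add_assoc]

lemma HasPeriod_mul {w : List A} {p : ℕ} (h : w.HasPeriod p) (k : ℕ) : w.HasPeriod (k * p) := by
  rw [List.hasPeriod_iff_getElem?] at h ⊢
  induction k with
  | zero => simp
  | succ k ih =>
    intro i hi
    have h1 := ih i (by rw [add_mul, one_mul] at hi; omega)
    have h2 := h (i + k * p) (by rw [add_mul, one_mul] at hi; omega)
    rw [h1, h2, add_mul, one_mul, add_assoc]

lemma getElem?_window (w : List A) (x y i : ℕ) (h : x + i < y) : (window w x y)[i]? = w[x + i]? := by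
  rw [window, List.getElem?_drop, List.getElem?_take_of_lt h]

lemma hasPeriod_wordPow (w : List A) (n : ℕ) : (wordPow w n).HasPeriod w.length := by
  rcases eq_or_ne w [] with rfl | hw
  · simp
  · obtain ⟨e, h1, h2⟩ := exists_periodic hw
    rw [h2]
    exact hasPeriod_seg h1 _ _

/-- A word with period `p` whose length is a positive multiple of `p` is a power. -/
lemma eq_wordPow {w : List A} {p n : ℕ} (h : w.HasPeriod p) (hn : w.length = n * p) (hp : 0 < p) :
    w = wordPow (w.take p) n := by
  rcases Nat.eq_zero_or_pos n with rfl | hn0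
  · simpa using hn
  have hple : p ≤ w.length := by rw [hn]; exact Nat.le_mul_of_pos_left _ hn0
  have hl : (w.take p).length = p := by simp [hple]
  have h2 := hasPeriod_wordPow (w.take p) n
  rw [hl] at h2
  apply List.ext_getElem?
  intro i
  by_cases hi : i < w.length
  · rw [← h.getElem?_mod _ _ _ hi, ← h2.getElem?_mod _ _ _ (by simpa [hple, ← hn])]
    have hm := Nat.mod_lt i hp
    obtain ⟨n, rfl⟩ : ∃ m, n = m + 1 := ⟨n - 1, by omega⟩
    rw [wordPow_succ, List.getElem?_append_left (by omega), List.getElem?_take_of_lt hm]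
  · rw [List.getElem?_eq_none (by omega), List.getElem?_eq_none (by simp [hple, ← hn]; omega)]

/-- No cut lies in the middle of a long factor with a small period. -/
theorem not_mem_cuts_of_period {l f g j : ℕ} {z : List A} (hl : 0 < l) (hg : 0 < g)
    (hgl : 2 * g ≤ l) (hdvd : g ∣ l) (hf : 2 * l ≤ f) (hfj : f ≤ j) (hjf : j + f ≤ z.length)
    (hper : (window z (j - f) (j + f)).HasPeriod g) : j ∉ cuts l z := by
  intro hj
  obtain ⟨x, y, rfl, hy, hjx⟩ := exists_of_mem_cuts l z j hj
  have hy0 := List.length_pos_iff.2 hy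
  set m := factorLength l y with hm
  have hspec : rootLength (y.take m) ≤ l := by
    have h0 : rootLength (y.take 0) ≤ l :=
      (rootLength_le_iff _ _).2 ⟨[], 1, one_pos, by simp, by simp⟩
    classical
    rw [hm]
    unfold factorLength
    convert Nat.findGreatest_spec (P := fun n => rootLength (y.take n) ≤ l) (Nat.zero_le _) h0
  have hmax : ∀ m', m < m' → m' ≤ y.length → ¬ rootLength (y.take m') ≤ l := by
    classical
    intro m' h1 h2
    refine Nat.findGreatest_is_greatest (P := fun n => rootLength (y.take n) ≤ l) (n := y.length)
      ?_ h2
    refine lt_of_le_of_lt (le_of_eq ?_) h1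
    rw [hm]
    unfold factorLength
    congr
  simp only [List.length_append] at hjf
  -- A word of length at most `l` has a root of length at most `l`, so a factor shorter than `l`
  -- could be prolonged by one letter.
  have hml : l ≤ m := by
    by_contra hlt
    refine hmax (m + 1) (by omega) ?_ ?_
    · have : m ≤ y.length := by
        rw [hm]; unfold factorLength; exact Nat.findGreatest_le _
      by_contra h
      have h3 : max 1 m = m := max_eq_right (by omega)
      rw [h3] at hjx
      omega
    · exact (rootLength_le_iff _ _).2 ⟨y.take (m + 1), 1, one_pos, by simp, by simp; omega⟩
  rw [max_eq_right (by omega)] at hjx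
  have hmy : m + f ≤ y.length := by omega
  -- letters of `y` close to the cut
  have hyper : ∀ i, m - f ≤ i → i + g < m + f → y[i]? = y[i + g]? := by
    rw [List.hasPeriod_iff_getElem?, length_window] at hper
    intro i h1 h2
    have h3 := hper (x.length + i - (j - f)) (by simp; omega)
    rw [getElem?_window _ _ _ _ (by omega), getElem?_window _ _ _ _ (by omega),
      List.getElem?_append_right (by omega), List.getElem?_append_right (by omega)] at h3
    convert h3 using 2 <;> omega
  obtain ⟨w, n, hn, hw, hwl⟩ := (rootLength_le_iff _ _).1 hspec
  have hlen : m = n * w.length := by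
    have := congrArg List.length hw
    rw [length_wordPow, List.length_take, min_eq_left (by omega)] at this
    exact this
  have hw0 : 0 < w.length := by
    rcases Nat.eq_zero_or_pos w.length with h | h
    · rw [h] at hlen; omega
    · exact h
  -- it suffices to extend the factor by a period
  suffices H : ∃ q, 0 < q ∧ q ≤ l ∧ q ∣ m ∧ (y.take (m + q)).HasPeriod q by
    obtain ⟨q, hq, hql, ⟨r, hr⟩, hp⟩ := H
    refine hmax (m + q) (by omega) (by omega) ((rootLength_le_iff _ _).2
      ⟨_, r + 1, by omega, eq_wordPow hp ?_ hq, ?_⟩)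
    · rw [List.length_take, min_eq_left (by omega), hr]; ring
    · simp; omega
  -- If the factor is not a proper power, its length is exactly `l`, a multiple of `g`, and it lies
  -- in the window, so it can be prolonged by `g` letters. Otherwise its own period `|w|` continues
  -- beyond the cut.
  rcases Nat.lt_or_ge n 2 with hn2 | hn2
  · -- the factor has length `l`
    have hn1 : n = 1 := by omega
    rw [hn1, one_mul] at hlen
    have hml' : m = l := by omega
    refine ⟨g, hg, by omega, by rw [hml']; exact hdvd, ?_⟩
    rw [List.hasPeriod_iff_getElem?, List.length_take, min_eq_left (by omega)]
    intro i hi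
    rw [List.getElem?_take_of_lt (by omega), List.getElem?_take_of_lt (by omega)]
    exact hyper i (by omega) (by omega)
  · refine ⟨w.length, hw0, hwl, ⟨n, by rw [hlen, mul_comm]⟩, ?_⟩
    have hyw : ∀ i, i + w.length < m → y[i]? = y[i + w.length]? := by
      have h1 := hasPeriod_wordPow w n
      rw [← hw, List.hasPeriod_iff_getElem?, List.length_take, min_eq_left (by omega)] at h1
      intro i hi
      have := h1 i (by omega)
      rwa [List.getElem?_take_of_lt (by omega), List.getElem?_take_of_lt (by omega)] at this
    -- Together with `2 * g ≤ l ≤ m` this leaves room for `g + |w|` letters before the cut, enough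
    -- for Fine and Wilf.
    have h2w : 2 * w.length ≤ m := by rw [hlen]; exact Nat.mul_le_mul_right _ hn2
    -- both periods hold before the cut
    have hV : (window y (m - (g + w.length)) m).HasPeriod (g.gcd w.length) := by
      have hlw : (window y (m - (g + w.length)) m).length = g + w.length := by
        rw [length_window, min_eq_left (by omega)]; omega
      refine List.HasPeriod.gcd ?_ ?_ (by omega)
      · rw [List.hasPeriod_iff_getElem?, hlw]
        intro i hi
        rw [getElem?_window _ _ _ _ (by omega), getElem?_window _ _ _ _ (by omega),
          hyper _ (by omega) (by omega), add_assoc]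
      · rw [List.hasPeriod_iff_getElem?, hlw]
        intro i hi
        rw [getElem?_window _ _ _ _ (by omega), getElem?_window _ _ _ _ (by omega),
          hyw _ (by omega), add_assoc]
    have hVw : ∀ i k, m - (g + w.length) ≤ i → i + k * g.gcd w.length < m →
        y[i]? = y[i + k * g.gcd w.length]? := by
      intro i k h1 h2
      have h3 := HasPeriod_mul hV k
      rw [List.hasPeriod_iff_getElem?, length_window, min_eq_left (by omega)] at h3
      have h4 := h3 (i - (m - (g + w.length))) (by omega)
      rw [getElem?_window _ _ _ _ (by omega), getElem?_window _ _ _ _ (by omega)] at h4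
      convert h4 using 2 <;> omega
    -- hence the period `w.length` continues after the cut
    have hcont : ∀ t, t < w.length → y[m + t - w.length]? = y[m + t]? := by
      intro t ht
      -- shift the position `m + t` by multiples of `g` into the last `g` positions before the cut
      have hshift : y[m + t]? = y[m - g + t % g]? := by
        have : ∀ k, k * g ≤ g + t → y[m + t]? = y[m + t - k * g]? := by
          intro k
          induction k with
          | zero => simp
          | succ k ih =>
            intro hk
            rw [add_mul, one_mul] at hk
            rw [ih (by omega), add_mul, one_mul]
            have := hyper (m + t - (k * g + g)) (by omega) (by omega)
            rw [this]
            congr 1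
            omega
        have hd := Nat.div_add_mod t g
        have h1 := this (t / g + 1) (by rw [add_mul, one_mul, mul_comm]; omega)
        rw [h1]
        congr 1
        rw [add_mul, one_mul, mul_comm]
        have := Nat.mod_lt t hg
        omega
      rw [hshift]
      have hd := Nat.div_add_mod t g
      have hgm := Nat.mod_lt t hg
      obtain ⟨r, hr⟩ := Nat.gcd_dvd_left g w.length
      obtain ⟨s, hs⟩ := Nat.gcd_dvd_right g w.length
      have er : r * g.gcd w.length = g := by rw [mul_comm]; exact hr.symm
      have es : s * g.gcd w.length = w.length := by rw [mul_comm]; exact hs.symm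
      -- the positions `m + t - w.length` and `m - g + t % g` differ by a multiple of the gcd
      rcases le_total (m + t - w.length) (m - g + t % g) with hc | hc
      · have : m - g + t % g = (m + t - w.length) + (s - r - r * (t / g)) * g.gcd w.length := by
          have e1 : r * (t / g) * g.gcd w.length = g * (t / g) := by
            rw [mul_right_comm, er]
          have e2 : (s - r - r * (t / g)) * g.gcd w.length =
              w.length - g - g * (t / g) := by
            rw [Nat.sub_mul, Nat.sub_mul, e1, er, es]
          rw [e2]; omega
        rw [this]
        exact hVw _ _ (by omega) (by omega)
      · have : m + t - w.length = (m - g + t % g) + (r + r * (t / g) - s) * g.gcd w.length := by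
          have e1 : r * (t / g) * g.gcd w.length = g * (t / g) := by
            rw [mul_right_comm, er]
          have e2 : (r + r * (t / g) - s) * g.gcd w.length =
              g + g * (t / g) - w.length := by
            rw [Nat.sub_mul, add_mul, e1, er, es]
          rw [e2]; omega
        rw [this]
        exact (hVw _ _ (by omega) (by omega)).symm
    rw [List.hasPeriod_iff_getElem?, List.length_take, min_eq_left (by omega)]
    intro i hi
    rw [List.getElem?_take_of_lt (by omega), List.getElem?_take_of_lt (by omega)]
    rcases Nat.lt_or_ge (i + w.length) m with h | h
    · exact hyw i h
    · have := hcont (i + w.length - m) (by omega)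
      convert this using 2 <;> omega

end CutPositions

/-! ## Substitutions and their evaluation -/

namespace Subst

section Basics

variable {X A B : Type*}

/-- The word obtained by replacing every variable by its value. -/
def eval (ρ : X → List A) (z : List (X ⊕ A)) : List A := z.flatMap (Sum.elim ρ fun a => [a])

@[simp] lemma eval_nil (ρ : X → List A) : eval ρ [] = [] := rfl

@[simp] lemma eval_append (ρ : X → List A) (y z : List (X ⊕ A)) :
    eval ρ (y ++ z) = eval ρ y ++ eval ρ z := by simp [eval]

@[simp] lemma eval_inl (ρ : X → List A) (x : X) (z : List (X ⊕ A)) :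
    eval ρ (Sum.inl x :: z) = ρ x ++ eval ρ z := by simp [eval]

@[simp] lemma eval_inr (ρ : X → List A) (a : A) (z : List (X ⊕ A)) :
    eval ρ (Sum.inr a :: z) = a :: eval ρ z := by simp [eval]

@[simp] lemma hat_nil (σ : Subst X A) : hat σ [] = [] := rfl

@[simp] lemma hat_append (σ : Subst X A) (y z : List (X ⊕ A)) :
    hat σ (y ++ z) = hat σ y ++ hat σ z := by simp [hat]

@[simp] lemma hat_inl (σ : Subst X A) (x : X) (z : List (X ⊕ A)) :
    hat σ (Sum.inl x :: z) = σ x ++ hat σ z := by simp [hat]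

@[simp] lemma hat_inr (σ : Subst X A) (a : A) (z : List (X ⊕ A)) :
    hat σ (Sum.inr a :: z) = Sum.inr a :: hat σ z := by simp [hat]

@[simp] lemma varsOf_nil : varsOf ([] : List (X ⊕ A)) = [] := rfl

@[simp] lemma varsOf_append (y z : List (X ⊕ A)) : varsOf (y ++ z) = varsOf y ++ varsOf z := by
  simp [varsOf]

@[simp] lemma varsOf_inl (x : X) (z : List (X ⊕ A)) : varsOf (Sum.inl x :: z) = x :: varsOf z := by
  simp [varsOf]

@[simp] lemma varsOf_inr (a : A) (z : List (X ⊕ A)) : varsOf (Sum.inr a :: z) = varsOf z := by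
  simp [varsOf, List.filterMap_cons]

@[simp] lemma eraseVars_nil : eraseVars ([] : List (X ⊕ A)) = [] := rfl

@[simp] lemma eraseVars_append (y z : List (X ⊕ A)) :
    eraseVars (y ++ z) = eraseVars y ++ eraseVars z := by simp [eraseVars]

@[simp] lemma eraseVars_inl (x : X) (z : List (X ⊕ A)) :
    eraseVars (Sum.inl x :: z) = eraseVars z := by simp [eraseVars, List.filterMap_cons]

@[simp] lemma eraseVars_inr (a : A) (z : List (X ⊕ A)) :
    eraseVars (Sum.inr a :: z) = a :: eraseVars z := by simp [eraseVars]

lemma mem_varsOf {x : X} {z : List (X ⊕ A)} : x ∈ varsOf z ↔ Sum.inl x ∈ z := by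
  induction z with
  | nil => simp
  | cons y z ih => rcases y with y | a <;> simp [ih]

lemma mem_eraseVars {a : A} {z : List (X ⊕ A)} : a ∈ eraseVars z ↔ Sum.inr a ∈ z := by
  induction z with
  | nil => simp
  | cons y z ih => rcases y with y | b <;> simp [ih]

lemma exists_split_of_mem_varsOf {x : X} {z : List (X ⊕ A)} (h : x ∈ varsOf z) :
    ∃ α β, z = α ++ Sum.inl x :: β :=
  List.append_of_mem (mem_varsOf.1 h)

lemma eval_hat (ρ : X → List A) (σ : Subst X A) (z : List (X ⊕ A)) :
    eval ρ (hat σ z) = eval (fun x => eval ρ (σ x)) z := by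
  induction z with
  | nil => rfl
  | cons y z ih => rcases y with y | a <;> simp [ih]

lemma eraseVars_eq_eval (z : List (X ⊕ A)) : eraseVars z = eval (fun _ => []) z := by
  induction z with
  | nil => rfl
  | cons y z ih => rcases y with y | a <;> simp [ih]

lemma eval_congr {ρ ρ' : X → List A} {z : List (X ⊕ A)} (h : ∀ x ∈ varsOf z, ρ x = ρ' x) :
    eval ρ z = eval ρ' z := by
  induction z with
  | nil => rfl
  | cons y z ih =>
    rcases y with y | a
    · simp only [varsOf_inl, List.mem_cons, forall_eq_or_imp] at h
      simp [h.1, ih h.2]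
    · simp only [varsOf_inr] at h
      simp [ih h]

lemma eval_of_varsOf_eq_nil {ρ : X → List A} {z : List (X ⊕ A)} (h : varsOf z = []) :
    eval ρ z = eraseVars z := by
  rw [eraseVars_eq_eval]
  exact eval_congr (by simp [h])

lemma hat_hat (σ τ : Subst X A) (z : List (X ⊕ A)) : hat σ (hat τ z) = hat (comp σ τ) z := by
  induction z with
  | nil => rfl
  | cons y z ih => rcases y with y | a <;> simp [ih, comp]

lemma hat_ident (z : List (X ⊕ A)) : hat ident z = z := by
  induction z with
  | nil => rfl
  | cons y z ih => rcases y with y | a <;> simp [ih, ident]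

lemma comp_assoc (σ τ υ : Subst X A) : comp (comp σ τ) υ = comp σ (comp τ υ) := by
  funext x
  exact (hat_hat σ τ (υ x)).symm

@[simp] lemma ident_comp (σ : Subst X A) : comp ident σ = σ := by
  funext x; exact hat_ident _

@[simp] lemma comp_ident (σ : Subst X A) : comp σ ident = σ := by
  funext x; simp [comp, ident]

@[simp] lemma compSeq_nil : compSeq ([] : List (Subst X A)) = ident := rfl

@[simp] lemma compSeq_cons (σ : Subst X A) (s : List (Subst X A)) :
    compSeq (σ :: s) = comp σ (compSeq s) := rfl

lemma compSeq_append (s r : List (Subst X A)) :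
    compSeq (s ++ r) = comp (compSeq s) (compSeq r) := by
  induction s with
  | nil => simp
  | cons σ s ih => simp [ih, comp_assoc]

lemma varsOf_hat (σ : Subst X A) (z : List (X ⊕ A)) :
    varsOf (hat σ z) = (varsOf z).flatMap fun x => varsOf (σ x) := by
  induction z with
  | nil => rfl
  | cons y z ih => rcases y with y | a <;> simp [ih]

lemma eraseVars_hat (σ : Subst X A) (z : List (X ⊕ A)) :
    eraseVars (hat σ z) = eval (fun x => eraseVars (σ x)) z := by
  rw [eraseVars_eq_eval, eval_hat]
  simp only [← eraseVars_eq_eval]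

/-- The contents of the variables after a sequence of substitutions. -/
def content (s : List (Subst X A)) (x : X) : List A := eraseVars (compSeq s x)

lemma content_append (s r : List (Subst X A)) (x : X) :
    content (s ++ r) x = eval (content s) (compSeq r x) := by
  rw [content, compSeq_append, comp, eraseVars_hat]
  rfl

lemma output_append (O : X) (s r : List (Subst X A)) :
    output O (s ++ r) = eval (content s) (compSeq r O) :=
  content_append s r O

lemma length_eval (ρ : X → List A) (z : List (X ⊕ A)) :
    (eval ρ z).length =
      (eraseVars z).length + ((varsOf z).map fun x => (ρ x).length).sum := by
  induction z with
  | nil => rfl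
  | cons y z ih => rcases y with y | a <;> simp [ih] <;> omega

/-! ## Copyless substitutions -/

lemma Copyless.eq_of_mem {σ : Subst X A} (h : σ.Copyless) {x y z : X} (hx : z ∈ varsOf (σ x))
    (hy : z ∈ varsOf (σ y)) : x = y := by
  by_contra hne
  exact h.2 x y hne hx hy

lemma Copyless.nodup_hat {σ : Subst X A} (h : σ.Copyless) {z : List (X ⊕ A)}
    (hz : (varsOf z).Nodup) : (varsOf (hat σ z)).Nodup := by
  rw [varsOf_hat, List.nodup_flatMap]
  exact ⟨fun x _ => h.1 x, hz.imp fun hne => h.2 _ _ hne⟩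

lemma Copyless.comp {σ τ : Subst X A} (hσ : σ.Copyless) (hτ : τ.Copyless) :
    (comp σ τ).Copyless := by
  refine ⟨fun x => hσ.nodup_hat (hτ.1 x), fun x y hxy z hx hy => ?_⟩
  simp only [Subst.comp, varsOf_hat, List.mem_flatMap] at hx hy
  obtain ⟨u, hu, hzu⟩ := hx
  obtain ⟨v, hv, hzv⟩ := hy
  obtain rfl := hσ.eq_of_mem hzu hzv
  exact hxy (hτ.eq_of_mem hu hv)

lemma copyless_ident : (ident : Subst X A).Copyless := by
  refine ⟨fun x => by simp [ident], fun x y hxy z hx hy => ?_⟩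
  simp only [ident, varsOf_inl, varsOf_nil, List.mem_singleton] at hx hy
  exact hxy (hx.symm.trans hy)

lemma copyless_compSeq {s : List (Subst X A)} (h : ∀ σ ∈ s, σ.Copyless) :
    (compSeq s).Copyless := by
  induction s with
  | nil => exact copyless_ident
  | cons σ s ih =>
    simp only [List.mem_cons, forall_eq_or_imp] at h
    exact h.1.comp (ih h.2)

/-! ## Weights -/

/-- Forgetting the letters of a word. -/
def shape (z : List (X ⊕ A)) : List (X ⊕ Unit) := z.map (Sum.map id fun _ => ())

@[simp] lemma shape_append (y z : List (X ⊕ A)) : shape (y ++ z) = shape y ++ shape z := by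
  simp [shape]

lemma shape_hat (σ : Subst X A) (z : List (X ⊕ A)) :
    shape (hat σ z) = hat (fun x => shape (σ x)) (shape z) := by
  induction z with
  | nil => rfl
  | cons y z ih =>
    rcases y with y | a
    · simp only [hat_inl, shape_append, ih]; simp [shape]
    · rw [hat_inr]
      show _ :: shape (hat σ z) = _
      rw [ih]; simp [shape]

lemma shape_compSeq (s : List (Subst X A)) (x : X) :
    shape (compSeq s x) = compSeq (s.map fun σ x => shape (σ x)) x := by
  induction s with
  | nil => simp [shape, ident]
  | cons σ s ih =>
    simp only [compSeq_cons, List.map_cons, comp, shape_hat, ih]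

lemma length_eraseVars_shape (z : List (X ⊕ A)) :
    (eraseVars (shape z)).length = (eraseVars z).length := by
  induction z with
  | nil => rfl
  | cons y z ih => rcases y with y | a <;> simpa [shape] using ih

lemma length_eval_shape {ρ : X → List A} {ρ' : X → List B} {z : List (X ⊕ A)} {z' : List (X ⊕ B)}
    (hρ : ∀ x, (ρ x).length = (ρ' x).length) (hz : shape z = shape z') :
    (eval ρ z).length = (eval ρ' z').length := by
  induction z generalizing z' with
  | nil =>
    rcases z' with _ | ⟨y, z'⟩
    · rfl
    · simp [shape] at hz
  | cons y z ih =>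
    rcases z' with _ | ⟨y', z'⟩
    · simp [shape] at hz
    simp only [shape, List.map_cons, List.cons.injEq] at hz
    have := ih (z' := z') hz.2
    rcases y with y | a <;> rcases y' with y' | a' <;> simp at hz
    · simp [hz.1, hρ, this]
    · simp [this]

lemma forall_mem_compSeq {p : A → Prop} {s : List (Subst X A)}
    (h : ∀ σ ∈ s, ∀ x, ∀ a ∈ eraseVars (σ x), p a) (x : X) : ∀ a ∈ eraseVars (compSeq s x), p a := by
  induction s generalizing x with
  | nil => simp [ident]
  | cons σ s ih =>
    simp only [List.mem_cons, forall_eq_or_imp] at h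
    intro a ha
    rw [compSeq_cons, comp, mem_eraseVars, hat, List.mem_flatMap] at ha
    obtain ⟨y, hy, hay⟩ := ha
    rcases y with y | b
    · exact h.1 y a (mem_eraseVars.2 hay)
    · simp only [Sum.elim_inr, List.mem_singleton, Sum.inr.injEq] at hay
      exact hay ▸ ih h.2 x b (mem_eraseVars.2 hy)

lemma countP_eval {p : A → Bool} {ρ : X → List A} {z : List (X ⊕ A)}
    (hρ : ∀ x, ∀ a ∈ ρ x, p a) (hz : ∀ a ∈ eraseVars z, ¬ p a) :
    (eval ρ z).countP p + (eraseVars z).length = (eval ρ z).length := by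
  induction z with
  | nil => rfl
  | cons y z ih =>
    rcases y with y | a
    · have := ih (by simpa using hz)
      have h1 : (ρ y).countP p = (ρ y).length := List.countP_eq_length.2 (hρ y)
      simp only [eval_inl, List.countP_append, eraseVars_inl, List.length_append, h1]
      omega
    · simp only [eraseVars_inr, List.mem_cons, forall_eq_or_imp] at hz
      have := ih hz.2
      simp only [eval_inr, eraseVars_inr, List.length_cons, List.countP_cons, hz.1]
      simp; omega

/-- The stamps are an arbitrary function of the index, because the second part of a split sequence
is stamped with an offset. -/
lemma stamp_map_shape (s : List (Subst X A)) (f : ℕ → ℕ) :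
    ((s.mapIdx fun i (σ : Subst X A) (x : X) => (σ x).map (Sum.map id fun _ => f i)).map
      fun σ x => shape (σ x)) = s.map fun σ x => shape (σ x) := by
  apply List.ext_getElem
  · simp
  · intro i h1 h2
    simp only [List.getElem_mapIdx, List.getElem_map]
    funext x
    simp [shape, Function.comp_def, Sum.map_map]

/-- The output positions before a cut with a late origin are the letters of the word that describes
the cut at that time. -/
theorem weight_add_length (O : X) (s r : List (Subst X A)) {l m : List (X ⊕ A)} {c : List X}
    (hw : compSeq r O = l ++ (c.map Sum.inl ++ m)) {i j : ℕ}
    (hi : i ≤ (eval (content s) (c.map Sum.inl)).length)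
    (hj : j = (eval (content s) l).length + i) :
    weight O j s.length (s ++ r) + (eraseVars l).length = j := by
  set s' : List (Subst X ℕ) := s.mapIdx fun i (σ : Subst X A) (x : X) =>
    (σ x).map (Sum.map id fun _ => i + 1) with hs'
  set r' : List (Subst X ℕ) := r.mapIdx fun i (σ : Subst X A) (x : X) =>
    (σ x).map (Sum.map id fun _ => i + s.length + 1) with hr'
  have hst : stamp (s ++ r) = s' ++ r' := by
    rw [stamp, List.mapIdx_append]
  -- The values of the variables carry the stamps of the first part, at most `|s|`; the letters of
  -- `l` carry those of the second part, which exceed `|s|`.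
  have hs'l : ∀ x, ∀ a ∈ content s' x, a ≤ s.length := by
    refine forall_mem_compSeq fun σ hσ x a ha => ?_
    obtain ⟨i, hi, rfl⟩ := List.mem_mapIdx.1 hσ
    rw [mem_eraseVars, List.mem_map] at ha
    obtain ⟨y, _, hy⟩ := ha
    rcases y with y | b <;> simp at hy
    omega
  have hr'l : ∀ x, ∀ a ∈ eraseVars (compSeq r' x), s.length < a := by
    refine forall_mem_compSeq fun σ hσ x a ha => ?_
    obtain ⟨i, hi, rfl⟩ := List.mem_mapIdx.1 hσ
    rw [mem_eraseVars, List.mem_map] at ha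
    obtain ⟨y, _, hy⟩ := ha
    rcases y with y | b <;> simp at hy
    omega
  have hsh : shape (compSeq r' O) = shape l ++ (shape (A := A) (c.map Sum.inl) ++ shape m) := by
    rw [shape_compSeq, hr', stamp_map_shape r (fun i => i + s.length + 1), ← shape_compSeq, hw]
    simp
  obtain ⟨l', m₁, hw', hl', hm₁⟩ := List.map_eq_append_iff.1 hsh
  obtain ⟨c', m', rfl, hc', -⟩ := List.map_eq_append_iff.1 hm₁
  have hcont : ∀ x, (content s' x).length = (content s x).length := by
    intro x
    have h1 : shape (compSeq s' x) = shape (compSeq s x) := by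
      rw [shape_compSeq, shape_compSeq, hs', stamp_map_shape s (fun i => i + 1)]
    rw [content, content, ← length_eraseVars_shape, h1, length_eraseVars_shape]
  have hlen1 : (eval (content s') l').length = (eval (content s) l).length :=
    length_eval_shape hcont hl'
  have hlen2 : (eval (content s') c').length = (eval (content s) (c.map Sum.inl)).length :=
    length_eval_shape hcont hc'
  have hlen3 : (eraseVars l').length = (eraseVars l).length := by
    rw [← length_eraseVars_shape l', ← length_eraseVars_shape l]
    exact congrArg (fun z => (eraseVars z).length) hl'
  have hc'v : eraseVars c' = [] := by
    have h1 : (eraseVars c').length = 0 := by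
      rw [← length_eraseVars_shape c']
      have : shape c' = shape (A := A) (c.map Sum.inl) := hc'
      rw [this, length_eraseVars_shape, eraseVars]
      simp [List.filterMap_map, Function.comp_def]
    exact List.length_eq_zero_iff.1 h1
  have htake : (originWord O (s ++ r)).take j =
      eval (content s') l' ++ (eval (content s') c').take i := by
    rw [originWord, hst, output_append, hw', eval_append, eval_append, hj, ← hlen1,
      List.take_length_add_append, List.take_append_of_le_length (by omega)]
  rw [weight, htake, List.countP_append]
  have h1 := countP_eval (p := fun o => decide (o ≤ s.length)) (ρ := content s') (z := l')
    (by simpa using hs'l)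
    (by
      intro a ha
      have := hr'l O a (by rw [hw', eraseVars_append]; exact List.mem_append_left _ ha)
      simp; omega)
  have h2 : ((eval (content s') c').take i).countP (fun o => decide (o ≤ s.length)) = i := by
    rw [List.countP_eq_length.2, List.length_take, min_eq_left (by omega)]
    intro a ha
    have ha' := List.mem_of_mem_take ha
    rw [eval, List.mem_flatMap] at ha'
    obtain ⟨y, hy, hay⟩ := ha'
    rcases y with y | b
    · simpa using hs'l y a hay
    · exact absurd (mem_eraseVars.2 hy) (by simp [hc'v])
  omega

end Basics

end Subst

/-! ## Frames: the position of a cut in the course of a run -/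

section WindowLemmas

variable {A : Type*}

@[simp] lemma window_self (w : List A) (x : ℕ) : window w x x = [] := by
  simp [window]

lemma take_append_window (w : List A) {x y : ℕ} (h : x ≤ y) :
    w.take x ++ window w x y = w.take y := by
  rw [window]
  conv_rhs => rw [← List.take_append_drop x (w.take y), List.take_take, min_eq_left h]

lemma window_append_drop (w : List A) {x y : ℕ} (h : x ≤ y) :
    window w x y ++ w.drop y = w.drop x := by
  have h1 : w.take x ++ (window w x y ++ w.drop y) = w.take x ++ w.drop x := by
    rw [← List.append_assoc, take_append_window w h, List.take_append_drop, List.take_append_drop]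
  exact List.append_cancel_left h1

lemma window_append_window (w : List A) {x y z : ℕ} (h : x ≤ y) (h' : y ≤ z) :
    window w x y ++ window w y z = window w x z := by
  have h1 : w.take x ++ (window w x y ++ window w y z) = w.take x ++ window w x z := by
    rw [← List.append_assoc, take_append_window w h, take_append_window w h',
      take_append_window w (h.trans h')]
  exact List.append_cancel_left h1

lemma mem_of_mem_window {w : List A} {x y : ℕ} {a : A} (h : a ∈ window w x y) : a ∈ w :=
  List.mem_of_mem_take (List.mem_of_mem_drop h)

/-- Frames have to be chosen from the end of the run: a cut in the value of a variable is refined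
when the variable is replaced by its image under the preceding substitution. -/
lemma exists_backward {α : Type*} (N : ℕ) :
    ∀ (P : ℕ → α → Prop) (R : ℕ → α → α → Prop), (∃ a, P N a) →
    (∀ t < N, ∀ b, P (t + 1) b → ∃ a, P t a ∧ R t a b) →
    ∃ g : ℕ → α, (∀ t ≤ N, P t (g t)) ∧ ∀ t < N, R t (g t) (g (t + 1)) := by
  induction N with
  | zero =>
    rintro P R ⟨a, ha⟩ _
    exact ⟨fun _ => a, fun t ht => by rwa [Nat.le_zero.1 ht], fun t ht => absurd ht (by omega)⟩
  | succ N ih =>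
    intro P R h0 h
    obtain ⟨g, hg, hgR⟩ := ih (fun t => P (t + 1)) (fun t => R (t + 1)) h0
      fun t ht b hb => h (t + 1) (by omega) b hb
    obtain ⟨a, ha, haR⟩ := h 0 (by omega) _ (hg 0 (Nat.zero_le _))
    refine ⟨fun t => Nat.casesOn t a g, fun t ht => ?_, fun t ht => ?_⟩
    · rcases t with _ | t
      · exact ha
      · exact hg t (by omega)
    · rcases t with _ | t
      · exact haR
      · exact hgR t (by omega)

end WindowLemmas

namespace Subst

/-- A decomposition of a word at a cut of its value, which lies between two letters or variables or
in the value of a variable. -/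
structure Frame (X A : Type*) where
  /-- the part left of the cut -/
  l : List (X ⊕ A)
  /-- the variable whose value contains the cut -/
  c : Option X
  /-- the part right of the cut -/
  r : List (X ⊕ A)
  /-- the part of the value of the variable that is left of the cut -/
  u : List A
  /-- the part of the value of the variable that is right of the cut -/
  v : List A

section Frames

variable {X A : Type*}

/-- The word that consists of an optional variable. -/
def optWord (c : Option X) : List (X ⊕ A) := c.toList.map Sum.inl

@[simp] lemma optWord_none : optWord (none : Option X) = ([] : List (X ⊕ A)) := rfl

@[simp] lemma optWord_some (x : X) : optWord (some x) = ([Sum.inl x] : List (X ⊕ A)) := rfl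

/-- The frame describes the cut `j` of the value of `w`. -/
structure Frame.Valid (F : Frame X A) (ρ : X → List A) (w : List (X ⊕ A)) (j : ℕ) : Prop where
  word : w = F.l ++ (optWord F.c ++ F.r)
  value : eval ρ (optWord F.c) = F.u ++ F.v
  pos : (eval ρ F.l).length + F.u.length = j

/-- The two frames describe the same cut before and after the application of a substitution. -/
def Frame.Step (σ : Subst X A) (F G : Frame X A) : Prop :=
  ∃ α β, hat σ (optWord G.c) = α ++ (optWord F.c ++ β) ∧ F.l = hat σ G.l ++ α ∧
    F.r = β ++ hat σ G.r

lemma exists_frame (ρ : X → List A) (w : List (X ⊕ A)) (j : ℕ) (hj : j ≤ (eval ρ w).length) :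
    ∃ F : Frame X A, F.Valid ρ w j := by
  induction w generalizing j with
  | nil =>
    simp only [eval_nil, List.length_nil, Nat.le_zero] at hj
    exact ⟨⟨[], none, [], [], []⟩, by simp, by simp, by simp [hj]⟩
  | cons y w ih =>
    rcases y with x | a
    · rcases le_total j (ρ x).length with h | h
      · exact ⟨⟨[], some x, w, (ρ x).take j, (ρ x).drop j⟩, by simp, by simp, by simpa using h⟩
      · obtain ⟨F, h1, h2, h3⟩ := ih (j - (ρ x).length) (by simp at hj; omega)
        exact ⟨⟨Sum.inl x :: F.l, F.c, F.r, F.u, F.v⟩, by simp [← h1], h2, by simp; omega⟩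
    · rcases Nat.eq_zero_or_pos j with rfl | h
      · exact ⟨⟨[], none, Sum.inr a :: w, [], []⟩, by simp, by simp, by simp⟩
      · obtain ⟨F, h1, h2, h3⟩ := ih (j - 1) (by simp at hj; omega)
        exact ⟨⟨Sum.inr a :: F.l, F.c, F.r, F.u, F.v⟩, by simp [← h1], h2, by simp; omega⟩

/-- Only the variable at the cut has to be refined: its image is split at the position `|u|` of its
value. -/
lemma Frame.Valid.exists_step {G : Frame X A} {ρ : X → List A} {σ : Subst X A}
    {w : List (X ⊕ A)} {j : ℕ} (h : G.Valid (fun x => eval ρ (σ x)) w j) :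
    ∃ F : Frame X A, F.Valid ρ (hat σ w) j ∧ F.Step σ G := by
  have hv := h.value
  rw [← eval_hat] at hv
  obtain ⟨F, h1, h2, h3⟩ := exists_frame ρ (hat σ (optWord G.c)) G.u.length (by simp [hv])
  refine ⟨⟨hat σ G.l ++ F.l, F.c, F.r ++ hat σ G.r, F.u, F.v⟩, ⟨?_, h2, ?_⟩, F.l, F.r, h1, rfl, rfl⟩
  · conv_lhs => rw [h.word]
    simp [h1]
  · have := h.pos
    rw [← eval_hat] at this
    simp only [eval_append, List.length_append]
    omega

lemma Frame.Step.refl (F : Frame X A) : F.Step ident F :=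
  ⟨[], [], by simp [hat_ident], by simp [hat_ident], by simp [hat_ident]⟩

lemma Frame.Step.trans {F G H : Frame X A} {σ τ : Subst X A} (h : F.Step σ G) (h' : G.Step τ H) :
    F.Step (comp σ τ) H := by
  obtain ⟨α, β, h1, h2, h3⟩ := h
  obtain ⟨α', β', h1', h2', h3'⟩ := h'
  refine ⟨hat σ α' ++ α, β ++ hat σ β', ?_, ?_, ?_⟩
  · rw [← hat_hat, h1']
    simp [h1]
  · rw [h2, h2', ← hat_hat]
    simp
  · rw [h3, h3', ← hat_hat]
    simp

lemma content_take (s : List (Subst X A)) {t t' : ℕ} (h : t ≤ t') (x : X) :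
    content (s.take t') x = eval (content (s.take t)) (compSeq (window s t t') x) := by
  rw [← take_append_window s h, content_append]

lemma compSeq_drop (s : List (Subst X A)) {t t' : ℕ} (h : t ≤ t') (x : X) :
    compSeq (s.drop t) x = hat (compSeq (window s t t')) (compSeq (s.drop t') x) := by
  rw [← window_append_drop s h, compSeq_append, comp]

lemma compSeq_window (s : List (Subst X A)) {x y z : ℕ} (h : x ≤ y) (h' : y ≤ z) :
    compSeq (window s x z) = comp (compSeq (window s x y)) (compSeq (window s y z)) := by
  rw [← window_append_window s h h', compSeq_append]

/-- A cut of the output can be followed through the whole sequence. -/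
theorem exists_frames (O : X) (s : List (Subst X A)) (j : ℕ) (hj : j ≤ (output O s).length) :
    ∃ F : ℕ → Frame X A,
      (∀ t ≤ s.length, (F t).Valid (content (s.take t)) (compSeq (s.drop t) O) j) ∧
      ∀ t t', t ≤ t' → t' ≤ s.length → (F t).Step (compSeq (window s t t')) (F t') := by
  obtain ⟨F, hF, hs⟩ := exists_backward (α := Frame X A) s.length
    (fun t F => F.Valid (content (s.take t)) (compSeq (s.drop t) O) j)
    (fun t F G => F.Step (compSeq (window s t (t + 1))) G)
    (exists_frame _ _ _ (by
      rw [← output_append, List.take_append_drop]; exact hj))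
    (by
      intro t ht G hG
      rw [funext (content_take s (Nat.le_succ t))] at hG
      rw [compSeq_drop s (Nat.le_succ t)]
      exact hG.exists_step)
  refine ⟨F, hF, fun t t' h h' => ?_⟩
  induction t', h using Nat.le_induction with
  | base => simpa using Frame.Step.refl (F t)
  | succ t' ht ih =>
    rw [compSeq_window s ht (Nat.le_succ t')]
    exact (ih (by omega)).trans (hs t' (by omega))

/-- The letters of `F.l` are those before the cut that are not yet written at time `t`. Differences
of weights thus become differences of letter counts in frames. -/
lemma Frame.Valid.weight {F : Frame X A} {O : X} {s : List (Subst X A)} {t j : ℕ}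
    (ht : t ≤ s.length) (h : F.Valid (content (s.take t)) (compSeq (s.drop t) O) j) :
    weight O j t s + (eraseVars F.l).length = j := by
  have := weight_add_length O (s.take t) (s.drop t) (l := F.l) (m := F.r) (c := F.c.toList)
    (by rw [h.word]; rfl) (i := F.u.length) (j := j)
    (by
      have := h.value
      rw [optWord] at this
      simp [this]) h.pos.symm
  rwa [List.length_take, min_eq_left ht, List.take_append_drop] at this

lemma length_eraseVars_hat (σ : Subst X A) (z : List (X ⊕ A)) :
    (eraseVars (hat σ z)).length =
      (eraseVars z).length + ((varsOf z).map fun x => (eraseVars (σ x)).length).sum := by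
  rw [eraseVars_hat, length_eval]

lemma sum_map_le_of_nodup [Fintype X] {L : List X} (h : L.Nodup) (f : X → ℕ) :
    (L.map f).sum ≤ ∑ x, f x := by
  classical
  rw [← List.sum_toFinset f h]
  exact Finset.sum_le_sum_of_subset (Finset.subset_univ _)

lemma Frame.Step.length_le [Fintype X] {F G : Frame X A} {σ : Subst X A} (h : F.Step σ G)
    (hG : (varsOf (G.l ++ (optWord G.c ++ G.r))).Nodup) :
    (eraseVars F.l).length ≤ (eraseVars G.l).length + ∑ x, (eraseVars (σ x)).length := by
  obtain ⟨α, β, h1, h2, -⟩ := h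
  have h3 : (eraseVars F.l).length ≤ (eraseVars (hat σ (G.l ++ optWord G.c))).length := by
    rw [hat_append, h1, h2]
    simp only [eraseVars_append, List.length_append]
    omega
  have h4 : (varsOf (G.l ++ optWord G.c)).Nodup := by
    rw [← List.append_assoc, varsOf_append] at hG
    exact hG.of_append_left
  have h5 := sum_map_le_of_nodup h4 fun x => (eraseVars (σ x)).length
  rw [length_eraseVars_hat] at h3
  have h6 : eraseVars (optWord G.c : List (X ⊕ A)) = [] := by
    rcases G.c with _ | x <;> simp
  rw [eraseVars_append, h6, List.append_nil] at h3
  omega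

lemma Frame.Step.le_length {F G : Frame X A} {σ : Subst X A} (h : F.Step σ G) :
    (eraseVars G.l).length ≤ (eraseVars F.l).length := by
  obtain ⟨α, β, -, h2, -⟩ := h
  rw [h2, eraseVars_append, List.length_append, length_eraseVars_hat]
  omega

end Frames

end Subst

/-! ## Classes of substitutions -/

namespace Subst

section Classes

variable {X A : Type*}

/-- The value of a word under a valuation of variables and letters in a finite monoid; the letters
are not distinguished. -/
def val (g : X ⊕ Unit → Function.End (Fin 3)) (z : List (X ⊕ A)) : Function.End (Fin 3) :=
  ((shape z).map g).prod

@[simp] lemma val_nil (g : X ⊕ Unit → Function.End (Fin 3)) : val g ([] : List (X ⊕ A)) = 1 := rfl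

@[simp] lemma val_append (g : X ⊕ Unit → Function.End (Fin 3)) (y z : List (X ⊕ A)) :
    val g (y ++ z) = val g y * val g z := by simp [val]

@[simp] lemma val_inl (g : X ⊕ Unit → Function.End (Fin 3)) (x : X) (z : List (X ⊕ A)) :
    val g (Sum.inl x :: z) = g (Sum.inl x) * val g z := by simp [val, shape]

@[simp] lemma val_inr (g : X ⊕ Unit → Function.End (Fin 3)) (a : A) (z : List (X ⊕ A)) :
    val g (Sum.inr a :: z) = g (Sum.inr ()) * val g z := by simp [val, shape]

/-- The action of a substitution on valuations. -/
def cls (σ : Subst X A) (g : X ⊕ Unit → Function.End (Fin 3)) :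
    X ⊕ Unit → Function.End (Fin 3) :=
  Sum.elim (fun x => val g (σ x)) fun a => g (Sum.inr a)

lemma val_hat (σ : Subst X A) (g : X ⊕ Unit → Function.End (Fin 3)) (z : List (X ⊕ A)) :
    val g (hat σ z) = val (cls σ g) z := by
  induction z with
  | nil => rfl
  | cons y z ih => rcases y with y | a <;> simp [ih, cls]

/-- The action on valuations reverses the composition, which is why `SST.Acts` is an opposite
monoid. -/
lemma cls_comp (σ τ : Subst X A) : cls (comp σ τ) = cls τ ∘ cls σ := by
  funext g y
  rcases y with x | a
  · exact val_hat σ g (τ x)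
  · rfl

/-- A variable or letter satisfying `p` occurs to the left of one satisfying `q`. -/
def Prec (p q : X ⊕ Unit → Prop) (z : List (X ⊕ A)) : Prop :=
  ∃ s t, z = s ++ t ∧ (∃ y ∈ shape s, p y) ∧ ∃ y ∈ shape t, q y

lemma prec_cons {p q : X ⊕ Unit → Prop} (y : X ⊕ A) (z : List (X ⊕ A)) :
    Prec p q (y :: z) ↔
      (p (y.map id fun _ => ()) ∧ ∃ y ∈ shape z, q y) ∨ (∃ y ∈ shape z, q y) ∧ Prec p q z := by
  constructor
  · rintro ⟨s, t, h, ⟨a, ha, hpa⟩, hq⟩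
    rcases s with _ | ⟨y', s⟩
    · simp [shape] at ha
    · simp only [List.cons_append, List.cons.injEq] at h
      obtain ⟨rfl, rfl⟩ := h
      have hq' : ∃ y ∈ shape (s ++ t), q y := by
        obtain ⟨b, hb, hqb⟩ := hq
        exact ⟨b, by rw [shape_append]; exact List.mem_append_right _ hb, hqb⟩
      simp only [shape, List.map_cons, List.mem_cons] at ha
      rcases ha with rfl | ha
      · exact Or.inl ⟨hpa, hq'⟩
      · exact Or.inr ⟨hq', s, t, rfl, ⟨a, ha, hpa⟩, hq⟩
  · rintro (⟨hp, hq⟩ | ⟨-, s, t, rfl, ⟨a, ha, hpa⟩, hq⟩)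
    · exact ⟨[y], z, rfl, ⟨_, by simp [shape], hp⟩, hq⟩
    · refine ⟨y :: s, t, rfl, ⟨a, ?_, hpa⟩, hq⟩
      simp only [shape, List.map_cons, List.mem_cons]
      exact Or.inr ha

open Classical in
/-- The valuation that detects the order of occurrences. -/
noncomputable def precTest (p q : X ⊕ Unit → Prop) (y : X ⊕ Unit) : Function.End (Fin 3) :=
  fun i => if q y then (if i = 0 then 1 else i) else if p y then (if i = 1 then 2 else i) else i

/-- The test is an automaton that reads the word from right to left, with states 0 (no `q` so far),
1 (some `q`) and 2 (a `p` to the left of a `q`). Maps of `Fin 3` therefore suffice to see the order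
of occurrences. -/
lemma val_precTest {p q : X ⊕ Unit → Prop} (h : ∀ y, p y → ¬ q y) (z : List (X ⊕ A)) :
    (val (precTest p q) z 0 ≠ 0 ↔ ∃ y ∈ shape z, q y) ∧
      (val (precTest p q) z 0 = 2 ↔ Prec p q z) := by
  classical
  induction z with
  | nil =>
    refine ⟨by simp [shape]; rfl, ?_⟩
    constructor
    · intro h
      exact absurd (show (0 : Fin 3) = 2 from h) (by decide)
    · rintro ⟨s, t, hst, ⟨a, ha, -⟩, -⟩
      have : s = [] := (List.append_eq_nil_iff.1 hst.symm).1
      simp [this, shape] at ha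
  | cons y z ih =>
    have hv : val (precTest p q) (y :: z) 0 =
        precTest p q (y.map id fun _ => ()) (val (precTest p q) z 0) := by
      rcases y with y | y
      · rw [val_inl]; rfl
      · rw [val_inr]; rfl
    have hm : (∃ y' ∈ shape (y :: z), q y') ↔
        q (y.map id fun _ => ()) ∨ ∃ y' ∈ shape z, q y' := by
      simp [shape]
    rw [hv, hm, prec_cons, ← ih.1, ← ih.2]
    have := h (y.map id fun _ => ())
    generalize (y.map id fun _ => () : X ⊕ Unit) = y' at this
    generalize val (precTest p q) z 0 = i
    unfold precTest
    by_cases hq : q y'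
    · have hp : ¬ p y' := fun hp => this hp hq
      simp only [hq, hp, if_true]
      fin_cases i <;> simp
    · by_cases hp : p y'
      · simp only [hq, hp, if_true, if_false]
        fin_cases i <;> simp
      · simp only [hq, hp, if_false]
        fin_cases i <;> simp

/-! ### What the class of a substitution determines -/

lemma mem_varsOf_of_cls {σ τ : Subst X A} (h : cls σ = cls τ) {x y : X}
    (hy : y ∈ varsOf (σ x)) : y ∈ varsOf (τ x) := by
  have h1 := (val_precTest (p := fun _ => False) (q := fun a => a = Sum.inl y)
    (fun _ h => h.elim) (σ x)).1
  have h2 := (val_precTest (p := fun _ => False) (q := fun a => a = Sum.inl y)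
    (fun _ h => h.elim) (τ x)).1
  have h3 := congrFun (congrFun h (precTest (fun _ => False) fun a => a = Sum.inl y)) (Sum.inl x)
  have key : ∀ z : List (X ⊕ A), (∃ a ∈ shape z, a = Sum.inl y) ↔ y ∈ varsOf z := by
    intro z
    rw [mem_varsOf]
    simp [shape]
  simp only [cls, Sum.elim_inl] at h3
  rw [h3, h2, key, key] at h1
  exact h1.2 hy

lemma prec_of_cls {σ τ : Subst X A} (h : cls σ = cls τ) {x : X} {p q : X ⊕ Unit → Prop}
    (hpq : ∀ y, p y → ¬ q y) (hp : Prec p q (σ x)) : Prec p q (τ x) := by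
  have h3 := congrFun (congrFun h (precTest p q)) (Sum.inl x)
  simp only [cls, Sum.elim_inl] at h3
  rw [← (val_precTest hpq _).2, ← h3, (val_precTest hpq _).2]
  exact hp

/-! ## Substitutions with idempotent class -/

/-- The class of a copyless substitution is idempotent. -/
structure Idem (σ : Subst X A) : Prop where
  copyless : σ.Copyless
  idem : cls (comp σ σ) = cls σ

lemma Idem.of_cls {σ τ : Subst X A} (h : Idem σ) (hτ : τ.Copyless) (he : cls τ = cls σ) :
    Idem τ := ⟨hτ, by rw [cls_comp, he, ← cls_comp, h.idem]⟩

lemma Idem.comp_self_mem {σ : Subst X A} (h : Idem σ) {x z : X} (hz : z ∈ varsOf (σ x)) :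
    ∃ y ∈ varsOf (σ x), z ∈ varsOf (σ y) := by
  have := mem_varsOf_of_cls h.idem.symm hz
  rwa [comp, varsOf_hat, List.mem_flatMap] at this

/-- By idempotence `z` already occurs in `σ x`, and copylessness admits only one such image.
Consequently the image of a variable either contains the variable itself, next to variables whose
images are variable-free, or is variable-free (`Idem.self_mem`, `Idem.eq_nil`). -/
lemma Idem.mem_of_mem_of_mem {σ : Subst X A} (h : Idem σ) {x y z : X} (hy : y ∈ varsOf (σ x))
    (hz : z ∈ varsOf (σ y)) : y = x := by
  have : z ∈ varsOf (σ x) := by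
    refine mem_varsOf_of_cls h.idem ?_
    rw [comp, varsOf_hat, List.mem_flatMap]
    exact ⟨y, hy, hz⟩
  exact h.copyless.eq_of_mem hz this

lemma Idem.self_mem {σ : Subst X A} (h : Idem σ) {x z : X} (hz : z ∈ varsOf (σ x)) :
    x ∈ varsOf (σ x) := by
  obtain ⟨y, hy, hzy⟩ := h.comp_self_mem hz
  rwa [h.mem_of_mem_of_mem hy hzy] at hy

lemma Idem.eq_nil {σ : Subst X A} (h : Idem σ) {x : X} (hx : x ∉ varsOf (σ x)) :
    varsOf (σ x) = [] :=
  List.eq_nil_iff_forall_not_mem.2 fun _ hz => hx (h.self_mem hz)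

lemma Idem.not_mem {σ : Subst X A} (h : Idem σ) {x y : X} (hy : y ∈ varsOf (σ x)) (hne : y ≠ x) :
    y ∉ varsOf (σ y) := fun h' => hne (h.mem_of_mem_of_mem hy h')

/-- The parts of the images of the persistent variables to the left and to the right of them. -/
def Splits (σ : Subst X A) (α β : X → List (X ⊕ A)) : Prop :=
  ∀ x, x ∈ varsOf (σ x) → σ x = α x ++ Sum.inl x :: β x

lemma exists_splits (σ : Subst X A) : ∃ α β, Splits σ α β := by
  classical
  have : ∀ x, ∃ p : List (X ⊕ A) × List (X ⊕ A), x ∈ varsOf (σ x) →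
      σ x = p.1 ++ Sum.inl x :: p.2 := by
    intro x
    by_cases hx : x ∈ varsOf (σ x)
    · obtain ⟨a, b, h⟩ := exists_split_of_mem_varsOf hx
      exact ⟨(a, b), fun _ => h⟩
    · exact ⟨([], []), fun h => absurd h hx⟩
  choose p hp using this
  exact ⟨fun x => (p x).1, fun x => (p x).2, fun x hx => hp x hx⟩

lemma split_unique {x : X} {s t s' t' : List (X ⊕ A)}
    (h : s ++ Sum.inl x :: t = s' ++ Sum.inl x :: t') (hn : (varsOf (s ++ Sum.inl x :: t)).Nodup) :
    s = s' ∧ t = t' := by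
  have hn' := h ▸ hn
  simp only [varsOf_append, varsOf_inl, List.nodup_append', List.nodup_cons, List.disjoint_cons_right,
    mem_varsOf] at hn hn'
  rcases List.append_eq_append_iff.1 h with ⟨a, rfl, h2⟩ | ⟨a, rfl, h2⟩
  · rcases a with _ | ⟨y, a⟩
    · simpa using h2
    · simp only [List.cons_append, List.cons.injEq] at h2
      exact absurd (by simp [← h2.1]) hn'.2.2.1
  · rcases a with _ | ⟨y, a⟩
    · simpa using h2.symm
    · simp only [List.cons_append, List.cons.injEq] at h2
      exact absurd (by simp [← h2.1]) hn.2.2.1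

lemma Idem.left_not_mem {σ : Subst X A} (h : Idem σ) {x y : X} {s t : List (X ⊕ A)}
    (hs : σ x = s ++ Sum.inl x :: t) (hy : y ∈ varsOf s) : y ∉ varsOf (σ y) := by
  have hn := h.copyless.1 x
  have hm : y ∈ varsOf (σ x) := by rw [hs]; simp [hy]
  refine h.not_mem hm ?_
  rintro rfl
  rw [hs] at hn
  simp only [varsOf_append, varsOf_inl, List.nodup_append', List.disjoint_cons_right] at hn
  exact hn.2.2.1 hy

lemma Idem.right_not_mem {σ : Subst X A} (h : Idem σ) {x y : X} {s t : List (X ⊕ A)}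
    (hs : σ x = s ++ Sum.inl x :: t) (hy : y ∈ varsOf t) : y ∉ varsOf (σ y) := by
  have hn := h.copyless.1 x
  have hm : y ∈ varsOf (σ x) := by rw [hs]; simp [hy]
  refine h.not_mem hm ?_
  rintro rfl
  rw [hs] at hn
  simp only [varsOf_append, varsOf_inl, List.nodup_append', List.nodup_cons] at hn
  exact hn.2.1.1 hy

/-- A letter occurs to the left of the variable. -/
def LetterLeft (x : X) (z : List (X ⊕ A)) : Prop :=
  ∃ s t, z = s ++ Sum.inl x :: t ∧ eraseVars s ≠ []

/-- A letter occurs to the right of the variable. -/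
def LetterRight (x : X) (z : List (X ⊕ A)) : Prop :=
  ∃ s t, z = s ++ Sum.inl x :: t ∧ eraseVars t ≠ []

lemma exists_inr_mem_shape {z : List (X ⊕ A)} :
    (∃ y ∈ shape z, y = Sum.inr ()) ↔ eraseVars z ≠ [] := by
  rw [ne_eq, List.eq_nil_iff_forall_not_mem]
  simp [shape, mem_eraseVars]

lemma exists_inl_mem_shape {x : X} {z : List (X ⊕ A)} :
    (∃ y ∈ shape z, y = Sum.inl x) ↔ Sum.inl x ∈ z := by
  simp [shape]

lemma letterLeft_iff {x : X} {z : List (X ⊕ A)} :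
    LetterLeft x z ↔ Prec (fun y => y = Sum.inr ()) (fun y => y = Sum.inl x) z := by
  simp only [Prec, exists_inr_mem_shape, exists_inl_mem_shape]
  constructor
  · rintro ⟨s, t, rfl, h⟩
    exact ⟨s, _, rfl, h, by simp⟩
  · rintro ⟨s, t, rfl, h, hx⟩
    obtain ⟨t₁, t₂, rfl⟩ := List.append_of_mem hx
    exact ⟨s ++ t₁, t₂, by simp, by simp [h]⟩

lemma letterRight_iff {x : X} {z : List (X ⊕ A)} :
    LetterRight x z ↔ Prec (fun y => y = Sum.inl x) (fun y => y = Sum.inr ()) z := by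
  simp only [Prec, exists_inr_mem_shape, exists_inl_mem_shape]
  constructor
  · rintro ⟨s, t, rfl, h⟩
    exact ⟨s ++ [Sum.inl x], t, by simp, by simp, h⟩
  · rintro ⟨s, t, rfl, hx, h⟩
    obtain ⟨t₁, t₂, rfl⟩ := List.append_of_mem hx
    exact ⟨t₁, t₂ ++ t, by simp, by simp [h]⟩

lemma LetterLeft.of_cls {σ τ : Subst X A} (h : cls σ = cls τ) {x : X} (hl : LetterLeft x (σ x)) :
    LetterLeft x (τ x) := by
  rw [letterLeft_iff] at hl ⊢
  exact prec_of_cls h (by rintro y rfl; simp) hl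

lemma LetterRight.of_cls {σ τ : Subst X A} (h : cls σ = cls τ) {x : X}
    (hl : LetterRight x (σ x)) : LetterRight x (τ x) := by
  rw [letterRight_iff] at hl ⊢
  exact prec_of_cls h (by rintro y rfl; simp) hl

/-- A second application of `σ` turns the variables of `s` into letters, so by idempotence a letter
is there after one application. Hence a block that grows under iteration receives a letter from
every single loop of the class. -/
lemma Idem.letterLeft {σ : Subst X A} (h : Idem σ) {x : X} {s t : List (X ⊕ A)}
    (hs : σ x = s ++ Sum.inl x :: t) {ρ : X → List A}
    (hρ : ∀ y, y ∉ varsOf (σ y) → eraseVars (σ y) = ρ y) (hne : eval ρ s ≠ []) :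
    LetterLeft x (σ x) := by
  refine LetterLeft.of_cls h.idem ⟨hat σ s ++ s, t ++ hat σ t, ?_, ?_⟩
  · rw [comp, hs]
    simp [hs]
  · rw [eraseVars_append, eraseVars_hat, eval_congr (ρ' := ρ)]
    · simp [hne]
    · exact fun y hy => hρ y (h.left_not_mem hs hy)

lemma Idem.letterRight {σ : Subst X A} (h : Idem σ) {x : X} {s t : List (X ⊕ A)}
    (hs : σ x = s ++ Sum.inl x :: t) {ρ : X → List A}
    (hρ : ∀ y, y ∉ varsOf (σ y) → eraseVars (σ y) = ρ y) (hne : eval ρ t ≠ []) :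
    LetterRight x (σ x) := by
  refine LetterRight.of_cls h.idem ⟨hat σ s ++ s, t ++ hat σ t, ?_, ?_⟩
  · rw [comp, hs]
    simp [hs]
  · rw [eraseVars_append, eraseVars_hat, eval_congr (ρ' := ρ)]
    · simp [hne]
    · exact fun y hy => hρ y (h.right_not_mem hs hy)

lemma Idem.letterLeft_split {σ : Subst X A} (h : Idem σ) {x : X} (hl : LetterLeft x (σ x))
    {s t : List (X ⊕ A)} (hs : σ x = s ++ Sum.inl x :: t) : eraseVars s ≠ [] := by
  obtain ⟨s', t', h1, h2⟩ := hl
  rw [(split_unique (hs.symm.trans h1) (hs ▸ h.copyless.1 x)).1]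
  exact h2

lemma Idem.letterRight_split {σ : Subst X A} (h : Idem σ) {x : X} (hl : LetterRight x (σ x))
    {s t : List (X ⊕ A)} (hs : σ x = s ++ Sum.inl x :: t) : eraseVars t ≠ [] := by
  obtain ⟨s', t', h1, h2⟩ := hl
  rw [(split_unique (hs.symm.trans h1) (hs ▸ h.copyless.1 x)).2]
  exact h2

end Classes

end Subst

/-! ## Iteration of a substitution with idempotent class -/

namespace Subst

section Patterns

variable {X A : Type*}

/-- The contents of the variables after `n` applications of a substitution. -/
def iterVal (C : Subst X A) (ρ : X → List A) : ℕ → X → List A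
  | 0 => ρ
  | n + 1 => fun x => eval (iterVal C ρ n) (C x)

lemma iterVal_succ (C : Subst X A) (ρ : X → List A) (n : ℕ) (x : X) :
    iterVal C ρ (n + 1) x = eval (iterVal C ρ n) (C x) := rfl

/-- The iteration of `C` from the contents `ρ` has no transient behaviour. -/
structure Pumpable (C : Subst X A) (ρ : X → List A) (α β : X → List (X ⊕ A)) : Prop where
  idem : Idem C
  splits : Splits C α β
  reset : ∀ y, y ∉ varsOf (C y) → eraseVars (C y) = ρ y

open Classical in
/-- The pattern of the values of a word under the iteration of a substitution. -/
noncomputable def pat (C : Subst X A) (ρ : X → List A) (α β : X → List (X ⊕ A))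
    (z : List (X ⊕ A)) : List (List A × List A) :=
  z.flatMap (Sum.elim
    (fun x => if x ∈ varsOf (C x) then [([], eval ρ (α x)), (ρ x, eval ρ (β x))] else [(ρ x, [])])
    fun a => [([a], [])])

variable {C : Subst X A} {ρ : X → List A} {α β : X → List (X ⊕ A)}

@[simp] lemma pat_nil : pat C ρ α β [] = [] := rfl

@[simp] lemma pat_append (y z : List (X ⊕ A)) :
    pat C ρ α β (y ++ z) = pat C ρ α β y ++ pat C ρ α β z := by simp [pat]

@[simp] lemma pat_inr (a : A) (z : List (X ⊕ A)) :
    pat C ρ α β (Sum.inr a :: z) = ([a], []) :: pat C ρ α β z := by simp [pat]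

lemma pat_inl_of_mem {x : X} (h : x ∈ varsOf (C x)) (z : List (X ⊕ A)) :
    pat C ρ α β (Sum.inl x :: z) =
      ([], eval ρ (α x)) :: (ρ x, eval ρ (β x)) :: pat C ρ α β z := by simp [pat, h]

lemma pat_inl_of_not_mem {x : X} (h : x ∉ varsOf (C x)) (z : List (X ⊕ A)) :
    pat C ρ α β (Sum.inl x :: z) = (ρ x, []) :: pat C ρ α β z := by simp [pat, h]

lemma Pumpable.iterVal_of_not_mem (h : Pumpable C ρ α β) {x : X} (hx : x ∉ varsOf (C x)) (n : ℕ) :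
    iterVal C ρ n x = ρ x := by
  rcases n with _ | n
  · rfl
  · rw [iterVal_succ, eval_of_varsOf_eq_nil (h.idem.eq_nil hx), h.reset x hx]

/-- The variables beside `x` in its image always have their reset values, so each iteration adds the
same two words around the content of `x`. -/
lemma Pumpable.iterVal_of_mem (h : Pumpable C ρ α β) {x : X} (hx : x ∈ varsOf (C x)) (n : ℕ) :
    iterVal C ρ n x = wordPow (eval ρ (α x)) n ++ (ρ x ++ wordPow (eval ρ (β x)) n) := by
  induction n with
  | zero => simp [iterVal]
  | succ n ih =>
    have hs := h.splits x hx
    rw [iterVal_succ, hs, eval_append, eval_inl, ih,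
      eval_congr (ρ' := ρ) (fun y hy => h.iterVal_of_not_mem (h.idem.left_not_mem hs hy) n),
      eval_congr (ρ' := ρ) (fun y hy => h.iterVal_of_not_mem (h.idem.right_not_mem hs hy) n),
      wordPow_succ, wordPow_succ']
    simp

lemma Pumpable.eval_iterVal (h : Pumpable C ρ α β) (n : ℕ) (z : List (X ⊕ A)) :
    eval (iterVal C ρ n) z = patEval n (pat C ρ α β z) := by
  induction z with
  | nil => rfl
  | cons y z ih =>
    rcases y with x | a
    · by_cases hx : x ∈ varsOf (C x)
      · rw [pat_inl_of_mem hx, eval_inl, h.iterVal_of_mem hx, ih]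
        simp
      · rw [pat_inl_of_not_mem hx, eval_inl, h.iterVal_of_not_mem hx, ih]
        simp
    · simp [ih]

lemma Pumpable.patEval_zero (h : Pumpable C ρ α β) (z : List (X ⊕ A)) :
    patEval 0 (pat C ρ α β z) = eval ρ z := (h.eval_iterVal 0 z).symm

lemma farFromEnd_cons {f : ℕ} {a b : List A} {P : List (List A × List A)} (hP : FarFromEnd f P)
    (h : b ≠ [] → f ≤ (patEval 0 P).length) : FarFromEnd f ((a, b) :: P) := by
  intro pre a' b' post he hb
  rcases pre with _ | ⟨p, pre⟩
  · simp only [List.nil_append, List.cons.injEq, Prod.mk.injEq] at he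
    obtain ⟨⟨rfl, rfl⟩, rfl⟩ := he
    exact h hb
  · simp only [List.cons_append, List.cons.injEq] at he
    exact hP pre a' b' post he.2 hb

lemma farFromStart_concat {f : ℕ} {a b : List A} {P : List (List A × List A)}
    (hP : FarFromStart f P) (h : b ≠ [] → f ≤ (patEval 0 P).length + a.length) :
    FarFromStart f (P ++ [(a, b)]) := by
  intro pre a' b' post he hb
  rcases List.eq_nil_or_concat' post with rfl | ⟨post, p, rfl⟩
  · obtain ⟨rfl, h2⟩ := List.append_inj' he rfl
    simp only [List.cons.injEq, Prod.mk.injEq, and_true] at h2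
    obtain ⟨rfl, rfl⟩ := h2
    exact h hb
  · rw [← List.cons_append, ← List.append_assoc] at he
    obtain ⟨rfl, -⟩ := List.append_inj' he rfl
    exact hP pre a' b' post rfl hb

/-- A persistent variable yields two blocks, one on each side of its content. The left one is kept
away from the end by the content, the right one by the letters that follow in the word. -/
lemma Pumpable.farFromEnd (h : Pumpable C ρ α β) {f : ℕ} {Q : List (List A × List A)}
    (hQ : FarFromEnd f Q) (l : List (X ⊕ A))
    (hl : ∀ x ∈ varsOf l, x ∈ varsOf (C x) → eval ρ (α x) ≠ [] → f ≤ (ρ x).length)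
    (hr : ∀ a x b, l = a ++ Sum.inl x :: b → x ∈ varsOf (C x) → eval ρ (β x) ≠ [] →
      f ≤ (eraseVars b).length) : FarFromEnd f (pat C ρ α β l ++ Q) := by
  induction l with
  | nil => exact hQ
  | cons y l ih =>
    have hrec := ih
      (fun x hx => hl x (by rcases y with y | a <;> simp [hx]))
      (fun a x b hab => hr (y :: a) x b (by rw [hab]; rfl))
    rcases y with x | a
    · by_cases hx : x ∈ varsOf (C x)
      · rw [pat_inl_of_mem hx, List.cons_append, List.cons_append]
        refine farFromEnd_cons (farFromEnd_cons hrec fun hb => ?_) fun hb => ?_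
        · have := hr [] x l rfl hx hb
          rw [patEval_append, h.patEval_zero, List.length_append, length_eval]
          omega
        · have := hl x (by simp) hx hb
          rw [patEval_cons, List.length_append]
          exact this.trans (Nat.le_add_right _ _)
      · rw [pat_inl_of_not_mem hx]
        exact farFromEnd_cons hrec fun hb => absurd rfl hb
    · rw [pat_inr]
      exact farFromEnd_cons hrec fun hb => absurd rfl hb

lemma Pumpable.farFromStart (h : Pumpable C ρ α β) {f : ℕ} {Q : List (List A × List A)}
    (hQ : FarFromStart f Q) (r : List (X ⊕ A))
    (hr : ∀ x ∈ varsOf r, x ∈ varsOf (C x) → eval ρ (β x) ≠ [] → f ≤ (ρ x).length)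
    (hl : ∀ a x b, r = a ++ Sum.inl x :: b → x ∈ varsOf (C x) → eval ρ (α x) ≠ [] →
      f ≤ (eraseVars a).length) : FarFromStart f (Q ++ pat C ρ α β r) := by
  induction r using List.reverseRecOn with
  | nil => simpa using hQ
  | append_singleton r y ih =>
    have hrec := ih
      (fun x hx => hr x (by simp [hx]))
      (fun a x b hab => hl a x (b ++ [y]) (by rw [hab]; simp))
    rcases y with x | a
    · by_cases hx : x ∈ varsOf (C x)
      · have e : Q ++ pat C ρ α β (r ++ [Sum.inl x]) = Q ++ pat C ρ α β r ++
            [([], eval ρ (α x))] ++ [(ρ x, eval ρ (β x))] := by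
          rw [pat_append, pat_inl_of_mem hx]; simp
        rw [e]
        refine farFromStart_concat (farFromStart_concat hrec fun hb => ?_) fun hb => ?_
        · have := hl r x [] rfl hx hb
          rw [patEval_append, h.patEval_zero, List.length_append, length_eval]
          omega
        · have := hr x (by simp) hx hb
          omega
      · rw [pat_append, pat_inl_of_not_mem hx, pat_nil, ← List.append_assoc]
        exact farFromStart_concat hrec fun hb => absurd rfl hb
    · rw [pat_append, pat_inr, pat_nil, ← List.append_assoc]
      exact farFromStart_concat hrec fun hb => absurd rfl hb

/-- The pattern of the part of a frame left of the cut. -/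
noncomputable def leftPat (C : Subst X A) (ρ : X → List A) (α β : X → List (X ⊕ A))
    (F : Frame X A) : List (List A × List A) :=
  pat C ρ α β F.l ++ F.c.elim [] fun x => [([], eval ρ (α x)), (F.u, [])]

/-- The pattern of the part of a frame right of the cut. -/
noncomputable def rightPat (C : Subst X A) (ρ : X → List A) (α β : X → List (X ⊕ A))
    (F : Frame X A) : List (List A × List A) :=
  (F.c.elim [] fun x => [(F.v, eval ρ (β x))]) ++ pat C ρ α β F.r

lemma Pumpable.eval_frame (h : Pumpable C ρ α β) {F : Frame X A} {w : List (X ⊕ A)} {j : ℕ}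
    (hF : F.Valid ρ w j) (hc : ∀ x ∈ F.c, x ∈ varsOf (C x)) (n : ℕ) :
    eval (iterVal C ρ n) w =
      patEval n (leftPat C ρ α β F) ++ patEval n (rightPat C ρ α β F) := by
  obtain ⟨l, c, r, u, v⟩ := F
  have hv := hF.value
  rw [hF.word, leftPat, rightPat]
  rcases c with _ | x
  · simp [h.eval_iterVal]
  · simp only [optWord_some, eval_inl, eval_nil, List.append_nil] at hv
    have := h.iterVal_of_mem (hc x rfl) n
    simp only [optWord_some, List.singleton_append, eval_append, eval_inl, this]
    simp [hv, h.eval_iterVal]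

lemma Pumpable.length_leftPat (h : Pumpable C ρ α β) {F : Frame X A} {w : List (X ⊕ A)} {j : ℕ}
    (hF : F.Valid ρ w j) : (patEval 0 (leftPat C ρ α β F)).length = j := by
  obtain ⟨l, c, r, u, v⟩ := F
  have hv := hF.value
  have hp := hF.pos
  rcases c with _ | x
  · simp only [optWord_none, eval_nil] at hv
    have hu : u = [] := (List.append_eq_nil_iff.1 hv.symm).1
    simp only [leftPat, Option.elim_none, List.append_nil, h.patEval_zero]
    simpa [hu] using hp
  · simp only [leftPat, Option.elim_some, patEval_append, h.patEval_zero]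
    simpa using hp

lemma length_eval_of_mem_iff {ρ : X → List A} {y z : List (X ⊕ A)} (hy : (varsOf y).Nodup)
    (hz : (varsOf z).Nodup) (h : ∀ x, x ∈ varsOf y ↔ x ∈ varsOf z) :
    (eval ρ y).length + (eraseVars z).length = (eval ρ z).length + (eraseVars y).length := by
  have : (varsOf y).Perm (varsOf z) := (List.perm_ext_iff_of_nodup hy hz).2 h
  rw [length_eval, length_eval, (this.map _).sum_eq]
  omega

/-- The slope is the gain in length from `n = 0` to `n = 1`, that is, from `F.l` to `G.l` under `ρ`.
Both contain the same variables, once each, so only the letters contribute to the difference. -/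
lemma Pumpable.patSlope_leftPat (h : Pumpable C ρ α β) {F G : Frame X A} (hG : G.Step C F)
    (hc : G.c = F.c) (hn : (varsOf F.l).Nodup) (hn' : (varsOf G.l).Nodup)
    (hl : ∀ x, x ∈ varsOf G.l ↔ x ∈ varsOf F.l) :
    patSlope (leftPat C ρ α β F) + (eraseVars F.l).length = (eraseVars G.l).length := by
  obtain ⟨s, t, h1, h2, -⟩ := hG
  have e1 : patEval 1 (leftPat C ρ α β F) =
      eval ρ G.l ++ F.c.elim [] fun _ => F.u := by
    have e2 : patEval 1 (pat C ρ α β F.l) = eval ρ (hat C F.l) := by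
      rw [← h.eval_iterVal, eval_hat]; rfl
    rw [leftPat, patEval_append, e2, h2, eval_append]
    rcases hFc : F.c with _ | x
    · rw [hc, hFc] at h1
      simp only [optWord_none, hat_nil, List.nil_append] at h1
      have : s = [] := (List.append_eq_nil_iff.1 h1.symm).1
      simp [this]
    · rw [hc, hFc] at h1
      simp only [optWord_some, hat_inl, hat_nil, List.append_nil, List.cons_append,
        List.nil_append] at h1
      have hx : x ∈ varsOf (C x) := by rw [h1]; simp
      obtain ⟨rfl, -⟩ := split_unique (h1.symm.trans (h.splits x hx)) (h1 ▸ h.idem.copyless.1 x)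
      simp
  have e0 : patEval 0 (leftPat C ρ α β F) =
      eval ρ F.l ++ F.c.elim [] fun _ => F.u := by
    rw [leftPat, patEval_append, h.patEval_zero]
    rcases F.c with _ | x <;> simp
  have e3 := length_patEval 1 (leftPat C ρ α β F)
  rw [e1, e0] at e3
  have e4 := length_eval_of_mem_iff (ρ := ρ) hn' hn hl
  simp only [List.length_append] at e3
  omega

end Patterns

end Subst

/-! ## Consecutive loops of the same idempotent class -/

namespace Subst

section Chains

variable {X A : Type*}

/-- Consecutive substitutions of the same idempotent class, with the contents of the variables and
the frames of a cut between them. -/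
structure Chain (K j : ℕ) (σ : ℕ → Subst X A) (ρ : ℕ → X → List A) (w : ℕ → List (X ⊕ A))
    (F : ℕ → Frame X A) : Prop where
  idem : ∀ i < K, Idem (σ i)
  cls_eq : ∀ i < K, ∀ i' < K, cls (σ i) = cls (σ i')
  content : ∀ i < K, ∀ x, ρ (i + 1) x = eval (ρ i) (σ i x)
  step : ∀ i < K, (F i).Step (σ i) (F (i + 1))
  valid : ∀ i ≤ K, (F i).Valid (ρ i) (w i) j
  nodup : ∀ i ≤ K, (varsOf (w i)).Nodup
  center : ∀ i ≤ K, (F i).c = (F 0).c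
  left : ∀ i ≤ K, ∀ x, x ∈ varsOf (F i).l ↔ x ∈ varsOf (F 0).l
  right : ∀ i ≤ K, ∀ x, x ∈ varsOf (F i).r ↔ x ∈ varsOf (F 0).r

variable {K j : ℕ} {σ : ℕ → Subst X A} {ρ : ℕ → X → List A} {w : ℕ → List (X ⊕ A)}
  {F : ℕ → Frame X A}

/-! ### Letters that accumulate around the cut along a chain -/

lemma Chain.nodup_left (h : Chain K j σ ρ w F) {i : ℕ} (hi : i ≤ K) : (varsOf (F i).l).Nodup := by
  have := h.nodup i hi
  rw [(h.valid i hi).word, varsOf_append] at this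
  exact this.of_append_left

lemma Chain.nodup_right (h : Chain K j σ ρ w F) {i : ℕ} (hi : i ≤ K) :
    (varsOf (F i).r).Nodup := by
  have := h.nodup i hi
  rw [(h.valid i hi).word, varsOf_append, varsOf_append] at this
  exact this.of_append_right.of_append_right

lemma length_pos_of_eraseVars_ne_nil {ρ : X → List A} {z : List (X ⊕ A)}
    (h : eraseVars z ≠ []) : 0 < (eval ρ z).length := by
  rw [length_eval]
  have := List.length_pos_iff.2 h
  omega

lemma Chain.le_length_content (h : Chain K j σ ρ w F) {x : X}
    (hx : (∀ i < K, LetterLeft x (σ i x)) ∨ ∀ i < K, LetterRight x (σ i x)) {i : ℕ}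
    (hi : i ≤ K) : i ≤ (ρ i x).length := by
  induction i with
  | zero => exact Nat.zero_le _
  | succ i ih =>
    have := ih (by omega)
    rw [h.content i hi]
    rcases hx with hx | hx <;> obtain ⟨s, t, hs, ht⟩ := hx i hi
    · have := length_pos_of_eraseVars_ne_nil (ρ := ρ i) ht
      simp only [hs, eval_append, eval_inl, List.length_append]
      omega
    · have := length_pos_of_eraseVars_ne_nil (ρ := ρ i) ht
      simp only [hs, eval_append, eval_inl, List.length_append]
      omega

lemma Chain.length_u_v (h : Chain K j σ ρ w F) {i : ℕ} (hi : i < K) {x : X} (hx : (F 0).c = some x) :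
    ∃ s t, σ i x = s ++ Sum.inl x :: t ∧
      (F (i + 1)).u.length = (eval (ρ i) s).length + (F i).u.length ∧
      (F (i + 1)).v.length = (eval (ρ i) t).length + (F i).v.length := by
  obtain ⟨s, t, h1, h2, -⟩ := h.step i hi
  have h3 := (h.valid i (by omega)).pos
  have h4 := (h.valid (i + 1) hi).pos
  have h5 := (h.valid i (by omega)).value
  have h6 := (h.valid (i + 1) hi).value
  have h7 : eval (ρ (i + 1)) (F (i + 1)).l = eval (ρ i) (hat (σ i) (F (i + 1)).l) := by
    rw [eval_hat, funext (h.content i hi)]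
  rw [h.center _ hi, h.center i (by omega), hx] at h1
  simp only [optWord_some, hat_inl, hat_nil, List.append_nil, List.singleton_append] at h1
  rw [h.center i (by omega), hx] at h5
  rw [h.center _ hi, hx] at h6
  simp only [optWord_some, eval_inl, eval_nil, List.append_nil] at h5 h6
  rw [h.content i hi, h1, eval_append, eval_inl, h5] at h6
  rw [h2, eval_append] at h3
  rw [h7] at h4
  have h8 := congrArg List.length h6
  simp only [List.length_append] at h3 h8
  exact ⟨s, t, h1, by omega, by omega⟩

lemma Chain.le_length_u (h : Chain K j σ ρ w F) {x : X} (hc : (F 0).c = some x)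
    (hx : ∀ i < K, LetterLeft x (σ i x)) {i : ℕ} (hi : i ≤ K) : i ≤ (F i).u.length := by
  induction i with
  | zero => exact Nat.zero_le _
  | succ i ih =>
    have := ih (by omega)
    obtain ⟨s, t, h1, h2, -⟩ := h.length_u_v hi hc
    have := length_pos_of_eraseVars_ne_nil (ρ := ρ i) ((h.idem i hi).letterLeft_split (hx i hi) h1)
    omega

lemma Chain.le_length_v (h : Chain K j σ ρ w F) {x : X} (hc : (F 0).c = some x)
    (hx : ∀ i < K, LetterRight x (σ i x)) {i : ℕ} (hi : i ≤ K) : i ≤ (F i).v.length := by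
  induction i with
  | zero => exact Nat.zero_le _
  | succ i ih =>
    have := ih (by omega)
    obtain ⟨s, t, h1, -, h2⟩ := h.length_u_v hi hc
    have := length_pos_of_eraseVars_ne_nil (ρ := ρ i) ((h.idem i hi).letterRight_split (hx i hi) h1)
    omega

/-- Going back by one loop replaces `x` by its image, which puts another letter to the right of `x`.
This counts the future loops, `Chain.le_length_content` the past ones; in the middle of `2 * f`
loops both give `f` letters. -/
lemma Chain.le_length_after (h : Chain K j σ ρ w F) {x : X} (hx : ∀ i < K, LetterRight x (σ i x))
    (i : ℕ) (hi : i ≤ K) (a b : List (X ⊕ A)) (hab : (F (K - i)).l = a ++ Sum.inl x :: b) :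
    i ≤ (eraseVars b).length := by
  induction i generalizing a b with
  | zero => exact Nat.zero_le _
  | succ i ih =>
    have hK : K - i = K - (i + 1) + 1 := by omega
    obtain ⟨α, β, -, h2, -⟩ := h.step (K - (i + 1)) (by omega)
    rw [← hK] at h2
    have hmem : x ∈ varsOf (F (K - i)).l := by
      rw [h.left _ (by omega), ← h.left (K - (i + 1)) (by omega), hab]
      simp
    obtain ⟨a', b', hab'⟩ := exists_split_of_mem_varsOf hmem
    have h3 := ih (by omega) a' b' hab'
    obtain ⟨s, t, hs, ht⟩ := hx (K - (i + 1)) (by omega)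
    have h4 : (F (K - (i + 1))).l = (hat (σ (K - (i + 1))) a' ++ s) ++
        Sum.inl x :: (t ++ hat (σ (K - (i + 1))) b' ++ α) := by
      rw [h2, hab']
      simp [hs]
    obtain ⟨-, rfl⟩ := split_unique (hab.symm.trans h4) (hab ▸ h.nodup_left (by omega))
    have h5 := List.length_pos_iff.2 ht
    simp only [eraseVars_append, List.length_append, length_eraseVars_hat]
    omega

lemma Chain.le_length_before (h : Chain K j σ ρ w F) {x : X} (hx : ∀ i < K, LetterLeft x (σ i x))
    (i : ℕ) (hi : i ≤ K) (a b : List (X ⊕ A)) (hab : (F (K - i)).r = a ++ Sum.inl x :: b) :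
    i ≤ (eraseVars a).length := by
  induction i generalizing a b with
  | zero => exact Nat.zero_le _
  | succ i ih =>
    have hK : K - i = K - (i + 1) + 1 := by omega
    obtain ⟨α, β, -, -, h2⟩ := h.step (K - (i + 1)) (by omega)
    rw [← hK] at h2
    have hmem : x ∈ varsOf (F (K - i)).r := by
      rw [h.right _ (by omega), ← h.right (K - (i + 1)) (by omega), hab]
      simp
    obtain ⟨a', b', hab'⟩ := exists_split_of_mem_varsOf hmem
    have h3 := ih (by omega) a' b' hab'
    obtain ⟨s, t, hs, ht⟩ := hx (K - (i + 1)) (by omega)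
    have h4 : (F (K - (i + 1))).r = (β ++ hat (σ (K - (i + 1))) a' ++ s) ++
        Sum.inl x :: (t ++ hat (σ (K - (i + 1))) b') := by
      rw [h2, hab']
      simp [hs]
    obtain ⟨rfl, -⟩ := split_unique (hab.symm.trans h4) (hab ▸ h.nodup_right (by omega))
    have h5 := List.length_pos_iff.2 ht
    simp only [eraseVars_append, List.length_append, length_eraseVars_hat]
    omega

/-- Iterating a substitution in the middle of a chain. -/
theorem Chain.exists_pattern {f : ℕ} (hf : 0 < f) (h : Chain (2 * f) j σ ρ w F) {C : Subst X A}
    (hC : C.Copyless) (hcls : cls C = cls (σ 0))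
    (hreset : ∀ y, y ∉ varsOf (C y) → eraseVars (C y) = ρ f y) {G : Frame X A}
    (hG : G.Step C (F f)) (hGc : G.c = (F 0).c) (hGn : (varsOf G.l).Nodup)
    (hGl : ∀ x, x ∈ varsOf G.l ↔ x ∈ varsOf (F 0).l) :
    ∃ P S, (∀ n, eval (iterVal C (ρ f) n) (w f) = patEval n P ++ patEval n S) ∧
      (patEval 0 P).length = j ∧ FarFromEnd f P ∧ FarFromStart f S ∧
      patSlope P + (eraseVars (F f).l).length = (eraseVars G.l).length := by
  have hidem : Idem C := (h.idem 0 (by omega)).of_cls hC hcls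
  obtain ⟨α, β, hs⟩ := exists_splits C
  have hp : Pumpable C (ρ f) α β := ⟨hidem, hs, hreset⟩
  have hcf := h.center f (by omega)
  have hvalid := h.valid f (by omega)
  have hcm : ∀ x ∈ (F f).c, x ∈ varsOf (C x) := by
    intro x hx
    obtain ⟨s, t, h1, -⟩ := hG
    rw [hGc, ← hcf, Option.mem_def.1 hx] at h1
    simp only [optWord_some, hat_inl, hat_nil, List.append_nil, List.singleton_append] at h1
    simp [h1]
  have hcls' : ∀ i < 2 * f, cls C = cls (σ i) := fun i hi =>
    hcls.trans (h.cls_eq 0 (by omega) i hi)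
  -- A non-empty block comes with a letter in the image under `C`, and equality of the classes
  -- transfers this letter to every loop of the chain.
  have hL : ∀ x, x ∈ varsOf (C x) → eval (ρ f) (α x) ≠ [] →
      ∀ i < 2 * f, LetterLeft x (σ i x) := fun x hx hne i hi =>
    (hidem.letterLeft (hs x hx) hreset hne).of_cls (hcls' i hi)
  have hR : ∀ x, x ∈ varsOf (C x) → eval (ρ f) (β x) ≠ [] →
      ∀ i < 2 * f, LetterRight x (σ i x) := fun x hx hne i hi =>
    (hidem.letterRight (hs x hx) hreset hne).of_cls (hcls' i hi)
  refine ⟨leftPat C (ρ f) α β (F f), rightPat C (ρ f) α β (F f), hp.eval_frame hvalid hcm,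
    hp.length_leftPat hvalid, hp.farFromEnd ?_ _ ?_ ?_, hp.farFromStart ?_ _ ?_ ?_,
    hp.patSlope_leftPat hG (hGc.trans hcf.symm) (h.nodup_left (by omega)) hGn
      fun x => (hGl x).trans (h.left f (by omega) x).symm⟩
  · rcases hFc : (F f).c with _ | x
    · intro pre a b post he
      simp at he
    · refine farFromEnd_cons (farFromEnd_cons (fun pre a b post he => by simp at he) ?_) ?_
      · exact fun hb => absurd rfl hb
      · intro hb
        have := h.le_length_u (hcf.symm.trans hFc) (hL x (hcm x hFc) hb) (i := f) (by omega)
        simpa using this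
  · intro x _ hx hne
    exact h.le_length_content (Or.inl (hL x hx hne)) (by omega)
  · intro a x b hab hx hne
    refine h.le_length_after (hR x hx hne) f (by omega) a b ?_
    rwa [show 2 * f - f = f by omega]
  · rcases hFc : (F f).c with _ | x
    · intro pre a b post he
      simp at he
    · refine farFromStart_concat (P := []) (fun pre a b post he => by simp at he) ?_
      intro hb
      have := h.le_length_v (hcf.symm.trans hFc) (hR x (hcm x hFc) hb) (i := f) (by omega)
      simpa using this
  · intro x _ hx hne
    exact h.le_length_content (Or.inr (hR x hx hne)) (by omega)
  · intro a x b hab hx hne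
    refine h.le_length_before (hL x hx hne) f (by omega) a b ?_
    rwa [show 2 * f - f = f by omega]

/-- A substitution with the same effect on the variables has a step to every frame of the same
type, with the same effect on the number of letters. -/
lemma Frame.Step.transfer {B : Subst X A} (hB : B.Copyless) {F₀ G₀ G : Frame X A}
    (h : F₀.Step B G₀) (hc₀ : F₀.c = G₀.c) (hc : G.c = G₀.c)
    (hl₀ : ∀ x, x ∈ varsOf F₀.l ↔ x ∈ varsOf G₀.l) (hl : ∀ x, x ∈ varsOf G.l ↔ x ∈ varsOf G₀.l)
    (hn₀ : (varsOf (G₀.l ++ optWord G₀.c)).Nodup) (hn : (varsOf (G.l ++ optWord G.c)).Nodup) :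
    ∃ F : Frame X A, F.Step B G ∧ F.c = G.c ∧ (∀ x, x ∈ varsOf F.l ↔ x ∈ varsOf G.l) ∧
      (varsOf F.l).Nodup ∧
      (eraseVars F.l).length + (eraseVars G₀.l).length =
        (eraseVars G.l).length + (eraseVars F₀.l).length := by
  obtain ⟨s, t, h1, h2, h3⟩ := h
  have hn₀' : (varsOf G₀.l).Nodup := by rw [varsOf_append] at hn₀; exact hn₀.of_append_left
  have hn' : (varsOf G.l).Nodup := by rw [varsOf_append] at hn; exact hn.of_append_left
  have e1 : hat B (optWord G.c) = s ++ (optWord G.c ++ t) := by rw [hc, h1, hc₀]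
  refine ⟨⟨hat B G.l ++ s, G.c, t ++ hat B G.r, [], []⟩, ⟨s, t, e1, rfl, rfl⟩, rfl, ?_, ?_, ?_⟩
  · intro x
    rw [hl, ← hl₀, h2]
    simp only [varsOf_append, varsOf_hat, List.mem_append, List.mem_flatMap, hl]
  · have := hB.nodup_hat hn
    rw [hat_append, e1, ← List.append_assoc, varsOf_append] at this
    exact this.of_append_left
  · have hp := (((List.perm_ext_iff_of_nodup hn' hn₀').2 hl).map
      fun x => (eraseVars (B x)).length).sum_eq
    rw [h2]
    simp only [eraseVars_append, List.length_append, length_eraseVars_hat, hp]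
    omega

end Chains

end Subst

/-! ## Runs -/

namespace SST

open Subst

variable {A : Type*} {T : SST A}

lemma Run.length_eq {p q : T.State} {z : List A} {s : List (Subst T.Var A)} (h : T.Run p z s q) :
    s.length = z.length := by
  induction h with
  | nil => rfl
  | cons _ _ ih => simp [ih]

lemma Run.append {p q r : T.State} {z z' : List A} {s s' : List (Subst T.Var A)}
    (h : T.Run p z s q) (h' : T.Run q z' s' r) : T.Run p (z ++ z') (s ++ s') r := by
  induction h with
  | nil => exact h'
  | cons hs _ ih => exact Run.cons hs (ih h')

lemma Run.copyless {p q : T.State} {z : List A} {s : List (Subst T.Var A)} (h : T.Run p z s q) :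
    ∀ σ ∈ s, σ.Copyless := by
  induction h with
  | nil => simp
  | cons hs _ ih =>
    simp only [List.mem_cons, forall_eq_or_imp]
    exact ⟨T.upd_copyless _ _ _ hs, ih⟩

lemma Run.replicate {p : T.State} {z : List A} {s : List (Subst T.Var A)} (h : T.Run p z s p)
    (n : ℕ) : T.Run p (List.replicate n z).flatten (List.replicate n s).flatten p := by
  induction n with
  | zero => exact Run.nil p
  | succ n ih =>
    simp only [List.replicate_succ, List.flatten_cons]
    exact h.append ih

lemma Run.exists_path {p q : T.State} {z : List A} {s : List (Subst T.Var A)}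
    (h : T.Run p z s q) : ∃ st : ℕ → T.State, st 0 = p ∧ st z.length = q ∧
      ∀ t < z.length, T.Run (st t) (window z t (t + 1)) (window s t (t + 1)) (st (t + 1)) := by
  induction h with
  | nil q => exact ⟨fun _ => q, rfl, rfl, fun t ht => absurd ht (by simp)⟩
  | @cons p q r a z s hs _ ih =>
    obtain ⟨st, h0, h1, h2⟩ := ih
    refine ⟨fun t => Nat.casesOn t p st, rfl, h1, fun t ht => ?_⟩
    rcases t with _ | t
    · simp only [h0]
      simpa [window] using Run.cons hs (Run.nil q)
    · have := h2 t (by simpa using ht)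
      simpa [window] using this

lemma Run.eq_upd {p q : T.State} {z : List A} {s : List (Subst T.Var A)} (h : T.Run p z s q)
    (hz : z.length = 1) : ∃ a, s = [T.upd p a q] := by
  rcases h with _ | ⟨_, h⟩
  · simp at hz
  · rename_i a z s _
    have : z = [] := by simpa using hz
    subst this
    rcases h
    exact ⟨a, rfl⟩

/-- An accepting run together with the frames of a cut of its output. -/
structure Track (T : SST A) (z : List A) (j : ℕ) where
  /-- the substitutions of the transitions -/
  s : List (Subst T.Var A)
  /-- the states -/
  q : ℕ → T.State
  /-- the frames -/
  F : ℕ → Frame T.Var A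
  length_eq : s.length = z.length
  start : q 0 ∈ T.aut.start
  accept : q z.length ∈ T.aut.accept
  run : ∀ t t', t ≤ t' → t' ≤ z.length → T.Run (q t) (window z t t') (window s t t') (q t')
  valid : ∀ t ≤ z.length, (F t).Valid (content (s.take t))
    (compSeq (s.drop t ++ [T.fin (q z.length)]) T.outVar) j
  step : ∀ t t', t ≤ t' → t' ≤ z.length → (F t).Step (compSeq (window s t t')) (F t')

lemma exists_track {z : List A} {s : List (Subst T.Var A)} (h : (z, s) ∈ T.lang) {j : ℕ}
    (hj : j ≤ (output T.outVar s).length) :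
    ∃ tr : Track T z j, s = tr.s ++ [T.fin (tr.q z.length)] := by
  obtain ⟨p, hp, q, hq, r, hr, rfl⟩ := h
  simp only at hr hj
  obtain ⟨st, h0, h1, h2⟩ := hr.exists_path
  obtain ⟨F, hF, hF'⟩ := exists_frames T.outVar (r ++ [T.fin q]) j hj
  have hl := hr.length_eq
  refine ⟨⟨r, st, F, hl, h0 ▸ hp, h1 ▸ hq, fun t t' h h' => ?_, fun t ht => ?_,
    fun t t' h h' => ?_⟩, by simp [h1]⟩
  · induction t', h using Nat.le_induction with
    | base => simpa using Run.nil (st t)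
    | succ t' ht ih =>
      rw [← window_append_window z ht (Nat.le_succ t'),
        ← window_append_window r ht (Nat.le_succ t')]
      exact (ih (by omega)).append (h2 t' (by omega))
  · have := hF t (by simp; omega)
    rwa [List.take_append_of_le_length (by omega), List.drop_append_of_le_length (by omega),
      ← h1] at this
  · have := hF' t t' h (by simp; omega)
    rwa [window, List.take_append_of_le_length (by omega)] at this

namespace Track

variable {z : List A} {j : ℕ} (tr : Track T z j)

lemma run_take {t : ℕ} (ht : t ≤ z.length) : T.Run (tr.q 0) (z.take t) (tr.s.take t) (tr.q t) := by
  simpa [window] using tr.run 0 t (Nat.zero_le _) ht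

lemma run_drop {t : ℕ} (ht : t ≤ z.length) :
    T.Run (tr.q t) (z.drop t) (tr.s.drop t) (tr.q z.length) := by
  have := tr.run t z.length ht le_rfl
  rwa [window, window, List.take_length, ← tr.length_eq, List.take_length, tr.length_eq] at this

lemma copyless_window {t t' : ℕ} : (compSeq (window tr.s t t')).Copyless := by
  refine copyless_compSeq fun σ hσ => ?_
  have h := tr.run 0 z.length (Nat.zero_le _) le_rfl
  refine h.copyless σ ?_
  rw [window, ← tr.length_eq, List.take_length, List.drop_zero]
  exact mem_of_mem_window hσ

lemma nodup {t : ℕ} (ht : t ≤ z.length) :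
    (varsOf (compSeq (tr.s.drop t ++ [T.fin (tr.q z.length)]) T.outVar)).Nodup := by
  refine (copyless_compSeq fun σ hσ => ?_).1 _
  rcases List.mem_append.1 hσ with hσ | hσ
  · exact (tr.run_drop ht).copyless σ hσ
  · rw [List.mem_singleton.1 hσ]
    exact T.fin_copyless _

lemma nodup_frame {t : ℕ} (ht : t ≤ z.length) :
    (varsOf ((tr.F t).l ++ (optWord (tr.F t).c ++ (tr.F t).r))).Nodup := by
  rw [← (tr.valid t ht).word]
  exact tr.nodup ht

lemma nodup_left {t : ℕ} (ht : t ≤ z.length) :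
    (varsOf ((tr.F t).l ++ optWord (tr.F t).c)).Nodup := by
  have := tr.nodup_frame ht
  rw [← List.append_assoc, varsOf_append] at this
  exact this.of_append_left

lemma weight {t : ℕ} (ht : t ≤ z.length) :
    Subst.weight T.outVar j t (tr.s ++ [T.fin (tr.q z.length)]) + (eraseVars (tr.F t).l).length =
      j := by
  have h := tr.length_eq
  refine Frame.Valid.weight (by simp; omega) ?_
  rw [List.take_append_of_le_length (by omega), List.drop_append_of_le_length (by omega)]
  exact tr.valid t ht

/-- At time 0 all variables are empty, and all letters before the cut are still to be written. -/
lemma length_zero : (eraseVars (tr.F 0).l).length = j := by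
  have h := tr.valid 0 (Nat.zero_le _)
  have hc : content (tr.s.take 0) = fun _ => [] := by
    funext x; simp [content, ident]
  have h1 := h.value
  have h2 := h.pos
  rw [hc] at h1 h2
  rw [← eraseVars_eq_eval] at h1 h2
  have h3 : (tr.F 0).u = [] := by
    refine (List.append_eq_nil_iff.1 (h1.symm.trans ?_)).1
    rcases (tr.F 0).c with _ | x <;> simp
  simpa [h3] using h2

lemma chain {K : ℕ} {τ : ℕ → ℕ} (hτ : ∀ i < K, τ i ≤ τ (i + 1)) (hτK : ∀ i ≤ K, τ i ≤ z.length)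
    (hidem : ∀ i < K, cls (comp (compSeq (window tr.s (τ i) (τ (i + 1))))
      (compSeq (window tr.s (τ i) (τ (i + 1))))) = cls (compSeq (window tr.s (τ i) (τ (i + 1)))))
    (hcls : ∀ i < K, ∀ i' < K, cls (compSeq (window tr.s (τ i) (τ (i + 1)))) =
      cls (compSeq (window tr.s (τ i') (τ (i' + 1)))))
    (hc : ∀ i ≤ K, (tr.F (τ i)).c = (tr.F (τ 0)).c)
    (hl : ∀ i ≤ K, ∀ x, x ∈ varsOf (tr.F (τ i)).l ↔ x ∈ varsOf (tr.F (τ 0)).l)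
    (hr : ∀ i ≤ K, ∀ x, x ∈ varsOf (tr.F (τ i)).r ↔ x ∈ varsOf (tr.F (τ 0)).r) :
    Chain K j (fun i => compSeq (window tr.s (τ i) (τ (i + 1))))
      (fun i => content (tr.s.take (τ i)))
      (fun i => compSeq (tr.s.drop (τ i) ++ [T.fin (tr.q z.length)]) T.outVar)
      (fun i => tr.F (τ i)) where
  idem i hi := ⟨tr.copyless_window, hidem i hi⟩
  cls_eq := hcls
  content i hi x := content_take tr.s (hτ i hi) x
  step i hi := tr.step _ _ (hτ i hi) (hτK _ hi)
  valid i hi := tr.valid _ (hτK i hi)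
  nodup i hi := tr.nodup (hτK i hi)
  center := hc
  left := hl
  right := hr

end Track

lemma content_replicate (s r : List (Subst T.Var A)) (n : ℕ) :
    content (s ++ (List.replicate n r).flatten) = iterVal (compSeq r) (content s) n := by
  induction n with
  | zero => simp [iterVal]
  | succ n ih =>
    funext x
    rw [List.replicate_succ', List.flatten_append, ← List.append_assoc, content_append, ih,
      iterVal_succ]
    simp

namespace Track

variable {z : List A} {j : ℕ} (tr : Track T z j)

lemma mem_rel_pump {t : ℕ} (ht : t ≤ z.length) {y : List A} {r : List (Subst T.Var A)}
    (hr : T.Run (tr.q t) y r (tr.q t)) (n : ℕ) :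
    (z.take t ++ (List.replicate n y).flatten ++ z.drop t,
      eval (iterVal (compSeq r) (content (tr.s.take t)) n)
        (compSeq (tr.s.drop t ++ [T.fin (tr.q z.length)]) T.outVar)) ∈ T.rel := by
  refine ⟨_, ⟨tr.q 0, tr.start, tr.q z.length, tr.accept, _,
    ((tr.run_take ht).append (hr.replicate n)).append (tr.run_drop ht), rfl⟩, ?_⟩
  simp only
  rw [List.append_assoc, output_append, content_replicate]

/-- The patterns of the outputs of the runs that are obtained by pumping in the middle of a
chain of loops. -/
theorem exists_pattern {f : ℕ} (hf : 0 < f) {τ : ℕ → ℕ} (hτ : ∀ i < 2 * f, τ i ≤ τ (i + 1))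
    (hτK : ∀ i ≤ 2 * f, τ i ≤ z.length)
    (h : Chain (2 * f) j (fun i => compSeq (window tr.s (τ i) (τ (i + 1))))
      (fun i => content (tr.s.take (τ i)))
      (fun i => compSeq (tr.s.drop (τ i) ++ [T.fin (tr.q z.length)]) T.outVar)
      (fun i => tr.F (τ i)))
    (hq : tr.q (τ (f - 1)) = tr.q (τ f)) {y : List A} {r : List (Subst T.Var A)}
    (hr : T.Run (tr.q (τ f)) y r (tr.q (τ f)))
    (hcls : cls (compSeq (r ++ window tr.s (τ (f - 1)) (τ f))) =
      cls (compSeq (window tr.s (τ (f - 1)) (τ f))))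
    {G : Frame T.Var A} (hG : G.Step (compSeq r) (tr.F (τ (f - 1))))
    (hGc : G.c = (tr.F (τ (f - 1))).c) (hGn : (varsOf G.l).Nodup)
    (hGl : ∀ x, x ∈ varsOf G.l ↔ x ∈ varsOf (tr.F (τ (f - 1))).l) :
    ∃ P S, (∀ n, (z.take (τ f) ++
        (List.replicate n (y ++ window z (τ (f - 1)) (τ f))).flatten ++ z.drop (τ f),
        patEval n P ++ patEval n S) ∈ T.rel) ∧
      (patEval 0 P).length = j ∧ FarFromEnd f P ∧ FarFromStart f S ∧
      patSlope P + (eraseVars (tr.F (τ f)).l).length = (eraseVars G.l).length := by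
  have hf1 : f - 1 + 1 = f := by omega
  have hle : τ (f - 1) ≤ τ f := by simpa [hf1] using hτ (f - 1) (by omega)
  have hI := h.idem (f - 1) (by omega)
  have hcont := h.content (f - 1) (by omega)
  have hcls0 := h.cls_eq (f - 1) (by omega) 0 (by omega)
  simp only [hf1] at hI hcont hcls0
  have hC : (compSeq (r ++ window tr.s (τ (f - 1)) (τ f))).Copyless := by
    rw [compSeq_append]
    exact (copyless_compSeq hr.copyless).comp hI.copyless
  obtain ⟨P, S, h1, h2⟩ := h.exists_pattern hf hC (hcls.trans hcls0)
    -- The inserted loop `r` comes before the original one, which therefore has the last word on the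
    -- non-persistent variables: it leaves them with their contents at time `τ f`.
    (fun x hx => by
      have hx' : x ∉ varsOf (compSeq (window tr.s (τ (f - 1)) (τ f)) x) := fun hm =>
        hx (mem_varsOf_of_cls hcls.symm hm)
      have hv := hI.eq_nil hx'
      rw [hcont, eval_of_varsOf_eq_nil hv, compSeq_append, comp, eraseVars_hat,
        eval_of_varsOf_eq_nil hv])
    (by
      rw [compSeq_append]
      exact hG.trans (tr.step _ _ hle (hτK f (by omega))))
    (hGc.trans (h.center _ (by omega))) hGn
    (fun x => (hGl x).trans (h.left _ (by omega) x))
  refine ⟨P, S, fun n => ?_, h2⟩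
  have hw := tr.run _ _ hle (hτK f (by omega))
  rw [hq] at hw
  have := tr.mem_rel_pump (hτK f (by omega)) (hr.append hw) n
  rwa [h1] at this

end Track

end SST

/-! ## Pumping two runs over the same input -/

namespace SST

open Subst MulOpposite

variable {A : Type*} {T T₁ T₂ : SST A}

instance (T : SST A) : Finite T.State := T.finite_state

instance (T : SST A) : Finite T.Var := T.finite_var

/-- The finite information on a state and a frame. -/
abbrev Types (T : SST A) : Type := T.State × Set T.Var × Option T.Var × Set T.Var

/-- The monoid of the classes of substitutions. -/
abbrev Acts (T : SST A) : Type := (Function.End (T.Var ⊕ Unit → Function.End (Fin 3)))ᵐᵒᵖ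

/-- The type of a state and a frame. -/
def typeOf (q : T.State) (F : Frame T.Var A) : Types T :=
  (q, {x | x ∈ varsOf F.l}, F.c, {x | x ∈ varsOf F.r})

lemma typeOf_eq_iff {p q : T.State} {F G : Frame T.Var A} :
    typeOf p F = typeOf q G ↔ p = q ∧ (∀ x, x ∈ varsOf F.l ↔ x ∈ varsOf G.l) ∧ F.c = G.c ∧
      ∀ x, x ∈ varsOf F.r ↔ x ∈ varsOf G.r := by
  simp [typeOf, Set.ext_iff]

/-- The class of a substitution, as an element of a monoid. -/
def act (σ : Subst T.Var A) : Acts T := op (cls σ)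

lemma act_comp (σ τ : Subst T.Var A) : act (comp σ τ) = act σ * act τ := by
  rw [act, cls_comp]; rfl

lemma act_eq_iff {σ τ : Subst T.Var A} : act σ = act τ ↔ cls σ = cls τ := op_inj

/-- A loop over the input `y` on a state and a frame of type `e`, which acts by `a` on the
variables and adds `d` letters to the left of the cut. -/
def LoopAt (T : SST A) (y : List A) (e : Types T) (a : Acts T) (d : ℕ) : Prop :=
  ∃ p s, ∃ F G : Frame T.Var A, T.Run p y s p ∧ F.Step (compSeq s) G ∧ typeOf p F = e ∧
    typeOf p G = e ∧ act (compSeq s) = a ∧ (varsOf (G.l ++ optWord G.c)).Nodup ∧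
    (eraseVars F.l).length = (eraseVars G.l).length + d

namespace Track

variable {z : List A} {j : ℕ}

lemma exists_patterns (tr : Track T z j) {f : ℕ} (hf : 0 < f) {τ : ℕ → ℕ}
    (hτ : ∀ i < 2 * f, τ i ≤ τ (i + 1)) (hτK : ∀ i ≤ 2 * f, τ i ≤ z.length) {e : Types T}
    {a : Acts T} (ha : a * a = a) (hty : ∀ i ≤ 2 * f, typeOf (tr.q (τ i)) (tr.F (τ i)) = e)
    (hact : ∀ i < 2 * f, act (compSeq (window tr.s (τ i) (τ (i + 1)))) = a) {y : List A} {d : ℕ}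
    (hB : LoopAt T y e a d) :
    (∃ P S, (∀ n, (z.take (τ f) ++
        (List.replicate n (window z (τ (f - 1)) (τ f))).flatten ++ z.drop (τ f),
        patEval n P ++ patEval n S) ∈ T.rel) ∧
      (patEval 0 P).length = j ∧ FarFromEnd f P ∧ FarFromStart f S ∧
      patSlope P + (eraseVars (tr.F (τ f)).l).length =
        (eraseVars (tr.F (τ (f - 1))).l).length) ∧
    ∃ P S, (∀ n, (z.take (τ f) ++
        (List.replicate n (y ++ window z (τ (f - 1)) (τ f))).flatten ++ z.drop (τ f),
        patEval n P ++ patEval n S) ∈ T.rel) ∧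
      (patEval 0 P).length = j ∧ FarFromEnd f P ∧ FarFromStart f S ∧
      patSlope P + (eraseVars (tr.F (τ f)).l).length =
        (eraseVars (tr.F (τ (f - 1))).l).length + d := by
  have hf1 : f - 1 + 1 = f := by omega
  have hty' : ∀ i ≤ 2 * f, ∀ i' ≤ 2 * f, _ := fun i hi i' hi' =>
    typeOf_eq_iff.1 ((hty i hi).trans (hty i' hi').symm)
  have hch := tr.chain hτ hτK
    (fun i hi => by rw [← act_eq_iff, act_comp, hact i hi, ha])
    (fun i hi i' hi' => by rw [← act_eq_iff, hact i hi, hact i' hi'])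
    (fun i hi => (hty' i hi 0 (by omega)).2.2.1)
    (fun i hi => (hty' i hi 0 (by omega)).2.1)
    (fun i hi => (hty' i hi 0 (by omega)).2.2.2)
  have hq := (hty' (f - 1) (by omega) f (by omega)).1
  have hn := tr.nodup_left (hτK (f - 1) (by omega))
  have hactI := hact (f - 1) (by omega)
  rw [hf1] at hactI
  constructor
  · have hn' := hn
    rw [varsOf_append] at hn'
    exact tr.exists_pattern hf hτ hτK hch hq (Run.nil _) rfl (Frame.Step.refl _) rfl
      hn'.of_append_left fun _ => Iff.rfl
  · obtain ⟨p, s, F, G, hrun, hstep, hF, hG, hacts, hGn, hd⟩ := hB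
    have hFG := typeOf_eq_iff.1 (hF.trans hG.symm)
    have hFt := typeOf_eq_iff.1 ((hty (f - 1) (by omega)).trans hG.symm)
    have hft := typeOf_eq_iff.1 ((hty f (by omega)).trans hG.symm)
    obtain ⟨H, h1, h2, h3, h4, h5⟩ := hstep.transfer (copyless_compSeq hrun.copyless)
      hFG.2.2.1 hFt.2.2.1 hFG.2.1 hFt.2.1 hGn hn
    obtain ⟨P, S, k1, k2, k3, k4, k5⟩ := tr.exists_pattern hf hτ hτK hch hq
      (y := y) (r := s) (by rwa [hft.1])
      (by rw [← act_eq_iff, compSeq_append, act_comp, hacts, hactI, ha]) h1 h2 h4 h3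
    exact ⟨P, S, k1, k2, k3, k4, by omega⟩

end Track

/-- Functionality forces the two pumped outputs to agree for every `n`, while the parts left of the
same base cut grow at different rates. -/
lemma period_of_pump (hrel : T₁.rel = T₂.rel) (hfun : T₁.Functional) {z W : List A}
    (hW : (z, W) ∈ T₁.rel) {inp : ℕ → List A} (hinp : inp 0 = z)
    {P₁ S₁ P₂ S₂ : List (List A × List A)} {f j : ℕ}
    (h₁ : ∀ n, (inp n, patEval n P₁ ++ patEval n S₁) ∈ T₁.rel)
    (h₂ : ∀ n, (inp n, patEval n P₂ ++ patEval n S₂) ∈ T₂.rel)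
    (hj₁ : (patEval 0 P₁).length = j) (hj₂ : (patEval 0 P₂).length = j)
    (hS₁ : FarFromStart f S₁) (hP₂ : FarFromEnd f P₂) {d : ℕ} (hd : 0 < d)
    (hslope : patSlope P₂ = patSlope P₁ + d) (hdf : d ≤ 2 * f) :
    f ≤ j ∧ j + f ≤ W.length ∧
      ∃ g, 0 < g ∧ g ∣ d ∧ (window W (j - f) (j + f)).HasPeriod g := by
  have hsub : patSlope P₂ - patSlope P₁ = d := by omega
  have h := period_of_slope f j (fun n => patEval n S₂) _ P₁ S₁ P₂ [] [] le_rfl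
    (fun n => hfun _ _ _ (h₁ n) (hrel ▸ h₂ n)) (by simpa using hj₁) (by simpa using hj₂)
    (by omega) (by omega) hS₁ hP₂
  have hW' : [] ++ (patEval 0 P₁ ++ patEval 0 S₁) = W := hfun _ _ _ (h₁ 0) (hinp ▸ hW)
  rwa [hW', hsub] at h

/-- Pumping the middle loop alone gives a period that divides `δ`; pumping it with a loop over `y`
in front gives one that divides `δ + d`. Their gcd divides `d`, and it is a period by Fine and Wilf
since the window has length `2 * f ≥ δ + (δ + d)`. -/
theorem exists_small_period (hrel : T₁.rel = T₂.rel) (hfun : T₁.Functional) {z W : List A}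
    (hW : (z, W) ∈ T₁.rel) {j : ℕ} (tr₁ : Track T₁ z j) (tr₂ : Track T₂ z j) {f : ℕ}
    {τ : ℕ → ℕ} (hτ : ∀ i < 2 * f, τ i ≤ τ (i + 1)) (hτK : ∀ i ≤ 2 * f, τ i ≤ z.length)
    {e₁ : Types T₁} {a₁ : Acts T₁} {e₂ : Types T₂} {a₂ : Acts T₂} (ha₁ : a₁ * a₁ = a₁)
    (ha₂ : a₂ * a₂ = a₂)
    (hty₁ : ∀ i ≤ 2 * f, typeOf (tr₁.q (τ i)) (tr₁.F (τ i)) = e₁)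
    (hty₂ : ∀ i ≤ 2 * f, typeOf (tr₂.q (τ i)) (tr₂.F (τ i)) = e₂)
    (hact₁ : ∀ i < 2 * f, act (compSeq (window tr₁.s (τ i) (τ (i + 1)))) = a₁)
    (hact₂ : ∀ i < 2 * f, act (compSeq (window tr₂.s (τ i) (τ (i + 1)))) = a₂)
    {y : List A} {d₁ d : ℕ} (hB₁ : LoopAt T₁ y e₁ a₁ d₁) (hB₂ : LoopAt T₂ y e₂ a₂ (d₁ + d))
    (hd : 0 < d) {δ : ℕ} (hδ : 0 < δ)
    (hI : (eraseVars (tr₂.F (τ (f - 1))).l).length + (eraseVars (tr₁.F (τ f)).l).length =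
      (eraseVars (tr₁.F (τ (f - 1))).l).length + (eraseVars (tr₂.F (τ f)).l).length + δ)
    (hf : δ + (δ + d) ≤ 2 * f) :
    f ≤ j ∧ j + f ≤ W.length ∧
      ∃ g, 0 < g ∧ g ≤ d ∧ (window W (j - f) (j + f)).HasPeriod g := by
  have hf0 : 0 < f := by omega
  obtain ⟨⟨P, S, h1, h2, h3, h4, h5⟩, P', S', h1', h2', h3', h4', h5'⟩ :=
    tr₁.exists_patterns hf0 hτ hτK ha₁ hty₁ hact₁ hB₁
  obtain ⟨⟨Q, R, k1, k2, k3, k4, k5⟩, Q', R', k1', k2', k3', k4', k5'⟩ :=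
    tr₂.exists_patterns hf0 hτ hτK ha₂ hty₂ hact₂ hB₂
  obtain ⟨m1, m2, g, hg, hgd, hp⟩ := period_of_pump hrel hfun hW
    (inp := fun n => z.take (τ f) ++
        (List.replicate n (window z (τ (f - 1)) (τ f))).flatten ++ z.drop (τ f)) (by simp)
    h1 k1 h2 k2 h4 k3 hδ (by omega) (by omega)
  obtain ⟨-, -, g', hg', hgd', hp'⟩ := period_of_pump hrel hfun hW
    (inp := fun n => z.take (τ f) ++
        (List.replicate n (y ++ window z (τ (f - 1)) (τ f))).flatten ++ z.drop (τ f)) (by simp)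
    h1' k1' h2' k2' h4' k3' (d := δ + d) (by omega) (by omega) (by omega)
  have hlen : (window W (j - f) (j + f)).length = 2 * f := by
    rw [window, List.length_drop, List.length_take]
    omega
  have hle := Nat.le_of_dvd hδ hgd
  have hle' := Nat.le_of_dvd (by omega) hgd'
  refine ⟨m1, m2, g.gcd g', Nat.gcd_pos_of_pos_left _ hg, Nat.le_of_dvd hd ?_, ?_⟩
  · exact (Nat.dvd_add_right ((Nat.gcd_dvd_left g g').trans hgd)).1
      ((Nat.gcd_dvd_right g g').trans hgd')
  · exact hp.gcd hp' (by omega)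

end SST

/-! ## Bounds on the delay of equivalent transducers -/

namespace SST

open Subst

/-- An arrow from `src` to `tgt` that carries an element of a semigroup. The product is defined
for all pairs of arrows. -/
@[ext]
structure Arrow (E M : Type*) where
  /-- the source -/
  src : E
  /-- the element of the semigroup -/
  act : M
  /-- the target -/
  tgt : E

instance {E M : Type*} [Semigroup M] : Semigroup (Arrow E M) where
  mul a b := ⟨a.src, a.act * b.act, b.tgt⟩
  mul_assoc a b c := Arrow.ext rfl (mul_assoc a.act b.act c.act) rfl

lemma Arrow.mul_def {E M : Type*} [Semigroup M] (a b : Arrow E M) :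
    a * b = ⟨a.src, a.act * b.act, b.tgt⟩ := rfl

instance {E M : Type*} [Finite E] [Finite M] : Finite (Arrow E M) :=
  Finite.of_injective (fun a : Arrow E M => (a.src, a.act, a.tgt)) fun a b h => by
    simp only [Prod.mk.injEq] at h
    exact Arrow.ext h.1 h.2.1 h.2.2

instance {V : Type*} [Finite V] : Finite (Function.End V) := inferInstanceAs (Finite (V → V))

instance {M : Type*} [Finite M] : Finite Mᵐᵒᵖ := Finite.of_equiv M MulOpposite.opEquiv

variable {A : Type*} {T T₁ T₂ : SST A}

/-- Taking the least witness for each of finitely many types yields a bound that no longer depends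
on the runs or on the window. -/
lemma exists_forall_exists_le {S : Type*} [Finite S] (Q : S → ℕ → Prop) :
    ∃ p, ∀ e, (∃ d, Q e d) → ∃ d ≤ p, Q e d := by
  classical
  obtain ⟨p, hp⟩ := (Set.finite_range fun e => if h : ∃ d, Q e d then Nat.find h else 0).bddAbove
  refine ⟨p, fun e h => ⟨Nat.find h, ?_, Nat.find_spec h⟩⟩
  have := hp (Set.mem_range_self e)
  simpa only [dif_pos h] using this

/-- `θ i` is the first time at which `D` reaches `i * (M + 1)`. As `D` rises by at most `M` per
step, it does not reach the next level at that time, so `D` increases strictly along `θ`, by an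
amount controlled by the number of levels. -/
lemma exists_levels {D : ℕ → ℤ} {n M k t₀ : ℕ} (h0 : D 0 = 0)
    (hD : ∀ t < n, D (t + 1) ≤ D t + M) (ht₀ : t₀ ≤ n) (hk : (k : ℤ) * (M + 1) ≤ D t₀) :
    ∃ θ : ℕ → ℕ, (∀ i ≤ k, θ i ≤ n ∧ (i : ℤ) * (M + 1) ≤ D (θ i) ∧
      D (θ i) < ((i : ℤ) + 1) * (M + 1)) ∧ ∀ i < k, θ i < θ (i + 1) := by
  classical
  have hex : ∀ i ≤ k, ∃ t, (i : ℤ) * (M + 1) ≤ D t := by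
    intro i hi
    refine ⟨t₀, le_trans ?_ hk⟩
    gcongr
  have key : ∀ i, ∃ t, i ≤ k → t ≤ n ∧ (i : ℤ) * (M + 1) ≤ D t ∧
      D t < ((i : ℤ) + 1) * (M + 1) ∧ ∀ t' < t, D t' < (i : ℤ) * (M + 1) := by
    intro i
    by_cases hi : i ≤ k
    · have h1 := Nat.find_spec (hex i hi)
      have h2 : Nat.find (hex i hi) ≤ n := by
        refine (Nat.find_min' (hex i hi) ?_).trans ht₀
        refine le_trans ?_ hk
        gcongr
      have h3 : ∀ t' < Nat.find (hex i hi), D t' < (i : ℤ) * (M + 1) := fun t' ht' =>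
        not_le.1 (Nat.find_min (hex i hi) ht')
      refine ⟨Nat.find (hex i hi), fun _ => ⟨h2, h1, ?_, h3⟩⟩
      rcases ht : Nat.find (hex i hi) with _ | t
      · rw [h0]; positivity
      · have h4 := h3 t (by omega)
        have h5 := hD t (by omega)
        have h6 : ((i : ℤ) + 1) * (M + 1) = (i : ℤ) * (M + 1) + (M + 1) := by ring
        omega
    · exact ⟨0, fun h => absurd h hi⟩
  choose θ hθ using key
  refine ⟨θ, fun i hi => ⟨(hθ i hi).1, (hθ i hi).2.1, (hθ i hi).2.2.1⟩, fun i hi => ?_⟩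
  obtain ⟨-, h1, h2, h3⟩ := hθ i hi.le
  obtain ⟨-, h1', -, -⟩ := hθ (i + 1) hi
  push_cast at h1'
  by_contra hle
  rcases (not_lt.1 hle).eq_or_lt with h | h
  · rw [h] at h1'
    exact absurd (h1'.trans_lt h2) (lt_irrefl _)
  · have h4 := h3 _ h
    have h6 : ((i : ℤ) + 1) * (M + 1) = (i : ℤ) * (M + 1) + (M + 1) := by ring
    omega

lemma exists_bound_upd [Finite A] (T : SST A) :
    ∃ M, ∀ (z : List A) (j : ℕ) (tr : Track T z j), ∀ t < z.length,
      (eraseVars (tr.F t).l).length ≤ (eraseVars (tr.F (t + 1)).l).length + M := by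
  have := Fintype.ofFinite T.Var
  obtain ⟨M, hM⟩ := (Set.finite_range fun x : T.State × A × T.State =>
    ∑ v, (eraseVars (T.upd x.1 x.2.1 x.2.2 v)).length).bddAbove
  refine ⟨M, fun z j tr t ht => ?_⟩
  have h1 := (tr.step t (t + 1) (Nat.le_succ t) ht).length_le (tr.nodup_frame ht)
  obtain ⟨a, ha⟩ := (tr.run t (t + 1) (Nat.le_succ t) ht).eq_upd (by
    rw [length_window]; omega)
  rw [ha] at h1
  have h2 := hM (Set.mem_range_self (tr.q t, a, tr.q (t + 1)))
  simp only [compSeq_cons, compSeq_nil, comp_ident] at h1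
  exact h1.trans (Nat.add_le_add_left h2 _)

namespace Track

variable {z : List A} {j : ℕ}

/-- The part of two runs between two times, as an element of a finite semigroup. -/
def arrow (tr₁ : Track T₁ z j) (tr₂ : Track T₂ z j) (t t' : ℕ) :
    Arrow (Types T₁ × Types T₂) (Acts T₁ × Acts T₂) :=
  ⟨(typeOf (tr₁.q t) (tr₁.F t), typeOf (tr₂.q t) (tr₂.F t)),
    (act (compSeq (window tr₁.s t t')), act (compSeq (window tr₂.s t t'))),
    (typeOf (tr₁.q t') (tr₁.F t'), typeOf (tr₂.q t') (tr₂.F t'))⟩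

lemma arrow_mul (tr₁ : Track T₁ z j) (tr₂ : Track T₂ z j) {t t' t'' : ℕ} (h : t ≤ t')
    (h' : t' ≤ t'') : tr₁.arrow tr₂ t t' * tr₁.arrow tr₂ t' t'' = tr₁.arrow tr₂ t t'' := by
  rw [Arrow.mul_def]
  simp only [arrow, Prod.mk_mul_mk, ← act_comp, ← compSeq_window _ h h']

lemma loopAt (tr : Track T z j) {t t' : ℕ} (h : t ≤ t') (h' : t' ≤ z.length)
    (hty : typeOf (tr.q t) (tr.F t) = typeOf (tr.q t') (tr.F t')) {d : ℕ}
    (hd : (eraseVars (tr.F t).l).length = (eraseVars (tr.F t').l).length + d) :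
    LoopAt T (window z t t') (typeOf (tr.q t) (tr.F t)) (act (compSeq (window tr.s t t'))) d := by
  have hr := tr.run t t' h h'
  have hq := (typeOf_eq_iff.1 hty).1
  refine ⟨tr.q t, _, tr.F t, tr.F t', ?_, tr.step t t' h h', rfl, ?_, rfl, tr.nodup_left h', hd⟩
  · rwa [← hq] at hr
  · rw [hty, hq]

end Track

/-- If the difference of the weights at an output position is large, then the output is periodic
around this position. -/
theorem exists_period_of_weight_lt [Finite A] (hrel : T₁.rel = T₂.rel) (hfun : T₁.Functional) :
    ∃ p, ∀ f, ∃ k, ∀ z s r, (z, s) ∈ T₁.lang → (z, r) ∈ T₂.lang →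
      ∀ j ≤ (output T₁.outVar s).length, ∀ t ≤ z.length,
        weight T₁.outVar j t s + k < weight T₂.outVar j t r →
        f ≤ j ∧ j + f ≤ (output T₁.outVar s).length ∧
          ∃ g, 0 < g ∧ g ≤ p ∧ (window (output T₁.outVar s) (j - f) (j + f)).HasPeriod g := by
  -- `p` is fixed before the radius `f`: it bounds the least gain of a loop for each type that
  -- admits one.
  obtain ⟨p, hp⟩ := exists_forall_exists_le
    fun (e : Arrow (Types T₁ × Types T₂) (Acts T₁ × Acts T₂)) d =>
      0 < d ∧ ∃ y d₁, LoopAt T₁ y e.src.1 e.act.1 d₁ ∧ LoopAt T₂ y e.src.2 e.act.2 (d₁ + d)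
  obtain ⟨M, hM⟩ := exists_bound_upd T₂
  refine ⟨p, fun f => ?_⟩
  obtain ⟨k, hk⟩ := exists_consecutive_idempotent
    (S := Arrow (Types T₁ × Types T₂) (Acts T₁ × Acts T₂))
    -- Loops with gap at most `b` have `δ < (b + 1) * (M + 1)`, and `d ≤ p`. Half of this number
    -- thus exceeds `f` and satisfies the Fine and Wilf bound; plain Ramsey arguments would not
    -- relate the number of loops to the gap.
    fun b => 2 * (f + (b + 1) * (M + 1) + p + 1)
  refine ⟨k * (M + 1), fun z s r hs hr j hj t₀ ht₀ hw => ?_⟩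
  have hW : (z, output T₁.outVar s) ∈ T₁.rel := ⟨s, hs, rfl⟩
  have hout : output T₁.outVar s = output T₂.outVar r :=
    hfun _ _ _ hW (hrel ▸ ⟨r, hr, rfl⟩)
  obtain ⟨tr₁, rfl⟩ := exists_track hs hj
  obtain ⟨tr₂, rfl⟩ := exists_track hr (hout ▸ hj)
  generalize output T₁.outVar _ = W at hW
  set D : ℕ → ℤ := fun t => (eraseVars (tr₁.F t).l).length - (eraseVars (tr₂.F t).l).length with hDdef
  have hD0 : D 0 = 0 := by simp [hDdef, tr₁.length_zero, tr₂.length_zero]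
  -- The count of `T₁` never increases with time, so only the count of `T₂`, which drops by at most
  -- `M`, can raise `D`.
  have hDs : ∀ t < z.length, D (t + 1) ≤ D t + M := by
    intro t ht
    have h1 := hM z j tr₂ t ht
    have h2 := (tr₁.step t (t + 1) (Nat.le_succ t) ht).le_length
    simp only [hDdef]
    omega
  have hDt : (k : ℤ) * (M + 1) ≤ D t₀ := by
    have h1 := tr₁.weight ht₀
    have h2 := tr₂.weight ht₀
    have h3 : ((k * (M + 1) : ℕ) : ℤ) ≤ D t₀ := by
      simp only [hDdef]
      omega
    exact_mod_cast h3
  obtain ⟨θ, hθ, hθm⟩ := exists_levels hD0 hDs ht₀ hDt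
  obtain ⟨b, e, t, he, ht, htk⟩ := hk (fun i i' => tr₁.arrow tr₂ (θ i) (θ i'))
    fun i i' i'' h h' h'' => tr₁.arrow_mul tr₂ (le_of_chain hθm h.le (by omega))
      (le_of_chain hθm h'.le h'')
  set f' := f + (b + 1) * (M + 1) + p + 1 with hf'
  have htm : ∀ i < 2 * f', t i < t (i + 1) := fun i hi => (ht i hi).1
  have htk' : ∀ i ≤ 2 * f', t i ≤ k := fun i hi => (le_of_chain htm hi le_rfl).trans htk
  have hτK : ∀ i ≤ 2 * f', θ (t i) ≤ z.length := fun i hi => (hθ _ (htk' i hi)).1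
  have hτ : ∀ i < 2 * f', θ (t i) ≤ θ (t (i + 1)) := fun i hi =>
    le_of_chain hθm (htm i hi).le (htk' _ hi)
  have hsrc : ∀ i < 2 * f', (typeOf (tr₁.q (θ (t i))) (tr₁.F (θ (t i))),
      typeOf (tr₂.q (θ (t i))) (tr₂.F (θ (t i)))) = e.src := fun i hi =>
    congrArg Arrow.src (ht i hi).2.2
  have htgt : ∀ i < 2 * f', (typeOf (tr₁.q (θ (t (i + 1)))) (tr₁.F (θ (t (i + 1)))),
      typeOf (tr₂.q (θ (t (i + 1)))) (tr₂.F (θ (t (i + 1))))) = e.tgt := fun i hi =>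
    congrArg Arrow.tgt (ht i hi).2.2
  -- The product of arrows ignores the inner ends, so idempotence of `e` does not identify its ends;
  -- two consecutive occurrences of `e` do.
  have hst : e.tgt = e.src := (htgt 0 (by omega)).symm.trans (hsrc 1 (by omega))
  have hty : ∀ i ≤ 2 * f', (typeOf (tr₁.q (θ (t i))) (tr₁.F (θ (t i))),
      typeOf (tr₂.q (θ (t i))) (tr₂.F (θ (t i)))) = e.src := by
    intro i hi
    rcases i with _ | i
    · exact hsrc 0 (by omega)
    · exact (htgt i hi).trans hst
  have hact : ∀ i < 2 * f', (act (compSeq (window tr₁.s (θ (t i)) (θ (t (i + 1))))),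
      act (compSeq (window tr₂.s (θ (t i)) (θ (t (i + 1)))))) = e.act := fun i hi =>
    congrArg Arrow.act (ht i hi).2.2
  have hee : e.act * e.act = e.act := congrArg Arrow.act he
  have hf1 : f' - 1 + 1 = f' := by omega
  have hlt : f' - 1 < 2 * f' := by omega
  have hle := hτ _ hlt
  have hact' := hact _ hlt
  have hty0 := hty (f' - 1) hlt.le
  have hty1 := hty f' (by omega)
  have htb := ht _ hlt
  rw [hf1] at hle hact' htb
  have hz := hτK f' (by omega)
  have hl₁ := (tr₁.step _ _ hle hz).le_length
  have hl₂ := (tr₂.step _ _ hle hz).le_length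
  obtain ⟨-, hDl, hDu⟩ := hθ _ (htk' (f' - 1) hlt.le)
  obtain ⟨-, hDl', hDu'⟩ := hθ _ (htk' f' (by omega))
  have hδ0 : D (θ (t (f' - 1))) < D (θ (t f')) := by
    refine hDu.trans_le (le_trans ?_ hDl')
    have : ((t (f' - 1) : ℤ) + 1) ≤ t f' := by have := htb.1; omega
    gcongr
  have hδ1 : D (θ (t f')) < D (θ (t (f' - 1))) + ((b + 1) * (M + 1) : ℕ) := by
    have h1 : ((t f' : ℤ) + 1) * (M + 1) ≤ (t (f' - 1) + b + 1) * (M + 1) := by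
      have : (t f' : ℤ) ≤ t (f' - 1) + b := by have := htb.2.1; omega
      gcongr
    have h2 : ((t (f' - 1) : ℤ) + b + 1) * (M + 1) =
      t (f' - 1) * (M + 1) + ((b + 1) * (M + 1) : ℕ) := by push_cast; ring
    omega
  obtain ⟨d₁, hd₁⟩ := Nat.exists_eq_add_of_le hl₁
  obtain ⟨δ, hδ⟩ : ∃ δ : ℕ, D (θ (t f')) = D (θ (t (f' - 1))) + δ :=
    ⟨(D (θ (t f')) - D (θ (t (f' - 1)))).toNat, by omega⟩
  have hδpos : 0 < δ := by omega
  have hδle : δ < (b + 1) * (M + 1) := by omega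
  have hI : (eraseVars (tr₂.F (θ (t (f' - 1)))).l).length +
      (eraseVars (tr₁.F (θ (t f'))).l).length =
      (eraseVars (tr₁.F (θ (t (f' - 1)))).l).length +
      (eraseVars (tr₂.F (θ (t f'))).l).length + δ := by
    simp only [hDdef] at hδ
    omega
  have hL₁ := tr₁.loopAt hle hz
    ((congrArg Prod.fst hty0).trans (congrArg Prod.fst hty1).symm) hd₁
  have hL₂ := tr₂.loopAt hle hz
    ((congrArg Prod.snd hty0).trans (congrArg Prod.snd hty1).symm) (d := d₁ + δ) (by omega)
  rw [show typeOf _ _ = e.src.1 from congrArg Prod.fst hty0,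
    show act _ = e.act.1 from congrArg Prod.fst hact'] at hL₁
  rw [show typeOf _ _ = e.src.2 from congrArg Prod.snd hty0,
    show act _ = e.act.2 from congrArg Prod.snd hact'] at hL₂
  -- The middle loop itself witnesses that the type `e` admits a positive gain, so there is also a
  -- loop of this type with gain at most `p`, possibly over an unrelated input `y`.
  obtain ⟨d, hdp, hd0, y, d₁', hB₁, hB₂⟩ := hp e ⟨δ, hδpos, _, d₁, hL₁, hL₂⟩
  obtain ⟨h1, h2, g, hg0, hgd, hg⟩ := exists_small_period hrel hfun hW tr₁ tr₂
    (τ := fun i => θ (t i)) hτ hτK (congrArg Prod.fst hee) (congrArg Prod.snd hee)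
    (fun i hi => congrArg Prod.fst (hty i hi)) (fun i hi => congrArg Prod.snd (hty i hi))
    (fun i hi => congrArg Prod.fst (hact i hi)) (fun i hi => congrArg Prod.snd (hact i hi))
    hB₁ hB₂ hd0 hδpos hI (by omega)
  exact ⟨by omega, by omega, g, hg0, hgd.trans hdp,
    hg.infix (window_infix _ (by omega) (by omega))⟩

/-! ### From periodicity to bounded delay -/

lemma weight_length {X : Type*} (O : X) (s : List (Subst X A)) {j : ℕ}
    (hj : j ≤ (output O s).length) : weight O j s.length s = j := by
  have := weight_add_length O s [] (l := []) (m := []) (c := [O]) (i := j) (j := j)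
    (by simp [ident]) (by simpa [content, output] using hj) (by simp)
  simpa using this

lemma le_length_of_mem_cuts {l j : ℕ} {w : List A} (h : j ∈ cuts l w) : j ≤ w.length := by
  obtain ⟨x, y, rfl, hy, rfl⟩ := exists_of_mem_cuts l w j h
  have h1 := List.length_pos_iff.2 hy
  have h2 : factorLength l y ≤ y.length := by
    classical
    exact Nat.findGreatest_le _
  rw [List.length_append]
  omega

lemma length_of_mem_lang {z : List A} {s : List (Subst T.Var A)} (h : (z, s) ∈ T.lang) :
    s.length = z.length + 1 := by
  obtain ⟨p, -, q, -, r, hr, rfl⟩ := h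
  simp [Run.length_eq hr]

theorem exists_delayResync [Finite A] (hrel : T₁.rel = T₂.rel) (hfun : T₁.Functional) :
    ∃ k l, 0 < l ∧ ∀ z s r, (z, s) ∈ T₁.lang → (z, r) ∈ T₂.lang →
      (s, r) ∈ delayResync T₁.outVar T₂.outVar k l ∧
        (r, s) ∈ delayResync T₂.outVar T₁.outVar k l := by
  have hfun₂ : T₂.Functional := fun z y y' h h' => hfun z y y' (hrel ▸ h) (hrel ▸ h')
  obtain ⟨p₁, h₁⟩ := exists_period_of_weight_lt hrel hfun
  obtain ⟨p₂, h₂⟩ := exists_period_of_weight_lt hrel.symm hfun₂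
  -- Every possible period `g ≤ p₁ + p₂` divides `l` and satisfies `2 * g ≤ l`, as
  -- `not_mem_cuts_of_period` requires; the radius is then `2 * l`.
  set l := 2 * (p₁ + p₂ + 1).factorial with hl
  have hl0 : 0 < l := by positivity
  obtain ⟨k₁, hk₁⟩ := h₁ (2 * l)
  obtain ⟨k₂, hk₂⟩ := h₂ (2 * l)
  have hcut : ∀ (g j : ℕ) (W : List A), 0 < g → g ≤ p₁ + p₂ → 2 * l ≤ j → j + 2 * l ≤ W.length →
      (window W (j - 2 * l) (j + 2 * l)).HasPeriod g → j ∉ cuts l W := by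
    intro g j W hg hgp hj hj' hper
    have hdvd : g ∣ (p₁ + p₂ + 1).factorial := Nat.dvd_factorial hg (by omega)
    have hle := Nat.le_of_dvd (Nat.factorial_pos _) hdvd
    exact not_mem_cuts_of_period hl0 hg (by omega) (hdvd.mul_left 2) le_rfl hj hj' hper
  have hdiff : ∀ z s r, (z, s) ∈ T₁.lang → (z, r) ∈ T₂.lang →
      output T₁.outVar s = output T₂.outVar r → ∀ j ∈ cuts l (output T₁.outVar s),
      ∀ t ≤ z.length + 1,
      weight T₁.outVar j t s ≤ weight T₂.outVar j t r + (k₁ + k₂) ∧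
        weight T₂.outVar j t r ≤ weight T₁.outVar j t s + (k₁ + k₂) := by
    intro z s r hs hr hout j hj t ht
    have hjl := le_length_of_mem_cuts hj
    rcases Nat.lt_succ_iff_lt_or_eq.1 (Nat.lt_succ_iff.2 ht) with ht | rfl
    · constructor
      · by_contra hlt
        obtain ⟨a1, a2, g, hg, hgp, hper⟩ := hk₂ z r s hr hs j (hout ▸ hjl) t (by omega) (by omega)
        rw [← hout] at a2 hper
        exact hcut g j _ hg (by omega) a1 a2 hper hj
      · by_contra hlt
        obtain ⟨a1, a2, g, hg, hgp, hper⟩ := hk₁ z s r hs hr j hjl t (by omega) (by omega)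
        exact hcut g j _ hg (by omega) a1 a2 hper hj
    -- The sequences have one substitution more than the input has letters. At this last time every
    -- origin counts and both weights are `j`.
    · have e1 := weight_length T₁.outVar s hjl
      have e2 := weight_length T₂.outVar r (hout ▸ hjl)
      rw [length_of_mem_lang hs] at e1
      rw [length_of_mem_lang hr] at e2
      omega
  refine ⟨k₁ + k₂, l, hl0, fun z s r hs hr => ?_⟩
  have hout : output T₁.outVar s = output T₂.outVar r :=
    hfun z _ _ ⟨s, hs, rfl⟩ (hrel ▸ ⟨r, hr, rfl⟩)
  have hlen : s.length = r.length :=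
    (length_of_mem_lang hs).trans (length_of_mem_lang hr).symm
  refine ⟨⟨hlen, hout, ?_⟩, ⟨hlen.symm, hout.symm, ?_⟩⟩
  · refine Finset.sup_le fun j hj => Finset.sup_le fun t ht => ?_
    have := hdiff z s r hs hr hout j hj t
      ((Finset.mem_Icc.1 ht).2.trans (length_of_mem_lang hs).le)
    simp only [diff]
    omega
  · refine Finset.sup_le fun j hj => Finset.sup_le fun t ht => ?_
    have := hdiff z s r hs hr hout j (hout ▸ hj) t
      ((Finset.mem_Icc.1 ht).2.trans (length_of_mem_lang hr).le)
    simp only [diff]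
    omega

theorem exists_delayEquivalent [Finite A] (hrel : T₁.Equivalent T₂) (hfun : T₁.Functional) :
    ∃ k l, 0 < l ∧ T₁.DelayEquivalent k l T₂ := by
  obtain ⟨k, l, hl, h⟩ := exists_delayResync hrel hfun
  have hrel' : T₁.rel = T₂.rel := hrel
  refine ⟨k, l, hl, fun z s hs => ?_, fun z r hr => ?_⟩
  · obtain ⟨r, hr, -⟩ : (z, output T₁.outVar s) ∈ T₂.rel := hrel' ▸ ⟨s, hs, rfl⟩
    exact ⟨r, hr, (h z s r hs hr).1⟩
  · obtain ⟨s, hs, -⟩ : (z, output T₂.outVar r) ∈ T₁.rel := hrel' ▸ ⟨r, hr, rfl⟩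
    exact ⟨s, hs, (h z s r hs hr).2⟩

/-! ### Equivalence from delay equivalence, and deterministic transducers -/

lemma DelayIncluded.rel_subset {k l : ℕ} (h : DelayIncluded k l T₁ T₂) : T₁.rel ⊆ T₂.rel := by
  rintro ⟨z, y⟩ ⟨s, hs, hy⟩
  obtain ⟨r, hr, -, hout, -⟩ := h z s hs
  exact ⟨r, hr, hy.trans hout⟩

lemma DelayEquivalent.equivalent {k l : ℕ} (h : T₁.DelayEquivalent k l T₂) : T₁.Equivalent T₂ :=
  h.1.rel_subset.antisymm h.2.rel_subset

lemma Run.eq_of_deterministic (hT : T.Deterministic) {p q q' : T.State} {z : List A}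
    {s s' : List (Subst T.Var A)} (h : T.Run p z s q) (h' : T.Run p z s' q') :
    s = s' ∧ q = q' := by
  induction h generalizing s' with
  | nil =>
    cases h'
    exact ⟨rfl, rfl⟩
  | @cons p q r a z s hs _ ih =>
    rcases h' with _ | ⟨hs', h'⟩
    obtain ⟨x, hx⟩ := hT.2 p a
    rw [hx, Set.mem_singleton_iff] at hs hs'
    subst hs
    subst hs'
    obtain ⟨rfl, rfl⟩ := ih h'
    exact ⟨rfl, rfl⟩

lemma Deterministic.functional (hT : T.Deterministic) : T.Functional := by
  rintro z y y' ⟨s, ⟨p, hp, q, -, r, hr, rfl⟩, rfl⟩ ⟨s', ⟨p', hp', q', -, r', hr', rfl⟩, rfl⟩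
  obtain ⟨x, hx⟩ := hT.1
  rw [hx, Set.mem_singleton_iff] at hp hp'
  subst hp
  subst hp'
  obtain ⟨rfl, rfl⟩ := hr.eq_of_deterministic hT hr'
  rfl

end SST

theorem mainTheorem6 {A : Type*} [Finite A] (T : SST A) (hT : T.Functional) (m : ℕ) :
    ∃ k l : ℕ, 0 < l ∧
      ((∃ T' : SST A, T'.Functional ∧ T'.numVars = m ∧ T.Equivalent T') ↔
        ∃ T'' : SST A, T''.Functional ∧ T''.numVars = m ∧ T.DelayEquivalent k l T'') ∧
      ((∃ T' : SST A, T'.Deterministic ∧ T'.numVars = m ∧ T.Equivalent T') ↔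
        ∃ T'' : SST A, T''.Deterministic ∧ T''.numVars = m ∧ T.DelayEquivalent k l T'') := by
  -- One pair `k`, `l` must serve both claims. A deterministic witness is functional, so it settles
  -- both at once; without one the second claim holds for every pair, and `k`, `l` can be chosen for
  -- the first alone.
  by_cases hdet : ∃ T' : SST A, T'.Deterministic ∧ T'.numVars = m ∧ T.Equivalent T'
  · obtain ⟨T', h1, h2, h3⟩ := hdet
    obtain ⟨k, l, hl, h4⟩ := SST.exists_delayEquivalent h3 hT
    exact ⟨k, l, hl,
      iff_of_true ⟨T', h1.functional, h2, h3⟩ ⟨T', h1.functional, h2, h4⟩,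
      iff_of_true ⟨T', h1, h2, h3⟩ ⟨T', h1, h2, h4⟩⟩
  have hdet' : ∀ k l, ¬ ∃ T'' : SST A, T''.Deterministic ∧ T''.numVars = m ∧
      T.DelayEquivalent k l T'' := by
    rintro k l ⟨T', h1, h2, h3⟩
    exact hdet ⟨T', h1, h2, h3.equivalent⟩
  by_cases hfun : ∃ T' : SST A, T'.Functional ∧ T'.numVars = m ∧ T.Equivalent T'
  · obtain ⟨T', h1, h2, h3⟩ := hfun
    obtain ⟨k, l, hl, h4⟩ := SST.exists_delayEquivalent h3 hT
    exact ⟨k, l, hl, iff_of_true ⟨T', h1, h2, h3⟩ ⟨T', h1, h2, h4⟩,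
      iff_of_false hdet (hdet' k l)⟩
  · refine ⟨0, 1, one_pos, iff_of_false hfun ?_, iff_of_false hdet (hdet' 0 1)⟩
    rintro ⟨T', h1, h2, h3⟩
    exact hfun ⟨T', h1, h2, h3.equivalent⟩
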